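/- Let $G=\mathbb Z_2^3$, with elements $g_0=(0,0,0)$, $g_1=(1,0,0)$, $g_2=(0,1,0)$, $g_3=(0,0,1)$, $g_4=(1,1,1)$, $g_5=(1,1,0)$, $g_6=(1,0,1)$, $g_7=(0,1,1)$. Let $\mathcal O$ be the complex octonion algebra with its standard basis $e_0=1,e_1,\dots,e_7$, graded by $\mathcal O_{g_i}=\mathbb C e_i$, and let $n(\sum x_ie_i,\sum y_ie_i)=\sum x_iy_i$. Put $$\mathfrak d_4=\{f\in\mathfrak{gl}(\mathcal O): n(f(x),y)+n(x,f(y))=0\ \ \forall x,y\},\qquad \mathfrak b_3=\{f\in\mathfrak d_4: f(1)=0\},$$ and for $\mathcal L\in\{\mathfrak b_3,\mathfrak d_4\}$ let $\Gamma_{\mathcal L}$ be the $G$-grading $\mathcal L=\bigoplus_{g\in G}\mathcal L_g$ with $\mathcal L_g=\{f\in\mathcal L: f(\mathcal O_h)\subseteq\mathcal O_{g+h}\ \ \forall h\in G\}$. A graded contraction of $\Gamma_{\mathcal L}$ is a map $\varepsilon\colon G\times G\to\mathbb C$ such that the vector space $\mathcal L$ with the bilinear product determined by $[x,y]^\varepsilon=\varepsilon(g,h)[x,y]$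 for $x\in\mathcal L_g$, $y\in\mathcal L_h$, is a Lie algebra, denoted $\mathcal L^\varepsilon$. Two graded contractions are equivalent, $\varepsilon\sim\varepsilon'$, if there is a Lie algebra isomorphism $f\colon\mathcal L^\varepsilon\to\mathcal L^{\varepsilon'}$ such that for every $g\in G$ there is $h\in G$ with $f(\mathcal L_g)=\mathcal L_h$. Given values $\varepsilon_{ij}=\varepsilon_{ji}$ for $1\le i<j\le 7$, let $\varepsilon$ also denote the map $G\times G\to\mathbb C$ with $\varepsilon(g_i,g_j)=\varepsilon_{ij}$ for distinct $i,j\in\{1,\dots,7\}$ and $\varepsilon(g,g)=\varepsilon(g_0,g)=\varepsilon(g,g_0)=0$ for all $g\in G$. For a set $T$ of two-element subsets of $\{1,\dots,7\}$, let $\varepsilon^T$ be the map with $\varepsilon^T_{ij}=1$ if $\{i,j\}\in T$ and $\varepsilon^T_{ij}=0$ otherwise. Write $ij$ for $\{i,j\}$, let $X$ be the set of all 21 two-element subsets of $\{1,\dots,7\}$, and let $T_1=\emptyset$, $T_2=\{12\}$, $T_3=\{12,13\}$, $T_4=\{12,15\}$, $T_5=\{12,67\}$, $T_6=\{12,15,25\}$,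 $T_7=\{25,36,47\}$, $T_8=\{12,13,14\}$, $T_9=\{12,13,15\}$, $T_{10}=\{12,13,17\}$, $T_{11}=\{12,16,26\}$, $T_{12}=\{12,16,67\}$, $T_{13}=\{12,13,14,15\}$, $T_{14}=\{12,13,15,16\}$, $T_{15}=\{12,16,17,26\}$, $T_{16}=\{12,16,27,67\}$, $T_{17}=\{12,13,14,15,16\}$, $T_{18}=\{12,16,17,26,27\}$, $T_{19}=\{34,36,37,46,47,67\}$, $T_{20}=\{12,13,14,15,16,17\}$, $T_{21}=\{12,13,17,23,26,35\}$, $T_{22}=T_{21}\cup\{14,15,16,56\}$, $T_{23}=X\setminus T_{19}$, $T_{24}=X$. For $\lambda,\mu\in\mathbb C^\times$, let $\alpha^{\lambda}$, $\beta^\lambda$, $\gamma^{\lambda,\mu}$ be the maps with supports $T_{14}$, $T_{17}$, $T_{20}$ and values $$(\alpha_{12},\alpha_{13},\alpha_{15},\alpha_{16})=(1,1,1,\lambda),\qquad (\beta_{12},\beta_{13},\beta_{14},\beta_{15},\beta_{16})=(1,\lambda,1,1,\lambda),$$ $$(\gamma_{12},\gamma_{13},\gamma_{14},\gamma_{15},\gamma_{16},\gamma_{17})=(1,\lambda,\mu,1,\lambda,\mu).$$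 **Theorem.** Let $\mathcal L\in\{\mathfrak b_3,\mathfrak d_4\}$. The 20 maps $\varepsilon^{T_i}$ with $1\le i\le 24$, $i\notin\{8,14,17,20\}$, and all the maps $\alpha^\lambda$, $\beta^\lambda$, $\gamma^{\lambda,\mu}$ with $\lambda,\mu\in\mathbb C^\times$, are graded contractions of $\Gamma_{\mathcal L}$, and every graded contraction of $\Gamma_{\mathcal L}$ is equivalent to at least one of them. The 20 maps $\varepsilon^{T_i}$ are pairwise inequivalent, none of them is equivalent to a member of one of the three families, and members of different families are inequivalent. Within the families, for all nonzero complex parameters: 1. $\alpha^\lambda\sim\alpha^{\lambda'}$ if and only if $\lambda'\in\{\lambda,\frac1\lambda\}$; 2. $\beta^\lambda\sim\beta^{\lambda'}$ if and only if $\lambda'\in\{\pm\lambda,\pm\frac1\lambda\}$; 3. $\gamma^{\lambda,\mu}\sim\gamma^{\lambda',\mu'}$ if and only if the set $\{\pm\lambda',\pm\mu'\}$ coincides with $\{\pm\lambda,\pm\mu\}$ or $\{\pm\frac1\lambda,\pm\frac\mu\lambda\}$ or $\{\pm\frac\lambda\mu,\pm\frac1\mu\}$. -/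

import Mathlib

/- Endomorphisms carry the commutator bracket. -/
attribute [local instance 100] LieRing.ofAssociativeRing

/-! ### Group gradings on complex Lie algebras and their graded contractions -/

/-- A grading of a complex Lie algebra `L` by an abelian group `A`: a vector space decomposition
`L = ⨁ L_g` with `⁅L_g, L_h⁆ ⊆ L_{g+h}`. -/
structure LieGrading (A : Type*) [AddCommGroup A] [DecidableEq A]
    (L : Type*) [LieRing L] [LieAlgebra ℂ L] where
  comp : A → Submodule ℂ L
  isInternal : DirectSum.IsInternal comp
  lie_mem : ∀ {g h : A} {x y : L}, x ∈ comp g → y ∈ comp h → ⁅x, y⁆ ∈ comp (g + h)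

namespace LieGrading

variable {A : Type*} [AddCommGroup A] [DecidableEq A] {L : Type*} [LieRing L] [LieAlgebra ℂ L]

/-- The projection of `L` onto the homogeneous component of degree `g`, as a map into `L`. -/
noncomputable def proj (Γ : LieGrading A L) (g : A) : L →ₗ[ℂ] L :=
  (Γ.comp g).subtype ∘ₗ DirectSum.component ℂ A (fun a => Γ.comp a) g ∘ₗ
    (LinearEquiv.ofBijective (DirectSum.coeLinearMap Γ.comp) Γ.isInternal).symm.toLinearMap

theorem proj_of_mem (Γ : LieGrading A L) {g : A} {x : L} (hx : x ∈ Γ.comp g) :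
    Γ.proj g x = x :=
  congrArg Subtype.val (DirectSum.IsInternal.ofBijective_coeLinearMap_of_mem Γ.isInternal hx)

theorem proj_of_mem_ne (Γ : LieGrading A L) {g h : A} (hgh : g ≠ h) {x : L}
    (hx : x ∈ Γ.comp g) : Γ.proj h x = 0 :=
  congrArg Subtype.val
    (DirectSum.IsInternal.ofBijective_coeLinearMap_of_mem_ne Γ.isInternal hgh hx)

/-- The contracted product: the bilinear map on `L` with `[x, y]^ε = ε(g, h) [x, y]` for
`x ∈ L_g` and `y ∈ L_h`. -/
noncomputable def bracket [Fintype A] (Γ : LieGrading A L) (ε : A → A → ℂ) :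
    L →ₗ[ℂ] L →ₗ[ℂ] L :=
  ∑ g : A, ∑ h : A,
    ε g h • ((LieModule.toEnd ℂ L L : L →ₗ[ℂ] Module.End ℂ L).compl₁₂ (Γ.proj g) (Γ.proj h))

theorem bracket_of_mem [Fintype A] (Γ : LieGrading A L) (ε : A → A → ℂ) {g h : A} {x y : L}
    (hx : x ∈ Γ.comp g) (hy : y ∈ Γ.comp h) : Γ.bracket ε x y = ε g h • ⁅x, y⁆ := by
  simp only [bracket, LinearMap.sum_apply, LinearMap.smul_apply, LinearMap.compl₁₂_apply]
  rw [Finset.sum_eq_single g, Finset.sum_eq_single h]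
  · rw [Γ.proj_of_mem hx, Γ.proj_of_mem hy]; rfl
  · intro b _ hb
    rw [Γ.proj_of_mem_ne (Ne.symm hb) hy]; simp
  · simp
  · intro a _ ha
    rw [Γ.proj_of_mem_ne (Ne.symm ha) hx]; simp
  · simp

/-- `ε` is a graded contraction of `Γ`: the vector space `L` with the contracted product is a
Lie algebra. -/
def IsGradedContraction [Fintype A] (Γ : LieGrading A L) (ε : A → A → ℂ) : Prop :=
  (∀ x : L, Γ.bracket ε x x = 0) ∧
  ∀ x y z : L, Γ.bracket ε x (Γ.bracket ε y z) + Γ.bracket ε y (Γ.bracket ε z x) +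
    Γ.bracket ε z (Γ.bracket ε x y) = 0

/-- Equivalence of graded contractions: there is an isomorphism `f : L^ε → L^ε'` which sends each
homogeneous component onto some homogeneous component. -/
def Equivalent [Fintype A] (Γ : LieGrading A L) (ε ε' : A → A → ℂ) : Prop :=
  ∃ f : L ≃ₗ[ℂ] L,
    (∀ x y : L, f (Γ.bracket ε x y) = Γ.bracket ε' (f x) (f y)) ∧
    ∀ g : A, ∃ h : A, (Γ.comp g).map (f : L →ₗ[ℂ] L) = Γ.comp h

end LieGrading

/-! ### The gradings on `𝔟₃` and `𝔡₄` -/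

namespace Octonion

/-- The grading group `ℤ₂³`. -/
abbrev G : Type := ZMod 2 × ZMod 2 × ZMod 2

/-- The degree `g_i` of the `i`-th basic octonion `e_i`. -/
def deg : Fin 8 → G :=
  ![(0, 0, 0), (1, 0, 0), (0, 1, 0), (0, 0, 1), (1, 1, 1), (1, 1, 0), (1, 0, 1), (0, 1, 1)]

/-- The inverse of `deg`, that is, `idx (g_i) = i`. -/
def idx (g : G) : Fin 8 :=
  if g.1 = 0 then
    if g.2.1 = 0 then (if g.2.2 = 0 then 0 else 3) else (if g.2.2 = 0 then 2 else 7)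
  else
    if g.2.1 = 0 then (if g.2.2 = 0 then 1 else 6) else (if g.2.2 = 0 then 5 else 4)

theorem deg_idx : ∀ g : G, deg (idx g) = g := by decide

theorem idx_deg : ∀ i : Fin 8, idx (deg i) = i := by decide

/-- The underlying vector space of the complex octonion algebra, in coordinates with respect to
its standard basis `e_0 = 1, e_1, …, e_7`. -/
abbrev Oct : Type := Fin 8 → ℂ

/-- The basic octonion `e_i`; in particular `e 0` is the identity element. -/
def e (i : Fin 8) : Oct := Pi.single i 1

/-- The polar form `n(∑ x_i e_i, ∑ y_i e_i) = ∑ x_i y_i` of the norm. -/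
def n : LinearMap.BilinForm ℂ Oct := dotProductBilin ℂ ℂ

/-- `𝔡₄ = 𝔰𝔬(𝒪, n) = {f | n(f(x), y) + n(x, f(y)) = 0}`. -/
noncomputable def d4 : LieSubalgebra ℂ (Module.End ℂ Oct) := skewAdjointLieSubalgebra n

/-- `𝔟₃ = {f ∈ 𝔰𝔬(𝒪, n) | f(1) = 0}`. -/
noncomputable def b3 : LieSubalgebra ℂ (Module.End ℂ Oct) :=
  { d4.toSubmodule ⊓ LinearMap.ker (LinearMap.applyₗ (R := ℂ) (M₂ := Oct) (e 0)) with
    lie_mem' := by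
      intro x y hx hy
      obtain ⟨hx1, hx2⟩ := hx
      obtain ⟨hy1, hy2⟩ := hy
      refine ⟨d4.lie_mem hx1 hy1, ?_⟩
      have hx3 : x (e 0) = 0 := by simpa using hx2
      have hy3 : y (e 0) = 0 := by simpa using hy2
      simp [LieRing.of_associative_ring_bracket, hx3, hy3] }

theorem mem_d4_iff {f : Module.End ℂ Oct} :
    f ∈ d4 ↔ ∀ x y : Oct, n (f x) y + n x (f y) = 0 := by
  have h : f ∈ d4 ↔ ∀ x y : Oct, n (f x) y = n x ((-f) y) := by
    unfold d4
    exact LinearMap.mem_skewAdjointSubmodule (B := n) (f := f)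
  rw [h]
  simp [eq_neg_iff_add_eq_zero]

theorem mem_b3_iff {f : Module.End ℂ Oct} : f ∈ b3 ↔ f ∈ d4 ∧ f (e 0) = 0 := by
  have : f ∈ b3 ↔ f ∈ d4.toSubmodule ⊓
    LinearMap.ker (LinearMap.applyₗ (R := ℂ) (M₂ := Oct) (e 0)) := Iff.rfl
  rw [this]
  simp

/-- The homogeneous component `𝒪_g`, spanned by the basic octonion of degree `g`. -/
def octComp (g : G) : Submodule ℂ Oct := Submodule.span ℂ {e (idx g)}

/-- `𝔤𝔩(𝒪)_g = {f | f(𝒪_h) ⊆ 𝒪_{g+h} for all h}`. -/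
def glComp (g : G) : Submodule ℂ (Module.End ℂ Oct) where
  carrier := {f | ∀ h : G, ∀ x ∈ octComp h, f x ∈ octComp (g + h)}
  zero_mem' := by intro h x _; simp
  add_mem' := by
    intro a b ha hb h x hx
    exact Submodule.add_mem _ (ha h x hx) (hb h x hx)
  smul_mem' := by
    intro c a ha h x hx
    exact Submodule.smul_mem _ c (ha h x hx)

theorem mem_octComp {g : G} {x : Oct} : x ∈ octComp g ↔ ∀ i, i ≠ idx g → x i = 0 := by
  unfold octComp e
  rw [Submodule.mem_span_singleton]
  constructor
  · rintro ⟨c, rfl⟩ i hi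
    simp [hi]
  · intro h
    refine ⟨x (idx g), ?_⟩
    ext i
    by_cases hi : i = idx g
    · subst hi; simp
    · simp [hi, h i hi]

theorem mem_glComp {g : G} {f : Module.End ℂ Oct} :
    f ∈ glComp g ↔ ∀ i j : Fin 8, i ≠ idx (g + deg j) → f (e j) i = 0 := by
  constructor
  · intro hf i j hij
    have h1 : e j ∈ octComp (deg j) := by
      unfold octComp
      rw [idx_deg]
      exact Submodule.mem_span_singleton_self _
    exact mem_octComp.1 (hf _ _ h1) i hij
  · intro hf h x hx
    obtain ⟨c, rfl⟩ := Submodule.mem_span_singleton.1 hx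
    rw [map_smul]
    refine Submodule.smul_mem _ _ (mem_octComp.2 ?_)
    intro i hi
    apply hf
    rwa [deg_idx]

/-- The component of degree `g` of an endomorphism. -/
def glProj (g : G) (f : Module.End ℂ Oct) : Module.End ℂ Oct where
  toFun x i := x (idx (deg i + g)) * f (e (idx (deg i + g))) i
  map_add' x y := by ext i; simp [add_mul]
  map_smul' c x := by ext i; simp [mul_assoc]

theorem add_add_self : ∀ a b : G, a + b + b = a := by decide

theorem glProj_e (g : G) (f : Module.End ℂ Oct) (i j : Fin 8) :
    glProj g f (e j) i = if j = idx (deg i + g) then f (e j) i else 0 := by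
  have : glProj g f (e j) i = e j (idx (deg i + g)) * f (e (idx (deg i + g))) i := rfl
  rw [this]
  split_ifs with h
  · rw [← h]; simp [e]
  · have h0 : e j (idx (deg i + g)) = 0 := by
      unfold e
      exact Pi.single_eq_of_ne (Ne.symm h) _
    rw [h0, zero_mul]

theorem idx_eq_iff (i j : Fin 8) (g : G) : j = idx (deg i + g) ↔ i = idx (g + deg j) := by
  constructor
  · rintro rfl
    rw [deg_idx, add_comm (deg i) g, ← add_assoc, add_comm (g + g), ← add_assoc,
      add_add_self, idx_deg]
  · rintro rfl
    rw [deg_idx, add_comm g (deg j), add_add_self, idx_deg]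

theorem end_ext {f f' : Module.End ℂ Oct} (h : ∀ i j, f (e j) i = f' (e j) i) : f = f' := by
  apply LinearMap.pi_ext'
  intro j
  ext i
  exact h i j

theorem glProj_mem (g : G) (f : Module.End ℂ Oct) : glProj g f ∈ glComp g := by
  rw [mem_glComp]
  intro i j hij
  rw [glProj_e, if_neg]
  rwa [idx_eq_iff]

theorem glProj_of_mem {g : G} {f : Module.End ℂ Oct} (hf : f ∈ glComp g) : glProj g f = f := by
  apply end_ext
  intro i j
  rw [glProj_e]
  split_ifs with h
  · rfl
  · rw [mem_glComp.1 hf i j (fun h' => h ((idx_eq_iff i j g).2 h'))]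

theorem glProj_of_mem_ne {g h : G} (hgh : g ≠ h) {f : Module.End ℂ Oct} (hf : f ∈ glComp g) :
    glProj h f = 0 := by
  apply end_ext
  intro i j
  rw [glProj_e]
  split_ifs with hij
  · apply mem_glComp.1 hf
    intro hi
    apply hgh
    rw [idx_eq_iff] at hij
    have := congrArg deg (hi.symm.trans hij)
    rw [deg_idx, deg_idx] at this
    exact add_right_cancel this
  · rfl

theorem sum_glProj (f : Module.End ℂ Oct) : ∑ g, glProj g f = f := by
  apply end_ext
  intro i j
  rw [LinearMap.sum_apply, Finset.sum_apply]
  simp_rw [glProj_e]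
  rw [Finset.sum_eq_single (deg i + deg j)]
  · rw [if_pos]
    rw [← add_assoc, add_comm (deg i + deg i), ← add_assoc, add_add_self, idx_deg]
  · intro b _ hb
    rw [if_neg]
    rintro rfl
    apply hb
    rw [deg_idx, ← add_assoc, add_comm (deg i + deg i), ← add_assoc, add_add_self]
  · simp

theorem glProj_add (g : G) (f f' : Module.End ℂ Oct) :
    glProj g (f + f') = glProj g f + glProj g f' := by
  apply end_ext
  intro i j
  rw [LinearMap.add_apply, Pi.add_apply, glProj_e, glProj_e, glProj_e]
  split_ifs <;> simp

theorem glProj_mem_d4 {f : Module.End ℂ Oct} (hf : f ∈ d4) (g : G) : glProj g f ∈ d4 := by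
  have hsk : ∀ i j, f (e j) i = - f (e i) j := by
    intro i j
    have := mem_d4_iff.1 hf (e j) (e i)
    have h2 : f (e j) i + f (e i) j = 0 := by
      simpa [n, dotProductBilin, e] using this
    exact eq_neg_of_add_eq_zero_left h2
  let τ : Fin 8 ≃ Fin 8 :=
    { toFun := fun i => idx (deg i + g)
      invFun := fun i => idx (deg i + g)
      left_inv := fun i => by simp [deg_idx, add_add_self, idx_deg]
      right_inv := fun i => by simp [deg_idx, add_add_self, idx_deg] }
  have hττ : ∀ i, τ (τ i) = i := fun i => τ.left_inv i
  rw [mem_d4_iff]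
  intro x y
  have h1 : n (glProj g f x) y = ∑ i, x (τ i) * f (e (τ i)) i * y i := rfl
  have h2 : n x (glProj g f y) = ∑ i, x i * (y (τ i) * f (e (τ i)) i) := rfl
  rw [h1, h2, ← Equiv.sum_comp τ (fun i => x i * (y (τ i) * f (e (τ i)) i)),
    ← Finset.sum_add_distrib]
  apply Finset.sum_eq_zero
  intro i _
  rw [hττ, hsk i (τ i)]
  ring

theorem glProj_mem_b3 {f : Module.End ℂ Oct} (hf : f ∈ b3) (g : G) : glProj g f ∈ b3 := by
  rw [mem_b3_iff] at hf ⊢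
  refine ⟨glProj_mem_d4 hf.1 g, ?_⟩
  ext i
  rw [glProj_e, hf.2]
  simp

theorem isInternal_of_proj {ι M : Type*} [Fintype ι] [DecidableEq ι] [AddCommGroup M] [Module ℂ M]
    (comp : ι → Submodule ℂ M) (P : ι → M → M)
    (hadd : ∀ g x y, P g (x + y) = P g x + P g y)
    (hmem : ∀ g x, P g x ∈ comp g)
    (hsame : ∀ g x, x ∈ comp g → P g x = x)
    (hne : ∀ g h, g ≠ h → ∀ x, x ∈ comp g → P h x = 0)
    (hsum : ∀ x, ∑ g, P g x = x) : DirectSum.IsInternal comp := by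
  have key : ∀ (w : DirectSum ι (fun i => comp i)) (g : ι),
      P g (DirectSum.coeAddMonoidHom comp w) = w g := by
    intro w g
    induction w using DirectSum.induction_on with
    | zero => simpa using hsame g 0 (Submodule.zero_mem _)
    | of a z =>
      rw [DirectSum.coeAddMonoidHom_of]
      by_cases h : a = g
      · subst h
        rw [DirectSum.of_eq_same, hsame _ _ z.2]
      · rw [DirectSum.of_eq_of_ne _ _ _ (Ne.symm h), hne a g h _ z.2]
        rfl
    | add x y hx hy =>
      rw [map_add, hadd, hx, hy]
      rfl
  constructor
  · intro w w' h
    ext g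
    rw [← key w g, ← key w' g, h]
  · intro x
    refine ⟨∑ g, DirectSum.of (fun i => comp i) g ⟨P g x, hmem g x⟩, ?_⟩
    rw [map_sum]
    simp only [DirectSum.coeAddMonoidHom_of]
    exact hsum x

/-- The grading `K = ⨁ (K ∩ 𝔤𝔩(𝒪)_g)` inherited from `𝔤𝔩(𝒪)` by a subalgebra `K` which is a graded
subspace. -/
noncomputable def inheritedGrading (K : LieSubalgebra ℂ (Module.End ℂ Oct))
    (hK : ∀ f ∈ K, ∀ g, glProj g f ∈ K) : LieGrading G K where
  comp g := (glComp g).comap K.toSubmodule.subtype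
  isInternal := by
    refine isInternal_of_proj _ (fun g f => ⟨glProj g f.1, hK f.1 f.2 g⟩) ?_ ?_ ?_ ?_ ?_
    · intro g f f'
      apply Subtype.ext
      exact glProj_add g f.1 f'.1
    · intro g f
      exact glProj_mem g f.1
    · intro g f hf
      apply Subtype.ext
      exact glProj_of_mem hf
    · intro g h hgh f hf
      apply Subtype.ext
      exact glProj_of_mem_ne hgh hf
    · intro f
      apply Subtype.ext
      rw [AddSubmonoidClass.coe_finsetSum]
      exact sum_glProj f.1
  lie_mem := by
    intro g h x y hx hy
    have hx' : x.1 ∈ glComp g := hx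
    have hy' : y.1 ∈ glComp h := hy
    change ⁅x.1, y.1⁆ ∈ glComp (g + h)
    rw [LieRing.of_associative_ring_bracket]
    refine Submodule.sub_mem _ ?_ ?_
    · intro k z hz
      have := hx' _ _ (hy' k z hz)
      rwa [← add_assoc] at this
    · intro k z hz
      have := hy' _ _ (hx' k z hz)
      rwa [← add_assoc, add_comm h g] at this

/-- The two types of orthogonal Lie algebras under consideration. -/
inductive OrthType
  | b3
  | d4

/-- The Lie algebra of the given type. -/
noncomputable def alg : OrthType → LieSubalgebra ℂ (Module.End ℂ Oct)
  | .b3 => b3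
  | .d4 => d4

/-- The `ℤ₂³`-gradings `Γ_{𝔟₃}` and `Γ_{𝔡₄}`. -/
noncomputable def Γ : (t : OrthType) → LieGrading G (alg t)
  | .b3 => inheritedGrading b3 (fun _ hf g => glProj_mem_b3 hf g)
  | .d4 => inheritedGrading d4 (fun _ hf g => glProj_mem_d4 hf g)

/-! ### The representatives -/

/-- The set of the 21 edges `{i, j}`, `1 ≤ i < j ≤ 7`. -/
def X : Finset (Sym2 (Fin 8)) := Finset.univ.filter (fun a => ¬ a.IsDiag ∧ 0 ∉ a)

/-- The nice sets `T_1, …, T_24` (the values at other indices are irrelevant). -/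
def T : ℕ → Finset (Sym2 (Fin 8))
  | 1 => ∅
  | 2 => {s(1, 2)}
  | 3 => {s(1, 2), s(1, 3)}
  | 4 => {s(1, 2), s(1, 5)}
  | 5 => {s(1, 2), s(6, 7)}
  | 6 => {s(1, 2), s(1, 5), s(2, 5)}
  | 7 => {s(2, 5), s(3, 6), s(4, 7)}
  | 8 => {s(1, 2), s(1, 3), s(1, 4)}
  | 9 => {s(1, 2), s(1, 3), s(1, 5)}
  | 10 => {s(1, 2), s(1, 3), s(1, 7)}
  | 11 => {s(1, 2), s(1, 6), s(2, 6)}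
  | 12 => {s(1, 2), s(1, 6), s(6, 7)}
  | 13 => {s(1, 2), s(1, 3), s(1, 4), s(1, 5)}
  | 14 => {s(1, 2), s(1, 3), s(1, 5), s(1, 6)}
  | 15 => {s(1, 2), s(1, 6), s(1, 7), s(2, 6)}
  | 16 => {s(1, 2), s(1, 6), s(2, 7), s(6, 7)}
  | 17 => {s(1, 2), s(1, 3), s(1, 4), s(1, 5), s(1, 6)}
  | 18 => {s(1, 2), s(1, 6), s(1, 7), s(2, 6), s(2, 7)}
  | 19 => {s(3, 4), s(3, 6), s(3, 7), s(4, 6), s(4, 7), s(6, 7)}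
  | 20 => {s(1, 2), s(1, 3), s(1, 4), s(1, 5), s(1, 6), s(1, 7)}
  | 21 => {s(1, 2), s(1, 3), s(1, 7), s(2, 3), s(2, 6), s(3, 5)}
  | 22 => {s(1, 2), s(1, 3), s(1, 7), s(2, 3), s(2, 6), s(3, 5),
      s(1, 5), s(1, 6), s(5, 6), s(1, 4)}
  | 23 => X \ {s(3, 4), s(3, 6), s(3, 7), s(4, 6), s(4, 7), s(6, 7)}
  | 24 => X
  | _ => ∅

/-- The symmetric admissible map `ε : G × G → ℂ` attached to a function `c` on the edges:
`ε(g_i, g_j) = c({i, j})` for distinct nonzero `i, j`, and `ε(g, g) = ε(e, g) = ε(g, e) = 0`. -/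
def ofEdges (c : Sym2 (Fin 8) → ℂ) (g h : G) : ℂ :=
  if g = 0 ∨ h = 0 ∨ g = h then 0 else c s(idx g, idx h)

/-- `ε^{T_i}`, with value `1` on the edges in `T_i` and `0` elsewhere. -/
def epsT (i : ℕ) : G → G → ℂ := ofEdges (fun a => if a ∈ T i then 1 else 0)

/-- `(1, 1, 1, λ)`: the values at the edges `12, 13, 15, 16` of `T_14`. -/
def eps14 (l : ℂ) : G → G → ℂ :=
  ofEdges (fun a => if a = s(1, 6) then l else if a ∈ T 14 then 1 else 0)

/-- `(1, λ, 1, 1, λ)`: the values at the edges `12, 13, 14, 15, 16` of `T_17`. -/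
def eps17 (l : ℂ) : G → G → ℂ :=
  ofEdges (fun a => if a = s(1, 3) ∨ a = s(1, 6) then l else if a ∈ T 17 then 1 else 0)

/-- `(1, λ, μ, 1, λ, μ)`: the values at the edges `12, 13, 14, 15, 16, 17` of `T_20`. -/
def eps20 (l m : ℂ) : G → G → ℂ :=
  ofEdges (fun a => if a = s(1, 3) ∨ a = s(1, 6) then l
    else if a = s(1, 4) ∨ a = s(1, 7) then m else if a ∈ T 20 then 1 else 0)

/-- The indices of the isolated classes. -/
def isolated : Finset ℕ := Finset.Icc 1 24 \ {8, 14, 17, 20}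

end Octonion

/-!
The basic octonions have pairwise distinct degrees, so an element of `𝔟₃` or `𝔡₄` of degree `g` is a
skew-symmetric matrix with entries only at positions `(g + j, j)`. Brackets of skew matrix units
show that a map `ε` is a graded contraction if and only if its values at pairs of distinct points of
the Fano plane `G \ {0}` are symmetric and satisfy
`ε(g, h + k) ε(h, k) = ε(h, k + g) ε(k, g)` for `g`, `h`, `k` not collinear (`Admissible`). The
values at the other pairs do not matter, because `L₀ = 0` and all components are abelian.

*Every graded contraction is listed.* The condition above makes the support a `Nice` graph on the
seven points. A search over all graphs, which the kernel runs on bit masks, shows that every nice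
graph becomes one of the 24 sets `T_i` under a collineation (`Nice.exists_collineation`), and
collineations act by automorphisms of the Lie algebra that permute the components
(`equivalent_comp`). For a fixed support, the values are normalized by scaling the components
(`equivalent_of_scale`); for the four largest supports the admissibility condition forces most of
the values to be `1` as soon as a few of them are. The set `T_8` is not a collineation image of
`T_10`, but the two are exchanged by the adjoint action of an element of degree `g₁` on the
components of degrees `g₄` and `g₇` (`equivalent_of_swap`).

*The listed maps are inequivalent as claimed.* An equivalence induces a permutation `σ` of `G` which
preserves the support and is additive along its edges. Hence the sum over all points of
`d (d + p)²`, where `d` is the number of edges at a point and `p` the number of edges whose sum is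
this point, is an invariant of the support, and it separates the sets `T_i` with `i ≠ 8`
(`supportInvariant_injOn`). In the three families all edges pass through `g₁`, so `σ` fixes `g₁`
and permutes the three lines through it. Comparing traces of `ad x ad x'` on the components, for `x`
and `x'` of degree `g₁`, shows that the products `ε(g₁, g) ε(g₁, g₁ + g)` on the three lines are
preserved up to this permutation and a common factor (`IsEquivalence.weight_ratio`). These products
are `(1, λ, 0)`, `(1, λ², 0)` and `(1, λ², μ²)` for the three families, which gives the necessity of
the conditions on the parameters; collineations fixing `g₁` and scalings give the sufficiency.
-/

namespace Octonion

open LieGrading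

/-! ### Matrix coefficients of elements of `𝔟₃` and `𝔡₄` -/

/-- The matrix coefficient of `x` at row `k` and column `j`, rows and columns being indexed by the
degrees of the basic octonions. -/
def coeff (k j : G) : Module.End ℂ Oct →ₗ[ℂ] ℂ where
  toFun x := x (e (idx j)) (idx k)
  map_add' _ _ := rfl
  map_smul' _ _ := rfl

theorem coeff_ext {x y : Module.End ℂ Oct} (h : ∀ k j, coeff k j x = coeff k j y) : x = y := by
  apply end_ext
  intro i j
  have := h (deg i) (deg j)
  simpa [coeff, idx_deg] using this

/-- The equivalence `idx` between degrees and indices. -/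
def idxEquiv : G ≃ Fin 8 := ⟨idx, deg, deg_idx, idx_deg⟩

theorem coeff_mul (k j : G) (x y : Module.End ℂ Oct) :
    coeff k j (x * y) = ∑ m, coeff k m x * coeff m j y := by
  have h : y (e (idx j)) = ∑ m : G, (coeff m j y) • e (idx m) := by
    rw [← Equiv.sum_comp idxEquiv.symm]
    ext i
    simp [coeff, idxEquiv, e, idx_deg, Pi.single_apply]
  change x (y (e (idx j))) (idx k) = _
  rw [h, map_sum, Finset.sum_apply]
  refine Finset.sum_congr rfl fun m _ => ?_
  simp [coeff, mul_comm]

theorem mem_glComp_iff_coeff {g : G} {x : Module.End ℂ Oct} :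
    x ∈ glComp g ↔ ∀ k j, k ≠ g + j → coeff k j x = 0 := by
  rw [mem_glComp]
  constructor
  · intro h k j hkj
    refine h _ _ fun h' => hkj ?_
    rw [deg_idx] at h'
    exact idxEquiv.injective h'
  · intro h i j hij
    have := h (deg i) (deg j) fun h' => hij (by rw [← h', idx_deg])
    simpa [coeff, idx_deg] using this

theorem coeff_skew {x : Module.End ℂ Oct} (hx : x ∈ d4) (k j : G) :
    coeff k j x = - coeff j k x := by
  have := mem_d4_iff.1 hx (e (idx j)) (e (idx k))
  have h2 : x (e (idx j)) (idx k) + x (e (idx k)) (idx j) = 0 := by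
    simpa [n, dotProductBilin, e] using this
  exact eq_neg_of_add_eq_zero_left h2

theorem mem_d4_of_coeff {x : Module.End ℂ Oct} (h : ∀ k j, coeff k j x = - coeff j k x) :
    x ∈ d4 := by
  have h' : ∀ i j, x (e j) i = - x (e i) j := by
    intro i j
    have := h (deg i) (deg j)
    simpa [coeff, idx_deg] using this
  have key : (n.compl₁₂ x LinearMap.id + n.compl₁₂ LinearMap.id x) = 0 := by
    refine LinearMap.ext_basis (Pi.basisFun ℂ (Fin 8)) (Pi.basisFun ℂ (Fin 8)) fun i j => ?_
    have := h' j i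
    simp only [e] at this
    simp [n, dotProductBilin, this]
  rw [mem_d4_iff]
  intro a b
  exact congrArg (fun B : LinearMap.BilinForm ℂ Oct => B a b) key

/-- The degrees of the basic octonions that are moved by the algebra: all of them for `𝔡₄`, the
nonzero ones for `𝔟₃`. -/
def moved : OrthType → G → Bool
  | .b3, j => j ≠ 0
  | .d4, _ => true

theorem moved_of_ne (t : OrthType) {j : G} (hj : j ≠ 0) : moved t j = true := by
  cases t <;> simp [moved, hj]

theorem mem_alg_iff {t : OrthType} {x : Module.End ℂ Oct} :
    x ∈ alg t ↔ (∀ k j, coeff k j x = - coeff j k x) ∧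
      ∀ k j, moved t j = false → coeff k j x = 0 := by
  cases t
  · change x ∈ b3 ↔ _
    rw [mem_b3_iff]
    constructor
    · rintro ⟨h, h0⟩
      refine ⟨coeff_skew h, fun k j hj => ?_⟩
      have : j = 0 := by simpa [moved] using hj
      subst this
      change x (e 0) (idx k) = 0
      rw [h0]; rfl
    · rintro ⟨h, h0⟩
      refine ⟨mem_d4_of_coeff h, ?_⟩
      ext i
      have := h0 (deg i) 0 rfl
      simp only [coeff, idx_deg] at this
      exact this
  · change x ∈ d4 ↔ _
    constructor
    · intro h
      exact ⟨coeff_skew h, fun k j hj => by simp [moved] at hj⟩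
    · rintro ⟨h, -⟩
      exact mem_d4_of_coeff h

/-- The matrix coefficient as a functional on the algebra. -/
noncomputable def cf {t : OrthType} (k j : G) : alg t →ₗ[ℂ] ℂ :=
  coeff k j ∘ₗ (alg t).toSubmodule.subtype

variable {t : OrthType}

theorem cf_ext {x y : alg t} (h : ∀ k j, cf k j x = cf k j y) : x = y :=
  Subtype.ext (coeff_ext h)

theorem cf_skew (x : alg t) (k j : G) : cf k j x = - cf j k x := (mem_alg_iff.1 x.2).1 k j

theorem cf_self (x : alg t) (k : G) : cf k k x = 0 := by
  have := cf_skew x k k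
  linear_combination this / 2

theorem cf_eq_zero_right (x : alg t) {k j : G} (hj : moved t j = false) : cf k j x = 0 :=
  (mem_alg_iff.1 x.2).2 k j hj

theorem cf_eq_zero_left (x : alg t) {k j : G} (hk : moved t k = false) : cf k j x = 0 := by
  rw [cf_skew, cf_eq_zero_right x hk, neg_zero]

theorem mem_comp_iff {g : G} {x : alg t} :
    x ∈ (Γ t).comp g ↔ ∀ k j, k ≠ g + j → cf k j x = 0 := by
  rw [show (x ∈ (Γ t).comp g) ↔ x.1 ∈ glComp g by cases t <;> rfl]
  exact mem_glComp_iff_coeff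

theorem cf_lie (k j : G) (x y : alg t) :
    cf k j ⁅x, y⁆ = ∑ m, (cf k m x * cf m j y - cf k m y * cf m j x) := by
  rw [Finset.sum_sub_distrib]
  have : ((⁅x, y⁆ : alg t) : Module.End ℂ Oct) = x.1 * y.1 - y.1 * x.1 := rfl
  change coeff k j ((⁅x, y⁆ : alg t) : Module.End ℂ Oct) = _
  rw [this, map_sub, coeff_mul, coeff_mul]
  rfl

/-- The homogeneous bracket involves a single path between two given indices for each order of
the factors. -/
theorem cf_lie_of_mem {g h : G} {x y : alg t} (hx : x ∈ (Γ t).comp g) (hy : y ∈ (Γ t).comp h)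
    (k j : G) :
    cf k j ⁅x, y⁆ = cf k (h + j) x * cf (h + j) j y - cf k (g + j) y * cf (g + j) j x := by
  rw [cf_lie, Finset.sum_sub_distrib]
  congr 1
  · refine Finset.sum_eq_single _ (fun m _ hm => ?_) (by simp)
    rw [mem_comp_iff.1 hy m j hm, mul_zero]
  · refine Finset.sum_eq_single _ (fun m _ hm => ?_) (by simp)
    rw [mem_comp_iff.1 hx m j hm, mul_zero]

theorem add_self_G : ∀ a : G, a + a = 0 := by decide

theorem add_add_cancel_G : ∀ a b : G, a + (a + b) = b := by decide

/-- The component of degree `0` vanishes. -/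
theorem comp_zero : (Γ t).comp 0 = ⊥ := by
  rw [eq_bot_iff]
  intro x hx
  rw [Submodule.mem_bot]
  apply cf_ext
  intro k j
  rw [map_zero]
  by_cases h : k = j
  · rw [h, cf_self]
  · exact mem_comp_iff.1 hx k j (by simpa using h)

/-- The homogeneous components are abelian. -/
theorem lie_eq_zero_of_mem_comp {g : G} {x y : alg t} (hx : x ∈ (Γ t).comp g)
    (hy : y ∈ (Γ t).comp g) : ⁅x, y⁆ = 0 := by
  apply cf_ext
  intro k j
  rw [cf_lie_of_mem hx hy, map_zero]
  by_cases h : k = j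
  · subst h
    rw [cf_skew x k, cf_skew y k]; ring
  · have : k ≠ g + (g + j) := by rwa [add_add_cancel_G]
    rw [mem_comp_iff.1 hx _ _ this, mem_comp_iff.1 hy _ _ this]; ring

/-- The skew-symmetric matrix unit `E_{kj} - E_{jk}`. -/
noncomputable def skewUnit (k j : G) : Module.End ℂ Oct where
  toFun v := v (idx j) • e (idx k) - v (idx k) • e (idx j)
  map_add' v w := by simp only [Pi.add_apply, add_smul]; abel
  map_smul' c v := by simp [mul_smul, smul_sub]

theorem coeff_skewUnit (k j a b : G) : coeff a b (skewUnit k j) =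
    (if b = j then 1 else 0) * (if a = k then 1 else 0) -
      (if b = k then 1 else 0) * (if a = j then 1 else 0) := by
  have hi : ∀ u v : G, e (idx u) (idx v) = if u = v then 1 else 0 := by
    intro u v
    by_cases h : u = v
    · rw [if_pos h, h]; simp [e]
    · have h' : idx v ≠ idx u := fun h' => h (idxEquiv.injective h').symm
      rw [if_neg h]; simp [e, h']
  simp only [coeff, skewUnit, LinearMap.coe_mk, AddHom.coe_mk, Pi.sub_apply, Pi.smul_apply,
    smul_eq_mul, hi]
  simp only [eq_comm]

theorem skewUnit_mem {k j : G} (hk : moved t k = true) (hj : moved t j = true) :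
    skewUnit k j ∈ alg t := by
  rw [mem_alg_iff]
  refine ⟨fun a b => ?_, fun a b hb => ?_⟩
  · rw [coeff_skewUnit, coeff_skewUnit]; ring
  · have h1 : b ≠ j := by rintro rfl; simp [hj] at hb
    have h2 : b ≠ k := by rintro rfl; simp [hk] at hb
    rw [coeff_skewUnit, if_neg h1, if_neg h2]; ring

/-- The skew-symmetric matrix unit `E_{kj} - E_{jk}` as an element of the algebra; it is `0` when
the algebra does not contain it. -/
noncomputable def unit (t : OrthType) (k j : G) : alg t :=
  if h : moved t k = true ∧ moved t j = true then ⟨skewUnit k j, skewUnit_mem h.1 h.2⟩ else 0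

theorem cf_unit {k j : G} (hk : moved t k = true) (hj : moved t j = true) (a b : G) :
    cf a b (unit t k j) = (if b = j then 1 else 0) * (if a = k then 1 else 0) -
      (if b = k then 1 else 0) * (if a = j then 1 else 0) := by
  rw [← coeff_skewUnit, unit, dif_pos ⟨hk, hj⟩]
  rfl

theorem unit_mem (k j : G) : unit t k j ∈ (Γ t).comp (k + j) := by
  by_cases h : moved t k = true ∧ moved t j = true
  · rw [mem_comp_iff]
    intro a b hab
    have h1 : ¬ (b = j ∧ a = k) := by
      rintro ⟨rfl, rfl⟩
      exact hab (by rw [add_add_self])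
    have h2 : ¬ (b = k ∧ a = j) := by
      rintro ⟨rfl, rfl⟩
      exact hab (by rw [add_comm b a, add_add_self])
    rw [cf_unit h.1 h.2]
    split_ifs <;> simp_all
  · rw [unit, dif_neg h]
    exact Submodule.zero_mem _

theorem unit_mem_of_add {g k j : G} (h : k + j = g) : unit t k j ∈ (Γ t).comp g :=
  h ▸ unit_mem k j

theorem unit_ne_zero {k j : G} (hk : moved t k = true) (hj : moved t j = true) (hkj : k ≠ j) :
    unit t k j ≠ 0 := by
  intro h
  have := congrArg (cf k j) h
  rw [cf_unit hk hj] at this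
  simp [hkj] at this

/-- Matrix units multiply as steps of a path: `[F_ab, F_bc] = F_ac`. -/
theorem lie_unit {a b c : G} (ha : moved t a = true) (hb : moved t b = true)
    (hc : moved t c = true) (hab : a ≠ b) (hbc : b ≠ c) (hac : a ≠ c) :
    ⁅unit t a b, unit t b c⁆ = unit t a c := by
  apply cf_ext
  intro k j
  rw [cf_lie, Finset.sum_eq_single b]
  · simp only [cf_unit ha hb, cf_unit hb hc, cf_unit ha hc, hab.symm, hbc, if_true,
      if_false, mul_zero, zero_mul, sub_zero, zero_sub, one_mul, mul_one, neg_mul_neg]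
    ring
  · intro m _ hm
    simp only [cf_unit ha hb, cf_unit hb hc, hm, if_false, mul_zero, zero_mul, sub_zero, zero_sub]
    by_cases h1 : m = a
    · subst h1; simp [hac]
    · simp [h1]
  · simp

theorem lie_unit_disjoint {a b c d : G} (ha : moved t a = true) (hb : moved t b = true)
    (hc : moved t c = true) (hd : moved t d = true) (hac : a ≠ c) (had : a ≠ d) (hbc : b ≠ c)
    (hbd : b ≠ d) : ⁅unit t a b, unit t c d⁆ = 0 := by
  apply cf_ext
  intro k j
  rw [cf_lie, map_zero]
  simp only [cf_unit ha hb, cf_unit hc hd]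
  apply Finset.sum_eq_zero
  intro m _
  by_cases h1 : m = a
  · subst h1; simp [hac, had]
  · by_cases h2 : m = b
    · subst h2; simp [hbc, hbd]
    · simp [h1, h2]

end Octonion

/-! ### Homogeneous elements and equivalences of graded contractions -/

namespace LieGrading

variable {A : Type*} [AddCommGroup A] [DecidableEq A] {L : Type*} [LieRing L] [LieAlgebra ℂ L]

theorem proj_mem (Γ : LieGrading A L) (g : A) (x : L) : Γ.proj g x ∈ Γ.comp g :=
  Subtype.property _

/-- A property closed under addition holds everywhere if it holds for homogeneous elements. -/
theorem homogeneous_induction (Γ : LieGrading A L) {P : L → Prop}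
    (hom : ∀ g, ∀ x ∈ Γ.comp g, P x) (add : ∀ x y, P x → P y → P (x + y)) (x : L) : P x := by
  have hx : x ∈ ⨆ g, Γ.comp g := by
    rw [Γ.isInternal.submodule_iSup_eq_top]; trivial
  exact Submodule.iSup_induction Γ.comp (motive := P) hx hom (hom 0 0 (Submodule.zero_mem _)) add

theorem linearMap_ext (Γ : LieGrading A L) {M : Type*} [AddCommGroup M] [Module ℂ M]
    {f f' : L →ₗ[ℂ] M} (h : ∀ g, ∀ x ∈ Γ.comp g, f x = f' x) : f = f' := by
  ext x
  refine Γ.homogeneous_induction (P := fun x => f x = f' x) h (fun x y hx hy => ?_) x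
  rw [map_add, map_add, hx, hy]

theorem eq_of_mem_comp (Γ : LieGrading A L) {g h : A} {x : L} (hx : x ∈ Γ.comp g)
    (hx' : x ∈ Γ.comp h) (h0 : x ≠ 0) : g = h := by
  by_contra hgh
  exact h0 ((Γ.proj_of_mem hx').symm.trans (Γ.proj_of_mem_ne hgh hx))

variable [Fintype A]

theorem sum_proj (Γ : LieGrading A L) (x : L) : ∑ g, Γ.proj g x = x := by
  have : (∑ g, Γ.proj g) = LinearMap.id := by
    refine Γ.linearMap_ext fun g x hx => ?_
    rw [LinearMap.sum_apply, Finset.sum_eq_single g (fun h _ hh => Γ.proj_of_mem_ne hh.symm hx)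
      (by simp)]
    exact Γ.proj_of_mem hx
  simpa using congrArg (fun f => f x) this

/-- The axioms of a Lie algebra need to be checked on homogeneous elements only. -/
theorem isGradedContraction_of_homogeneous (Γ : LieGrading A L) {ε : A → A → ℂ}
    (hsymm : ∀ g h, ∀ x ∈ Γ.comp g, ∀ y ∈ Γ.comp h, ε g h • ⁅x, y⁆ = ε h g • ⁅x, y⁆)
    (hjac : ∀ g h k, ∀ x ∈ Γ.comp g, ∀ y ∈ Γ.comp h, ∀ z ∈ Γ.comp k,
      (ε g (h + k) * ε h k) • ⁅x, ⁅y, z⁆⁆ + (ε h (k + g) * ε k g) • ⁅y, ⁅z, x⁆⁆ +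
        (ε k (g + h) * ε g h) • ⁅z, ⁅x, y⁆⁆ = 0) : Γ.IsGradedContraction ε := by
  constructor
  · intro x
    have h : Γ.bracket ε = -(Γ.bracket ε).flip := by
      refine Γ.linearMap_ext fun g x hx => Γ.linearMap_ext fun h y hy => ?_
      rw [LinearMap.neg_apply, LinearMap.neg_apply, LinearMap.flip_apply,
        Γ.bracket_of_mem ε hx hy, Γ.bracket_of_mem ε hy hx, hsymm g h x hx y hy, ← lie_skew,
        smul_neg]
    have h2 := congrArg (fun B : L →ₗ[ℂ] L →ₗ[ℂ] L => B x x) h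
    have h3 : (2 : ℂ) • Γ.bracket ε x x = 0 := by
      rw [two_smul]; exact add_eq_zero_iff_eq_neg.2 h2
    exact (smul_eq_zero.1 h3).resolve_left two_ne_zero
  · have step : ∀ {x y z u v w : L}, x + y + z = 0 → u + v + w = 0 →
        x + u + (y + v) + (z + w) = 0 := by
      intro x y z u v w h1 h2
      rw [show x + u + (y + v) + (z + w) = (x + y + z) + (u + v + w) by abel, h1, h2, add_zero]
    intro x
    refine Γ.homogeneous_induction (P := fun x => ∀ y z, Γ.bracket ε x (Γ.bracket ε y z) +
      Γ.bracket ε y (Γ.bracket ε z x) + Γ.bracket ε z (Γ.bracket ε x y) = 0)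
      (fun g x hx => ?_) (fun x x' hx hx' y z => ?_) x
    · intro y
      refine Γ.homogeneous_induction (P := fun y => ∀ z, Γ.bracket ε x (Γ.bracket ε y z) +
        Γ.bracket ε y (Γ.bracket ε z x) + Γ.bracket ε z (Γ.bracket ε x y) = 0)
        (fun h y hy => ?_) (fun y y' hy hy' z => ?_) y
      · intro z
        refine Γ.homogeneous_induction (P := fun z => Γ.bracket ε x (Γ.bracket ε y z) +
          Γ.bracket ε y (Γ.bracket ε z x) + Γ.bracket ε z (Γ.bracket ε x y) = 0)
          (fun k z hz => ?_) (fun z z' hz hz' => ?_) z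
        · rw [← hjac g h k x hx y hy z hz, Γ.bracket_of_mem ε hy hz, Γ.bracket_of_mem ε hz hx,
            Γ.bracket_of_mem ε hx hy, map_smul, map_smul, map_smul,
            Γ.bracket_of_mem ε hx (Γ.lie_mem hy hz), Γ.bracket_of_mem ε hy (Γ.lie_mem hz hx),
            Γ.bracket_of_mem ε hz (Γ.lie_mem hx hy)]
          simp only [smul_smul, mul_comm]
        · simp only [map_add, LinearMap.add_apply]
          exact step hz hz'
      · simp only [map_add, LinearMap.add_apply]
        exact step (hy z) (hy' z)
    · simp only [map_add, LinearMap.add_apply]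
      exact step (hx y z) (hx' y z)

theorem Equivalent.trans {Γ : LieGrading A L} {ε ε' ε'' : A → A → ℂ} (h : Γ.Equivalent ε ε')
    (h' : Γ.Equivalent ε' ε'') : Γ.Equivalent ε ε'' := by
  obtain ⟨f, hf, hg⟩ := h
  obtain ⟨f', hf', hg'⟩ := h'
  refine ⟨f.trans f', fun x y => ?_, fun g => ?_⟩
  · simp only [LinearEquiv.trans_apply, hf, hf']
  · obtain ⟨k, hk⟩ := hg g
    obtain ⟨l, hl⟩ := hg' k
    exact ⟨l, by rw [LinearEquiv.coe_trans, Submodule.map_comp, hk, hl]⟩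

/-- A linear automorphism permuting the components is an equivalence as soon as it respects the
contracted products of homogeneous elements. -/
theorem equivalent_of_homogeneous (Γ : LieGrading A L) {ε ε' : A → A → ℂ} (f : L ≃ₗ[ℂ] L)
    (σ : A → A) (hσ : ∀ g, (Γ.comp g).map (f : L →ₗ[ℂ] L) = Γ.comp (σ g))
    (hf : ∀ g h, ∀ x ∈ Γ.comp g, ∀ y ∈ Γ.comp h,
      ε g h • f ⁅x, y⁆ = ε' (σ g) (σ h) • ⁅f x, f y⁆) : Γ.Equivalent ε ε' := by
  have hmem : ∀ {g x}, x ∈ Γ.comp g → f x ∈ Γ.comp (σ g) := fun {g x} hx =>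
    hσ g ▸ Submodule.mem_map_of_mem hx
  refine ⟨f, fun x y => ?_, fun g => ⟨σ g, hσ g⟩⟩
  have h : (Γ.bracket ε).compr₂ (f : L →ₗ[ℂ] L) =
      (Γ.bracket ε').compl₁₂ (f : L →ₗ[ℂ] L) (f : L →ₗ[ℂ] L) := by
    refine Γ.linearMap_ext fun g x hx => Γ.linearMap_ext fun h y hy => ?_
    simp only [LinearMap.compr₂_apply, LinearMap.compl₁₂_apply, LinearEquiv.coe_coe]
    rw [Γ.bracket_of_mem ε hx hy, Γ.bracket_of_mem ε' (hmem hx) (hmem hy), map_smul,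
      hf g h x hx y hy]
  exact congrArg (fun B : L →ₗ[ℂ] L →ₗ[ℂ] L => B x y) h

/-- If one term of the contracted Jacobi identity vanishes, then the coefficients of the other two
coincide. -/
theorem coeff_eq_of_jacobi (Γ : LieGrading A L) {ε : A → A → ℂ} {g h k : A} {x y z : L}
    (J : Γ.bracket ε x (Γ.bracket ε y z) + Γ.bracket ε y (Γ.bracket ε z x) +
      Γ.bracket ε z (Γ.bracket ε x y) = 0)
    (hx : x ∈ Γ.comp g) (hy : y ∈ Γ.comp h) (hz : z ∈ Γ.comp k) (hzx : ⁅z, x⁆ = 0)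
    (hxyz : ⁅x, ⁅y, z⁆⁆ = -⁅z, ⁅x, y⁆⁆) (h0 : ⁅x, ⁅y, z⁆⁆ ≠ 0) :
    ε g (h + k) * ε h k = ε k (g + h) * ε g h := by
  rw [Γ.bracket_of_mem ε hy hz, Γ.bracket_of_mem ε hz hx, Γ.bracket_of_mem ε hx hy, map_smul,
    map_smul, map_smul, Γ.bracket_of_mem ε hx (Γ.lie_mem hy hz),
    Γ.bracket_of_mem ε hz (Γ.lie_mem hx hy), hzx, map_zero, smul_zero, add_zero,
    show ⁅z, ⁅x, y⁆⁆ = -⁅x, ⁅y, z⁆⁆ by rw [hxyz, neg_neg], smul_neg, smul_neg, smul_smul,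
    smul_smul, ← sub_eq_add_neg, sub_eq_zero] at J
  linear_combination smul_left_injective ℂ h0 J

/-- The linear map acting on the component of degree `g` as the scalar `a g`. -/
noncomputable def diag (Γ : LieGrading A L) (a : A → ℂ) : L →ₗ[ℂ] L := ∑ g, a g • Γ.proj g

theorem diag_of_mem (Γ : LieGrading A L) (a : A → ℂ) {g : A} {x : L} (hx : x ∈ Γ.comp g) :
    Γ.diag a x = a g • x := by
  rw [diag, LinearMap.sum_apply, Finset.sum_eq_single g]
  · rw [LinearMap.smul_apply, Γ.proj_of_mem hx]
  · intro h _ hh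
    rw [LinearMap.smul_apply, Γ.proj_of_mem_ne hh.symm hx, smul_zero]
  · simp

theorem diag_diag_inv (Γ : LieGrading A L) {a b : A → ℂ} (h : ∀ g, a g * b g = 1) :
    Γ.diag a ∘ₗ Γ.diag b = LinearMap.id := by
  refine Γ.linearMap_ext fun g x hx => ?_
  rw [LinearMap.comp_apply, Γ.diag_of_mem b hx, map_smul, Γ.diag_of_mem a hx, smul_smul, mul_comm,
    h, one_smul, LinearMap.id_apply]

/-- The linear automorphism acting on the component of degree `g` as the nonzero scalar `a g`. -/
noncomputable def diagEquiv (Γ : LieGrading A L) (a : A → ℂ) (ha : ∀ g, a g ≠ 0) : L ≃ₗ[ℂ] L :=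
  LinearEquiv.ofLinearMap (Γ.diag a) (Γ.diag a⁻¹) (Γ.diag_diag_inv fun g => mul_inv_cancel₀ (ha g))
    (Γ.diag_diag_inv fun g => inv_mul_cancel₀ (ha g))

/-- Multiplication by `a g` on the component of degree `g` is an equivalence from `ε` to
`ε' g h = a (g + h) * ε g h / (a g * a h)`. -/
theorem equivalent_of_scaling (Γ : LieGrading A L) {ε ε' : A → A → ℂ} (a : A → ℂ)
    (ha : ∀ g, a g ≠ 0) (h : ∀ g h, ∀ x ∈ Γ.comp g, ∀ y ∈ Γ.comp h, ⁅x, y⁆ ≠ 0 →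
      ε' g h * (a g * a h) = a (g + h) * ε g h) : Γ.Equivalent ε ε' := by
  have hd : ∀ {g x}, x ∈ Γ.comp g → Γ.diagEquiv a ha x = a g • x := fun hx => Γ.diag_of_mem a hx
  refine Γ.equivalent_of_homogeneous (Γ.diagEquiv a ha) id (fun g => ?_) fun g k x hx y hy => ?_
  · apply le_antisymm
    · rintro _ ⟨x, hx, rfl⟩
      rw [LinearEquiv.coe_coe, hd hx]
      exact Submodule.smul_mem _ _ hx
    · intro x hx
      refine ⟨(a g)⁻¹ • x, Submodule.smul_mem _ _ hx, ?_⟩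
      rw [LinearEquiv.coe_coe, map_smul, hd hx, smul_smul]
      exact (congrArg (· • x) (inv_mul_cancel₀ (ha g))).trans (one_smul ℂ x)
  · by_cases h0 : ⁅x, y⁆ = 0
    · simp [h0, hd hx, hd hy]
    · rw [hd hx, hd hy, hd (Γ.lie_mem hx hy), smul_lie, lie_smul, smul_smul, smul_smul, smul_smul,
        mul_comm, ← h g k x hx y hy h0, mul_assoc]
      rfl

end LieGrading

namespace Octonion

open LieGrading

variable {t : OrthType}

/-! ### Admissible maps -/

/-- Three points of the Fano plane `G \ {0}` which are not collinear. -/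
def Generic (g h k : G) : Prop :=
  g ≠ 0 ∧ h ≠ 0 ∧ k ≠ 0 ∧ g ≠ h ∧ h ≠ k ∧ k ≠ g ∧ g + h ≠ k

instance (g h k : G) : Decidable (Generic g h k) := by unfold Generic; infer_instance

/-- The conditions on the values of a map at pairs of distinct points of the Fano plane under which
it is a graded contraction. -/
structure Admissible (ε : G → G → ℂ) : Prop where
  symm : ∀ g h, g ≠ 0 → h ≠ 0 → g ≠ h → ε g h = ε h g
  jacobi : ∀ g h k, Generic g h k → ε g (h + k) * ε h k = ε h (k + g) * ε k g

theorem Generic.rotate : ∀ {g h k : G}, Generic g h k → Generic h k g := by decide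

theorem lie_eq_zero_of_degenerate {g h : G} (hgh : g = 0 ∨ h = 0 ∨ g = h) {x y : alg t}
    (hx : x ∈ (Γ t).comp g) (hy : y ∈ (Γ t).comp h) : ⁅x, y⁆ = 0 := by
  rcases hgh with rfl | rfl | rfl
  · rw [comp_zero, Submodule.mem_bot] at hx
    rw [hx, zero_lie]
  · rw [comp_zero, Submodule.mem_bot] at hy
    rw [hy, lie_zero]
  · exact lie_eq_zero_of_mem_comp hx hy

theorem nondegenerate_of_lie_ne_zero {g h : G} {x y : alg t} (hx : x ∈ (Γ t).comp g)
    (hy : y ∈ (Γ t).comp h) (h0 : ⁅x, y⁆ ≠ 0) : g ≠ 0 ∧ h ≠ 0 ∧ g ≠ h := by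
  by_contra hc
  apply h0
  apply lie_eq_zero_of_degenerate _ hx hy
  tauto

theorem exists_middle : ∀ g h : G, g ≠ 0 ∧ h ≠ 0 ∧ g ≠ h →
    ∃ b : G, b ≠ 0 ∧ b + g ≠ 0 ∧ b + h ≠ 0 := by decide

theorem add_left_ne : ∀ {b g h : G}, g ≠ h → b + g ≠ b + h := fun h h' => h (add_left_cancel h')

/-- Distinct points have components with nonzero bracket. -/
theorem exists_lie_ne_zero (t : OrthType) {g h : G} (hg : g ≠ 0) (hh : h ≠ 0) (hgh : g ≠ h) :
    ∃ x ∈ (Γ t).comp g, ∃ y ∈ (Γ t).comp h, ⁅x, y⁆ ≠ 0 := by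
  obtain ⟨b, hb, hbg, hbh⟩ := exists_middle g h ⟨hg, hh, hgh⟩
  refine ⟨unit t (b + g) b, unit_mem_of_add ?_, unit t b (b + h), unit_mem_of_add ?_, ?_⟩
  · rw [add_comm b g, add_add_self]
  · rw [add_add_cancel_G]
  · rw [lie_unit (moved_of_ne t hbg) (moved_of_ne t hb) (moved_of_ne t hbh) (by simpa using hg)
      (by simpa using hh) (add_left_ne hgh)]
    exact unit_ne_zero (moved_of_ne t hbg) (moved_of_ne t hbh) (add_left_ne hgh)

theorem exists_middle_generic : ∀ g h k : G, Generic g h k →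
    ∃ b : G, b ≠ 0 ∧ b + g ≠ 0 ∧ b + h ≠ 0 ∧ b + h + k ≠ 0 ∧ b + g ≠ b + h + k ∧
      b ≠ b + h + k := by decide

/-- For generic degrees, the values of a graded contraction satisfy the Jacobi condition. Along a
path `a, b, c, d` of indices whose steps have degrees `g`, `h`, `k`, one term of the
Jacobi identity vanishes and the other two are proportional. -/
theorem Admissible.of_isGradedContraction {ε : G → G → ℂ} (hε : (Γ t).IsGradedContraction ε) :
    Admissible ε := by
  obtain ⟨halt, hjac⟩ := hε
  have hskew : ∀ x y, (Γ t).bracket ε x y = -(Γ t).bracket ε y x := by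
    intro x y
    have := halt (x + y)
    simp only [map_add, LinearMap.add_apply, halt, zero_add, add_zero] at this
    exact eq_neg_of_add_eq_zero_right this
  have hsymm : ∀ g h, g ≠ 0 → h ≠ 0 → g ≠ h → ε g h = ε h g := by
    intro g h hg hh hgh
    obtain ⟨x, hx, y, hy, h0⟩ := exists_lie_ne_zero t hg hh hgh
    have := hskew x y
    rw [bracket_of_mem _ _ hx hy, bracket_of_mem _ _ hy hx, ← lie_skew x y, smul_neg, neg_inj]
      at this
    exact smul_left_injective ℂ (by rw [← lie_skew, neg_ne_zero]; exact h0) this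
  have key : ∀ g h k, Generic g h k → ε g (h + k) * ε h k = ε k (g + h) * ε g h := by
    intro g h k hgen
    obtain ⟨b, hb, ha, hc, hd, had, hbd⟩ := exists_middle_generic g h k hgen
    obtain ⟨hg, hh, hk, hgh, hhk, hkg, -⟩ := hgen
    have mb := moved_of_ne t hb
    have ma := moved_of_ne t ha
    have mc := moved_of_ne t hc
    have md := moved_of_ne t hd
    have hab : b + g ≠ b := by simpa using hg
    have hbc : b ≠ b + h := by simpa using hh
    have hac : b + g ≠ b + h := add_left_ne hgh
    have hcd : b + h ≠ b + h + k := by simpa using hk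
    have hx : unit t (b + g) b ∈ (Γ t).comp g :=
      unit_mem_of_add (by rw [add_comm b g, add_add_self])
    have hy : unit t b (b + h) ∈ (Γ t).comp h := unit_mem_of_add (add_add_cancel_G _ _)
    have hz : unit t (b + h) (b + h + k) ∈ (Γ t).comp k := unit_mem_of_add (add_add_cancel_G _ _)
    have e1 := lie_unit mb mc md hbc hcd hbd
    have e2 := lie_unit ma mb mc hab hbc hac
    have e3 := lie_unit_disjoint (t := t) mc md ma mb hac.symm hbc.symm had.symm hbd.symm
    have e4 := lie_unit ma mb md hab hbd had
    have e5 := lie_unit ma mc md hac hcd had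
    refine coeff_eq_of_jacobi (Γ t) (hjac _ _ _) hx hy hz e3 ?_ ?_
    · rw [e1, e2, e4, ← e5, lie_skew]
    · rw [e1, e4]
      exact unit_ne_zero ma md had
  exact ⟨hsymm, fun g h k hgen => (key h k g hgen.rotate).symm⟩

/-- The converse of `Admissible.of_isGradedContraction`: for degrees that are not generic, the
Jacobi identity of the contracted product holds automatically. -/
theorem Admissible.isGradedContraction {ε : G → G → ℂ} (hε : Admissible ε) :
    (Γ t).IsGradedContraction ε := by
  have hs : ∀ g h, ∀ x ∈ (Γ t).comp g, ∀ y ∈ (Γ t).comp h, ε g h • ⁅x, y⁆ = ε h g • ⁅x, y⁆ := by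
    intro g h x hx y hy
    by_cases h0 : ⁅x, y⁆ = 0
    · rw [h0, smul_zero, smul_zero]
    · obtain ⟨hg, hh, hgh⟩ := nondegenerate_of_lie_ne_zero hx hy h0
      rw [hε.symm g h hg hh hgh]
  refine isGradedContraction_of_homogeneous _ hs fun g h k x hx y hy z hz => ?_
  have J := lie_jacobi x y z
  -- two of the degrees coincide: one term vanishes and the other two have the same coefficient
  have two : ∀ g k, ∀ x ∈ (Γ t).comp g, ∀ y ∈ (Γ t).comp g, ∀ z ∈ (Γ t).comp k,
      (ε g (g + k) * ε g k) • ⁅x, ⁅y, z⁆⁆ + (ε g (k + g) * ε k g) • ⁅y, ⁅z, x⁆⁆ = 0 := by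
    intro g k x hx y hy z hz
    have J := lie_jacobi x y z
    rw [lie_eq_zero_of_mem_comp hx hy, lie_zero, add_zero] at J
    have h1 := hs g k y hy z hz
    rw [mul_smul, ← lie_smul, h1, lie_smul, ← mul_smul, add_comm g k, ← smul_add, J, smul_zero]
  by_cases hgen : Generic g h k
  · rw [hε.jacobi g h k hgen, hε.jacobi h k g hgen.rotate, ← smul_add, ← smul_add, J, smul_zero]
  by_cases h1 : g = h
  · subst h1
    rw [lie_eq_zero_of_mem_comp hx hy, lie_zero, smul_zero, add_zero]
    exact two g k x hx y hy z hz
  by_cases h2 : h = k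
  · subst h2
    rw [lie_eq_zero_of_mem_comp hy hz, lie_zero, smul_zero, zero_add]
    exact two h g y hy z hz x hx
  by_cases h3 : k = g
  · subst h3
    rw [lie_eq_zero_of_mem_comp hz hx, lie_zero, smul_zero, add_zero, add_comm]
    exact two k h z hz x hx y hy
  -- otherwise a degree vanishes or the three degrees are collinear: all terms vanish
  have h4 : g = 0 ∨ h = 0 ∨ k = 0 ∨ g + h = k := by
    unfold Generic at hgen
    tauto
  rcases h4 with rfl | rfl | rfl | rfl
  · rw [comp_zero, Submodule.mem_bot] at hx
    simp [hx]
  · rw [comp_zero, Submodule.mem_bot] at hy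
    simp [hy]
  · rw [comp_zero, Submodule.mem_bot] at hz
    simp [hz]
  · have e1 : h + (g + h) = g := by rw [add_comm, add_add_self]
    have e2 : g + h + g = h := by rw [add_comm, add_add_cancel_G]
    rw [lie_eq_zero_of_mem_comp hx (e1 ▸ lie_mem _ hy hz),
      lie_eq_zero_of_mem_comp hy (e2 ▸ lie_mem _ hz hx),
      lie_eq_zero_of_mem_comp hz (lie_mem _ hx hy)]
    simp

/-! ### Equivalences by scalings, collineations and a transposition of collinear points -/

theorem equivalent_of_scale {ε ε' : G → G → ℂ} (a : G → ℂ) (ha : ∀ g, a g ≠ 0)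
    (h : ∀ g h, g ≠ 0 → h ≠ 0 → g ≠ h → ε' g h * (a g * a h) = a (g + h) * ε g h) :
    (Γ t).Equivalent ε ε' :=
  equivalent_of_scaling _ a ha fun g k _ hx _ hy h0 =>
    let ⟨hg, hk, hgk⟩ := nondegenerate_of_lie_ne_zero hx hy h0
    h g k hg hk hgk

/-- Conjugation by the permutation of the basic octonions induced by an automorphism of `G`. -/
noncomputable def conjEnd (σ : G ≃+ G) : Module.End ℂ Oct ≃ₗ[ℂ] Module.End ℂ Oct :=
  (LinearEquiv.funCongrLeft ℂ ℂ ((idxEquiv.symm.trans σ.symm.toEquiv).trans idxEquiv)).conj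

theorem coeff_conjEnd (σ : G ≃+ G) (k j : G) (x : Module.End ℂ Oct) :
    coeff k j (conjEnd σ x) = coeff (σ.symm k) (σ.symm j) x := by
  have h : (LinearEquiv.funCongrLeft ℂ ℂ
      ((idxEquiv.symm.trans σ.symm.toEquiv).trans idxEquiv)).symm (e (idx j)) =
      e (idx (σ.symm j)) := by
    rw [LinearEquiv.symm_apply_eq]
    ext i
    have hi : i = idx j ↔ idx (σ.symm j) = idx (σ.symm (deg i)) := by
      rw [show (idx (σ.symm j) = idx (σ.symm (deg i))) ↔ (σ.symm j) = (σ.symm (deg i)) from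
        idxEquiv.injective.eq_iff, σ.symm.injective.eq_iff]
      exact ⟨fun h => by rw [h, deg_idx], fun h => by rw [h, idx_deg]⟩
    simp [e, Pi.single_apply, idxEquiv, eq_comm, hi]
  simp only [coeff, LinearMap.coe_mk, AddHom.coe_mk, conjEnd, LinearEquiv.conj_apply,
    LinearMap.comp_apply, LinearEquiv.coe_coe, h]
  simp [idxEquiv, deg_idx]

theorem moved_map (σ : G ≃+ G) (j : G) : moved t (σ j) = moved t j := by
  cases t <;> simp [moved]

theorem conjEnd_mem (σ : G ≃+ G) {x : Module.End ℂ Oct} (hx : x ∈ alg t) :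
    conjEnd σ x ∈ alg t := by
  rw [mem_alg_iff] at hx ⊢
  refine ⟨fun k j => ?_, fun k j hj => ?_⟩
  · rw [coeff_conjEnd, coeff_conjEnd, hx.1]
  · rw [coeff_conjEnd, hx.2]
    rwa [moved_map]

/-- The automorphism of `𝔟₃` or `𝔡₄` which permutes the components by an automorphism of `G`. -/
noncomputable def conjAlg (t : OrthType) (σ : G ≃+ G) : alg t ≃ₗ[ℂ] alg t where
  toFun x := ⟨conjEnd σ x.1, conjEnd_mem σ x.2⟩
  invFun x := ⟨conjEnd σ.symm x.1, conjEnd_mem σ.symm x.2⟩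
  map_add' x y := Subtype.ext (map_add _ _ _)
  map_smul' c x := Subtype.ext (map_smul _ _ _)
  left_inv x := Subtype.ext (coeff_ext fun k j => by simp [coeff_conjEnd])
  right_inv x := Subtype.ext (coeff_ext fun k j => by simp [coeff_conjEnd])

theorem cf_conjAlg (σ : G ≃+ G) (k j : G) (x : alg t) :
    cf k j (conjAlg t σ x) = cf (σ.symm k) (σ.symm j) x := coeff_conjEnd σ k j x.1

theorem conjAlg_lie (σ : G ≃+ G) (x y : alg t) :
    conjAlg t σ ⁅x, y⁆ = ⁅conjAlg t σ x, conjAlg t σ y⁆ := by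
  apply cf_ext
  intro k j
  rw [cf_conjAlg, cf_lie, cf_lie, ← Equiv.sum_comp σ.symm.toEquiv]
  simp only [cf_conjAlg]
  rfl

theorem conjAlg_mem (σ : G ≃+ G) {g : G} {x : alg t} (hx : x ∈ (Γ t).comp g) :
    conjAlg t σ x ∈ (Γ t).comp (σ g) := by
  rw [mem_comp_iff] at hx ⊢
  intro k j hkj
  rw [cf_conjAlg]
  refine hx _ _ fun h => hkj ?_
  rw [← σ.apply_symm_apply k, h, map_add, σ.apply_symm_apply]

/-- A collineation permutes the components by an automorphism of the Lie algebra, so that it carries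
maps to equivalent maps. -/
theorem equivalent_of_collineation {ε ε' : G → G → ℂ} (σ : G ≃+ G)
    (h : ∀ g h, g ≠ 0 → h ≠ 0 → g ≠ h → ε' (σ g) (σ h) = ε g h) : (Γ t).Equivalent ε ε' := by
  refine equivalent_of_homogeneous _ (conjAlg t σ) σ (fun g => ?_) fun g k x hx y hy => ?_
  · apply le_antisymm
    · rintro _ ⟨x, hx, rfl⟩
      exact conjAlg_mem σ hx
    · intro x hx
      refine ⟨(conjAlg t σ).symm x, ?_, (conjAlg t σ).apply_symm_apply x⟩
      have := conjAlg_mem σ.symm hx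
      rwa [σ.symm_apply_apply] at this
  · rw [conjAlg_lie]
    by_cases h0 : ⁅x, y⁆ = 0
    · rw [← conjAlg_lie, h0, map_zero, smul_zero, smul_zero]
    · obtain ⟨hg, hk, hgk⟩ := nondegenerate_of_lie_ne_zero hx hy h0
      rw [h g k hg hk hgk]

/-- The composite of the map `ε` with an automorphism of `G` is equivalent to `ε`. -/
theorem equivalent_comp (ε : G → G → ℂ) (σ : G ≃+ G) :
    (Γ t).Equivalent ε (fun g h => ε (σ g) (σ h)) :=
  equivalent_of_collineation σ.symm fun g h _ _ _ => by simp

/-- An element of degree `g₁` on which no root vanishes that occurs on the components of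
degrees `g₄` and `g₇`. -/
noncomputable def regular (t : OrthType) : alg t :=
  unit t (deg 2) (deg 5) + (2 : ℂ) • unit t (deg 3) (deg 6) + (3 : ℂ) • unit t (deg 4) (deg 7)

theorem regular_mem : regular t ∈ (Γ t).comp (deg 1) :=
  Submodule.add_mem _ (Submodule.add_mem _ (unit_mem_of_add (by decide))
    (Submodule.smul_mem _ _ (unit_mem_of_add (by decide))))
    (Submodule.smul_mem _ _ (unit_mem_of_add (by decide)))

theorem cf_regular (j : G) : cf (deg 1 + j) j (regular t) =
    (![0, 0, -1, -2, -3, 1, 2, 3] : Fin 8 → ℂ) (idx j) := by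
  have hm : ∀ i, i ≠ 0 → moved t (deg i) = true := fun i hi =>
    moved_of_ne t (by revert i; decide)
  simp only [regular, map_add, map_smul, cf_unit (hm 2 (by decide)) (hm 5 (by decide)),
    cf_unit (hm 3 (by decide)) (hm 6 (by decide)), cf_unit (hm 4 (by decide)) (hm 7 (by decide))]
  obtain ⟨i, rfl⟩ : ∃ i, j = deg i := ⟨idx j, (deg_idx j).symm⟩
  have hd : ∀ i, deg 1 + deg i = deg (![1, 0, 5, 6, 7, 2, 3, 4] i) := by decide
  have hinj : ∀ i k, deg i = deg k ↔ i = k := by decide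
  simp only [hd, hinj, idx_deg]
  fin_cases i <;> simp

/-- The roots of the components of degrees `g₄` and `g₇` are sums and differences of matrix
coefficients of `regular t` at the indices `j` and `g₄ + j`, and they do not vanish. -/
theorem cf_regular_sq_ne (j : G) : cf (deg 1 + (deg 4 + j)) (deg 4 + j) (regular t) ^ 2 ≠
    cf (deg 1 + j) j (regular t) ^ 2 := by
  rw [cf_regular, cf_regular]
  obtain ⟨i, rfl⟩ : ∃ i, j = deg i := ⟨idx j, (deg_idx j).symm⟩
  have hd : ∀ i, idx (deg 4 + deg i) = ![4, 7, 6, 5, 0, 3, 2, 1] i := by decide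
  rw [hd, idx_deg]
  fin_cases i <;> simp <;> norm_num

theorem lie_regular_ne_zero {g : G} (hg : g = deg 4 ∨ g = deg 1 + deg 4) {y : alg t}
    (hy : y ∈ (Γ t).comp g) (h : ⁅regular t, y⁆ = 0) : y = 0 := by
  have hX : ∀ j, cf (deg 1 + (deg 1 + j)) (deg 1 + j) (regular t) =
      -cf (deg 1 + j) j (regular t) := fun j => by rw [add_add_cancel_G, cf_skew]
  have hE : ∀ j, cf (deg 1 + (g + j)) (g + j) (regular t) * cf (g + j) j y =
      cf (g + (deg 1 + j)) (deg 1 + j) y * cf (deg 1 + j) j (regular t) := by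
    intro j
    have := cf_lie_of_mem regular_mem hy (deg 1 + (g + j)) j
    rw [h, map_zero, add_left_comm (deg 1) g j] at this
    rw [add_left_comm (deg 1) g j]
    exact (sub_eq_zero.1 this.symm)
  have hsq : ∀ j, cf (deg 1 + (g + j)) (g + j) (regular t) ^ 2 ≠
      cf (deg 1 + j) j (regular t) ^ 2 := by
    intro j
    rcases hg with rfl | rfl
    · exact cf_regular_sq_ne j
    · rw [add_assoc, hX, neg_sq]
      exact cf_regular_sq_ne j
  have hY : ∀ j, cf (g + j) j y = 0 := by
    intro j
    have h1 := hE j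
    have h2 := hE (deg 1 + j)
    have h3 := hsq j
    rw [hX, add_left_comm g, hX, add_add_cancel_G, add_left_comm (deg 1) g] at h2
    rw [add_left_comm (deg 1) g] at h1 h3
    refine (mul_eq_zero.1 ?_).resolve_left (sub_ne_zero.2 h3)
    linear_combination cf (g + (deg 1 + j)) (g + j) (regular t) * h1 -
      cf (deg 1 + j) j (regular t) * h2
  refine cf_ext fun k j => ?_
  rw [map_zero]
  by_cases hkj : k = g + j
  · rw [hkj, hY]
  · exact mem_comp_iff.1 hy k j hkj

/-- The map which exchanges the components of degrees `g₄` and `g₇` by the adjoint action of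
`regular t` and is the identity on the other components. -/
noncomputable def swapMap (t : OrthType) : alg t →ₗ[ℂ] alg t :=
  ∑ g : G, if g = deg 4 ∨ g = deg 7 then
    (LieModule.toEnd ℂ (alg t) (alg t) (regular t)) ∘ₗ (Γ t).proj g else (Γ t).proj g

theorem swapMap_of_mem {g : G} {x : alg t} (hx : x ∈ (Γ t).comp g) :
    swapMap t x = if g = deg 4 ∨ g = deg 7 then ⁅regular t, x⁆ else x := by
  rw [swapMap, LinearMap.sum_apply, Finset.sum_eq_single g]
  · split_ifs
    · rw [LinearMap.comp_apply, proj_of_mem _ hx]; rfl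
    · rw [proj_of_mem _ hx]
  · intro h _ hh
    have h0 := proj_of_mem_ne _ hh.symm hx
    split_ifs
    · rw [LinearMap.comp_apply, h0, map_zero]
    · exact h0
  · simp

theorem swapMap_mem {g : G} {x : alg t} (hx : x ∈ (Γ t).comp g) :
    swapMap t x ∈ (Γ t).comp (Equiv.swap (deg 4) (deg 7) g) := by
  rw [swapMap_of_mem hx]
  have h := lie_mem (Γ t) (regular_mem (t := t)) hx
  split_ifs with hg
  · rcases hg with rfl | rfl
    · rw [Equiv.swap_apply_left]; exact h
    · rw [Equiv.swap_apply_right]; exact h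
  · rw [Equiv.swap_apply_of_ne_of_ne] <;> tauto

theorem swapMap_proj (g : G) (x : alg t) :
    swapMap t ((Γ t).proj g x) = (Γ t).proj (Equiv.swap (deg 4) (deg 7) g) (swapMap t x) := by
  have : swapMap t ∘ₗ (Γ t).proj g =
      (Γ t).proj (Equiv.swap (deg 4) (deg 7) g) ∘ₗ swapMap t := by
    refine (Γ t).linearMap_ext fun h x hx => ?_
    rw [LinearMap.comp_apply, LinearMap.comp_apply]
    by_cases hg : h = g
    · subst hg
      rw [proj_of_mem _ hx, proj_of_mem _ (swapMap_mem hx)]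
    · rw [proj_of_mem_ne _ hg hx, map_zero, proj_of_mem_ne _ _ (swapMap_mem hx)]
      exact fun h' => hg ((Equiv.swap _ _).injective h')
  exact congrArg (fun f => f x) this

theorem swapMap_injective : Function.Injective (swapMap t) := by
  rw [injective_iff_map_eq_zero]
  intro x hx
  rw [← sum_proj (Γ t) x]
  refine Finset.sum_eq_zero fun g _ => ?_
  have h := swapMap_proj g x
  rw [hx, map_zero, swapMap_of_mem (proj_mem (Γ t) g x)] at h
  split_ifs at h with hg
  · exact lie_regular_ne_zero hg (proj_mem (Γ t) g x) h
  · exact h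

/-- A bijective version of `swapMap`. -/
noncomputable def swapEquiv (t : OrthType) : alg t ≃ₗ[ℂ] alg t :=
  LinearEquiv.ofInjectiveEndo (swapMap t) swapMap_injective

/-- If only the brackets with the component of degree `g₁` survive, the components of degrees
`g₄` and `g₇` play the same role: the adjoint action of a regular element of degree `g₁`
commutes with that of the whole component, and exchanges the two. -/
theorem equivalent_of_swap {ε ε' : G → G → ℂ}
    (hs : ∀ g, g ≠ 0 → g ≠ deg 1 → ε g (deg 1) = ε (deg 1) g)
    (hs' : ∀ g, g ≠ 0 → g ≠ deg 1 → ε' g (deg 1) = ε' (deg 1) g)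
    (h0 : ∀ g h, g ≠ deg 1 → h ≠ deg 1 → ε g h = 0)
    (h0' : ∀ g h, g ≠ deg 1 → h ≠ deg 1 → ε' g h = 0)
    (h : ∀ g, g ≠ 0 → g ≠ deg 1 → ε' (deg 1) (Equiv.swap (deg 4) (deg 7) g) = ε (deg 1) g) :
    (Γ t).Equivalent ε ε' := by
  set σ : Equiv.Perm G := Equiv.swap (deg 4) (deg 7) with hσ
  have σ0 : ∀ g : G, g = 0 ↔ Equiv.swap (deg 4) (deg 7) g = 0 := by decide
  have σ1 : ∀ g : G, g = deg 1 ↔ Equiv.swap (deg 4) (deg 7) g = deg 1 := by decide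
  have hf : ∀ x, swapEquiv t x = swapMap t x := fun x => rfl
  have hp : ∀ g, (deg 1 + g = deg 4 ∨ deg 1 + g = deg 7) ↔ (g = deg 4 ∨ g = deg 7) := by decide
  have key : ∀ g, g ≠ 0 → g ≠ deg 1 → ∀ x ∈ (Γ t).comp (deg 1), ∀ y ∈ (Γ t).comp g,
      swapMap t ⁅x, y⁆ = ⁅swapMap t x, swapMap t y⁆ := by
    intro g _ _ x hx y hy
    rw [swapMap_of_mem (lie_mem _ hx hy), swapMap_of_mem hx, swapMap_of_mem hy,
      if_neg (show ¬(deg 1 = deg 4 ∨ deg 1 = deg 7) by decide)]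
    simp only [hp]
    split_ifs
    · rw [leibniz_lie, lie_eq_zero_of_mem_comp regular_mem hx, zero_lie, zero_add]
    · rfl
  refine equivalent_of_homogeneous _ (swapEquiv t) σ (fun g => ?_) fun g k x hx y hy => ?_
  · apply le_antisymm
    · rintro _ ⟨x, hx, rfl⟩
      exact swapMap_mem hx
    · intro x hx
      refine ⟨(swapEquiv t).symm x, ?_, (swapEquiv t).apply_symm_apply x⟩
      have h1 := swapMap_proj g ((swapEquiv t).symm x)
      rw [← hf ((swapEquiv t).symm x), LinearEquiv.apply_symm_apply, proj_of_mem _ hx] at h1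
      rw [← h1, ← hf, LinearEquiv.symm_apply_apply]
      exact proj_mem (Γ t) _ _
  · simp only [hf]
    by_cases hd : g = 0 ∨ k = 0 ∨ g = k
    · have hd' : σ g = 0 ∨ σ k = 0 ∨ σ g = σ k :=
        hd.imp (σ0 g).1 (Or.imp (σ0 k).1 (congrArg σ))
      rw [lie_eq_zero_of_degenerate hd hx hy,
        lie_eq_zero_of_degenerate hd' (swapMap_mem hx) (swapMap_mem hy), map_zero, smul_zero,
        smul_zero]
    obtain ⟨hg, hk, hgk⟩ : g ≠ 0 ∧ k ≠ 0 ∧ g ≠ k := by tauto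
    by_cases h1 : g = deg 1
    · subst h1
      have s1 : σ (deg 1) = deg 1 := ((σ1 _).1 rfl)
      rw [key k hk hgk.symm x hx y hy, s1, h k hk hgk.symm]
    · by_cases h2 : k = deg 1
      · subst h2
        have s1 : σ (deg 1) = deg 1 := ((σ1 _).1 rfl)
        rw [← lie_skew, map_neg, key g hg hgk y hy x hx, lie_skew, s1,
          hs' _ (fun h => hg ((σ0 g).2 h)) (fun h => h1 ((σ1 g).2 h)), h g hg h1, hs g hg h1]
      · rw [h0 g k h1 h2, h0' _ _ (fun h => h1 ((σ1 g).2 h)) (fun h => h2 ((σ1 k).2 h)),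
          zero_smul, zero_smul]

/-! ### The permutation of the components induced by an equivalence -/

theorem exists_mem_comp_ne_zero (t : OrthType) {g : G} (hg : g ≠ 0) :
    ∃ x ∈ (Γ t).comp g, x ≠ 0 := by
  obtain ⟨h, h0, hgh⟩ : ∃ h : G, h ≠ 0 ∧ g ≠ h := by revert g; decide
  obtain ⟨x, hx, y, -, hxy⟩ := exists_lie_ne_zero t hg h0 hgh
  exact ⟨x, hx, fun h => hxy (by rw [h, zero_lie])⟩

theorem comp_injective {g h : G} (hgh : (Γ t).comp g = (Γ t).comp h) : g = h := by
  by_cases hg : g = 0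
  · by_contra hne
    obtain ⟨x, hx, h0⟩ := exists_mem_comp_ne_zero t (fun h' => hne (hg.trans h'.symm))
    rw [← hgh, hg, comp_zero, Submodule.mem_bot] at hx
    exact h0 hx
  · obtain ⟨x, hx, h0⟩ := exists_mem_comp_ne_zero t hg
    exact eq_of_mem_comp _ hx (hgh ▸ hx) h0

/-- The isomorphism `f` realizes an equivalence from `ε` to `ε'` and sends the component of degree
`g` onto the one of degree `σ g`. -/
structure IsEquivalence (t : OrthType) (ε ε' : G → G → ℂ) (f : alg t ≃ₗ[ℂ] alg t) (σ : G → G) :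
    Prop where
  map_bracket : ∀ x y, f ((Γ t).bracket ε x y) = (Γ t).bracket ε' (f x) (f y)
  map_comp : ∀ g, ((Γ t).comp g).map (f : alg t →ₗ[ℂ] alg t) = (Γ t).comp (σ g)

theorem exists_isEquivalence {ε ε' : G → G → ℂ} (h : (Γ t).Equivalent ε ε') :
    ∃ f σ, IsEquivalence t ε ε' f σ := by
  obtain ⟨f, hf, hg⟩ := h
  choose σ hσ using hg
  exact ⟨f, σ, hf, hσ⟩

namespace IsEquivalence

variable {ε ε' : G → G → ℂ} {f : alg t ≃ₗ[ℂ] alg t} {σ : G → G}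

theorem map_mem (E : IsEquivalence t ε ε' f σ) {g : G} {x : alg t}
    (hx : x ∈ (Γ t).comp g) : f x ∈ (Γ t).comp (σ g) :=
  E.map_comp g ▸ Submodule.mem_map_of_mem hx

theorem symm_mem (E : IsEquivalence t ε ε' f σ) {g : G} {x : alg t}
    (hx : x ∈ (Γ t).comp (σ g)) : f.symm x ∈ (Γ t).comp g := by
  rw [← E.map_comp g] at hx
  obtain ⟨y, hy, rfl⟩ := hx
  rwa [LinearEquiv.coe_coe, LinearEquiv.symm_apply_apply]

theorem injective (E : IsEquivalence t ε ε' f σ) : Function.Injective σ := by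
  intro g h hgh
  apply comp_injective (t := t)
  apply Submodule.map_injective_of_injective (f := (f : alg t →ₗ[ℂ] alg t)) f.injective
  rw [E.map_comp, E.map_comp, hgh]

theorem map_zero' (E : IsEquivalence t ε ε' f σ) : σ 0 = 0 := by
  apply comp_injective (t := t)
  rw [← E.map_comp, comp_zero, Submodule.map_bot]

theorem map_ne_zero (E : IsEquivalence t ε ε' f σ) {g : G} (hg : g ≠ 0) : σ g ≠ 0 := fun h =>
  hg (E.injective (h.trans E.map_zero'.symm))

theorem map_lie (E : IsEquivalence t ε ε' f σ) {g h : G} {x y : alg t}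
    (hx : x ∈ (Γ t).comp g) (hy : y ∈ (Γ t).comp h) :
    ε g h • f ⁅x, y⁆ = ε' (σ g) (σ h) • ⁅f x, f y⁆ := by
  rw [← bracket_of_mem _ _ (E.map_mem hx) (E.map_mem hy), ← E.map_bracket,
    bracket_of_mem _ _ hx hy, map_smul]

/-- An equivalence preserves the support, since brackets of components of distinct nonzero degrees
do not vanish. -/
theorem support_iff (E : IsEquivalence t ε ε' f σ) {g h : G} (hg : g ≠ 0) (hh : h ≠ 0)
    (hgh : g ≠ h) :
    ε g h ≠ 0 ↔ ε' (σ g) (σ h) ≠ 0 := by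
  constructor
  · intro h0 h0'
    obtain ⟨x, hx, y, hy, hxy⟩ := exists_lie_ne_zero t hg hh hgh
    have := E.map_lie hx hy
    rw [h0', zero_smul, smul_eq_zero, LinearEquiv.map_eq_zero_iff] at this
    tauto
  · intro h0 h0'
    obtain ⟨x, hx, y, hy, hxy⟩ := exists_lie_ne_zero t (E.map_ne_zero hg) (E.map_ne_zero hh)
      (E.injective.ne hgh)
    have := E.map_lie (E.symm_mem hx) (E.symm_mem hy)
    rw [h0', zero_smul, LinearEquiv.apply_symm_apply, LinearEquiv.apply_symm_apply, eq_comm,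
      smul_eq_zero] at this
    tauto

/-- An equivalence is additive on degrees wherever the contracted bracket survives. -/
theorem map_add_of_ne_zero (E : IsEquivalence t ε ε' f σ) {g h : G} (hg : g ≠ 0)
    (hh : h ≠ 0) (hgh : g ≠ h) (h0 : ε g h ≠ 0) :
    σ (g + h) = σ g + σ h := by
  obtain ⟨x, hx, y, hy, hxy⟩ := exists_lie_ne_zero t hg hh hgh
  have h1 : ε g h • f ⁅x, y⁆ ∈ (Γ t).comp (σ (g + h)) :=
    Submodule.smul_mem _ _ (E.map_mem (lie_mem _ hx hy))
  refine eq_of_mem_comp _ h1 ?_ (smul_ne_zero h0 ((LinearEquiv.map_ne_zero_iff f).2 hxy))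
  rw [E.map_lie hx hy]
  exact Submodule.smul_mem _ _ (lie_mem _ (E.map_mem hx) (E.map_mem hy))

end IsEquivalence

/-! ### Trace forms -/

theorem proj_eq_sum (g : G) (y : alg t) :
    (Γ t).proj g y = ∑ j, (2⁻¹ * cf (g + j) j y) • unit t (g + j) j := by
  refine homogeneous_induction (Γ t)
    (P := fun y => (Γ t).proj g y = ∑ j, (2⁻¹ * cf (g + j) j y) • unit t (g + j) j)
    (fun h y hy => ?_) (fun x y hx hy => ?_) y
  · by_cases hgh : h = g
    · subst hgh
      rw [proj_of_mem _ hy]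
      refine cf_ext fun k l => ?_
      have hu : ∀ j, cf (h + j) j y * cf k l (unit t (h + j) j) = cf (h + j) j y *
          ((if k = h + j then 1 else 0) * (if l = j then 1 else 0) -
            (if l = h + j then 1 else 0) * (if k = j then 1 else 0)) := by
        intro j
        cases hj : moved t j
        · rw [cf_eq_zero_right y hj, zero_mul, zero_mul]
        cases hj' : moved t (h + j)
        · rw [cf_eq_zero_left y hj', zero_mul, zero_mul]
        rw [cf_unit hj' hj, mul_comm (if l = j then (1 : ℂ) else 0)]
      have hs : ∀ j, (l = h + j) ↔ (h + l = j) := fun j =>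
        ⟨fun e => by rw [e, add_add_cancel_G], fun e => by rw [← e, add_add_cancel_G]⟩
      simp only [map_sum, map_smul, smul_eq_mul, mul_assoc, hu]
      simp only [hs, mul_sub, Finset.sum_sub_distrib, mul_ite, mul_one, mul_zero,
        Finset.sum_ite_eq, Finset.mem_univ, if_true]
      by_cases hk : k = h + l
      · subst hk
        rw [if_pos rfl, if_pos rfl, add_add_cancel_G, cf_skew y l (h + l)]
        ring
      · rw [if_neg hk, if_neg (Ne.symm hk), mem_comp_iff.1 hy k l hk, sub_zero]
    · rw [proj_of_mem_ne _ hgh hy, eq_comm]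
      refine Finset.sum_eq_zero fun j _ => ?_
      rw [mem_comp_iff.1 hy _ _ fun h' => hgh (add_right_cancel h').symm, mul_zero, zero_smul]
  · simp only [map_add, mul_add, add_smul, Finset.sum_add_distrib, hx, hy]

theorem trace_comp_proj (F : alg t →ₗ[ℂ] alg t) (g : G) :
    LinearMap.trace ℂ (alg t) (F ∘ₗ (Γ t).proj g) =
      ∑ j, 2⁻¹ * cf (g + j) j (F (unit t (g + j) j)) := by
  have : F ∘ₗ (Γ t).proj g = ∑ j : G, (2⁻¹ : ℂ) •
      LinearMap.smulRight (cf (g + j) j) (F (unit t (g + j) j)) := by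
    ext1 y
    rw [LinearMap.comp_apply, proj_eq_sum, map_sum, LinearMap.sum_apply]
    refine Finset.sum_congr rfl fun j _ => ?_
    rw [map_smul, LinearMap.smul_apply, LinearMap.smulRight_apply, smul_smul]
  rw [this, map_sum]
  refine Finset.sum_congr rfl fun j _ => ?_
  rw [map_smul, LinearMap.trace_smulRight, smul_eq_mul]

/-- The symmetric bilinear form `∑ x_j x'_j` in the matrix coefficients of two elements of
degree `p`, where `j` runs through the indices such that `g + j, j` is a matrix unit of the
algebra. -/
noncomputable def form (t : OrthType) (p g : G) (x x' : alg t) : ℂ :=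
  ∑ j, if moved t j ∧ moved t (g + j) then cf (p + j) j x * cf (p + j) j x' else 0

theorem cf_lie_lie_unit {p g : G} (hp : p ≠ 0) (hg : g ≠ 0) (hgp : g ≠ p) {x x' : alg t}
    (hx : x ∈ (Γ t).comp p) (hx' : x' ∈ (Γ t).comp p) {j : G} (hj : moved t j = true)
    (hj' : moved t (g + j) = true) :
    cf (g + j) j ⁅x, ⁅x', unit t (g + j) j⁆⁆ =
      -(cf (p + j) j x * cf (p + j) j x' +
        cf (p + (g + j)) (g + j) x * cf (p + (g + j)) (g + j) x') := by
  have hU : unit t (g + j) j ∈ (Γ t).comp g := unit_mem_of_add (by rw [add_add_self])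
  have n1 : p + j ≠ j := by simpa using hp
  have n2 : p + j ≠ g + j := fun h => hgp (add_right_cancel h).symm
  have n3 : g + (p + j) ≠ j := by
    rw [← add_assoc]
    intro h
    have : g + p = 0 := by simpa using h
    exact hgp (by rw [← add_add_self g p, this, zero_add])
  have n4 : g + j ≠ j := by simpa using hg
  have v1 := cf_lie_of_mem hx' hU (p + (g + j)) j
  have v2 := cf_lie_of_mem hx' hU (g + j) (p + j)
  have e : p + g + j = p + (g + j) := add_assoc _ _ _
  rw [cf_lie_of_mem hx (lie_mem _ hx' hU), e, v1, v2, cf_unit hj' hj, cf_unit hj' hj,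
    cf_unit hj' hj, cf_unit hj' hj, cf_skew x (g + j), cf_skew x' (p + (p + j)),
    add_add_cancel_G]
  simp [n1, n2, n3, n4, n4.symm]
  ring

theorem trace_lie_lie_proj {p g : G} (hp : p ≠ 0) (hg : g ≠ 0) (hgp : g ≠ p) {x x' : alg t}
    (hx : x ∈ (Γ t).comp p) (hx' : x' ∈ (Γ t).comp p) :
    LinearMap.trace ℂ (alg t) ((LieModule.toEnd ℂ (alg t) (alg t) x ∘ₗ
      LieModule.toEnd ℂ (alg t) (alg t) x') ∘ₗ (Γ t).proj g) = -form t p g x x' := by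
  rw [trace_comp_proj]
  have h1 : ∀ j, 2⁻¹ * cf (g + j) j ((LieModule.toEnd ℂ (alg t) (alg t) x ∘ₗ
      LieModule.toEnd ℂ (alg t) (alg t) x') (unit t (g + j) j)) =
      -2⁻¹ * (if moved t j ∧ moved t (g + j) then cf (p + j) j x * cf (p + j) j x' else 0) +
      -2⁻¹ * (if moved t (g + j) ∧ moved t (g + (g + j)) then
        cf (p + (g + j)) (g + j) x * cf (p + (g + j)) (g + j) x' else 0) := by
    intro j
    simp only [add_add_cancel_G, and_comm (a := moved t (g + j) = true)]
    split_ifs with h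
    · change 2⁻¹ * cf (g + j) j ⁅x, ⁅x', unit t (g + j) j⁆⁆ = _
      rw [cf_lie_lie_unit hp hg hgp hx hx' h.1 h.2]
      ring
    · rw [unit, dif_neg (by tauto)]
      simp
  simp only [h1]
  have h2 : ∑ j, -2⁻¹ * (if moved t (g + j) ∧ moved t (g + (g + j)) then
      cf (p + (g + j)) (g + j) x * cf (p + (g + j)) (g + j) x' else 0) = ∑ j, -2⁻¹ *
        (if moved t j ∧ moved t (g + j) then cf (p + j) j x * cf (p + j) j x' else 0) :=
    Equiv.sum_comp (Equiv.addLeft g) fun j =>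
      -2⁻¹ * (if moved t j ∧ moved t (g + j) then cf (p + j) j x * cf (p + j) j x' else 0)
  rw [Finset.sum_add_distrib, h2, ← Finset.mul_sum]
  change -2⁻¹ * form t p g x x' + -2⁻¹ * form t p g x x' = _
  ring

/-- The factor by which the contraction multiplies the action of `ad x ad x'` on the component of
degree `g`, for `x` and `x'` of degree `p`. -/
def weight (ε : G → G → ℂ) (p g : G) : ℂ := ε p (p + g) * ε p g

theorem mul_trace_eq_of_intertwine {V : Type*} [AddCommGroup V] [Module ℂ V] (f : V ≃ₗ[ℂ] V)
    (M N : V →ₗ[ℂ] V) {a b : ℂ} (h : ∀ y, a • f (M y) = b • N (f y)) :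
    a * LinearMap.trace ℂ V M = b * LinearMap.trace ℂ V N := by
  have h1 : a • f.conj M = b • N := by
    ext z
    obtain ⟨y, rfl⟩ := f.surjective z
    simpa [LinearEquiv.conj_apply_apply] using h y
  have h2 := congrArg (LinearMap.trace ℂ V) h1
  rwa [map_smul, map_smul, LinearMap.trace_conj', smul_eq_mul, smul_eq_mul] at h2

theorem IsEquivalence.weight_mul_form {ε ε' : G → G → ℂ} {f : alg t ≃ₗ[ℂ] alg t} {σ : G → G}
    (E : IsEquivalence t ε ε' f σ) {p g : G} (hp : p ≠ 0) (hg : g ≠ 0) (hgp : g ≠ p) {x x' : alg t}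
    (hx : x ∈ (Γ t).comp p) (hx' : x' ∈ (Γ t).comp p) :
    weight ε p g * form t p g x x' =
      weight ε' (σ p) (σ g) * form t (σ p) (σ g) (f x) (f x') := by
  have hc : ∀ h, ∀ y ∈ (Γ t).comp h, weight ε p g • f ⁅x, ⁅x', (Γ t).proj g y⁆⁆ =
      weight ε' (σ p) (σ g) • ⁅f x, ⁅f x', (Γ t).proj (σ g) (f y)⁆⁆ := by
    intro h y hy
    by_cases hh : h = g
    · subst hh
      rw [proj_of_mem _ hy, proj_of_mem _ (E.map_mem hy)]
      have h1 := E.map_bracket x ((Γ t).bracket ε x' y)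
      rw [E.map_bracket x' y, bracket_of_mem _ _ hx' hy, bracket_of_mem _ _ (E.map_mem hx')
        (E.map_mem hy), map_smul ((Γ t).bracket ε x), map_smul ((Γ t).bracket ε' (f x)),
        bracket_of_mem _ _ hx (lie_mem _ hx' hy),
        bracket_of_mem _ _ (E.map_mem hx) (lie_mem _ (E.map_mem hx') (E.map_mem hy)),
        map_smul f, map_smul f, smul_smul, smul_smul] at h1
      rw [weight, weight, mul_comm, h1, mul_comm]
    · rw [proj_of_mem_ne _ hh hy, proj_of_mem_ne _ (E.injective.ne hh) (E.map_mem hy)]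
      simp
  have hl := mul_trace_eq_of_intertwine f
    ((LieModule.toEnd ℂ (alg t) (alg t) x ∘ₗ LieModule.toEnd ℂ (alg t) (alg t) x') ∘ₗ (Γ t).proj g)
    ((LieModule.toEnd ℂ (alg t) (alg t) (f x) ∘ₗ LieModule.toEnd ℂ (alg t) (alg t) (f x')) ∘ₗ
      (Γ t).proj (σ g)) (homogeneous_induction (Γ t) hc
        fun a b ha hb => by simp only [map_add, smul_add, ha, hb])
  rw [trace_lie_lie_proj hp hg hgp hx hx', trace_lie_lie_proj (E.map_ne_zero hp) (E.map_ne_zero hg)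
    (E.injective.ne hgp) (E.map_mem hx) (E.map_mem hx')] at hl
  simpa using hl

/-- The number of those among the indices `a` and `p + a` that contribute to `form t p g`. -/
def formMult (t : OrthType) (p g a : G) : ℂ :=
  (if moved t (g + a) then 1 else 0) + (if moved t (g + (p + a)) then 1 else 0)

theorem form_unit {p a : G} (hp : p ≠ 0) (ha : moved t a = true) (ha' : moved t (p + a) = true)
    (g : G) (x : alg t) :
    form t p g x (unit t (p + a) a) = formMult t p g a * cf (p + a) a x := by
  have hn : p + a ≠ a := by simpa using hp
  have hs : ∀ j, (p + j = a) ↔ (j = p + a) := fun j =>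
    ⟨fun e => by rw [← e, add_add_cancel_G], fun e => by rw [e, add_add_cancel_G]⟩
  unfold form formMult
  simp only [cf_unit ha' ha, hs, add_right_inj]
  rw [← Finset.sum_subset (Finset.subset_univ {a, p + a})]
  · rw [Finset.sum_pair hn.symm]
    simp only [ha, ha', add_add_cancel_G, cf_skew x a (p + a), hn, hn.symm, true_and, if_true,
      if_false]
    split_ifs <;> ring
  · intro j _ hj
    simp only [Finset.mem_insert, Finset.mem_singleton, not_or] at hj
    simp only [if_neg hj.1, if_neg hj.2, sub_zero, mul_zero, ite_self]

theorem form_comm (p g : G) (x x' : alg t) : form t p g x x' = form t p g x' x :=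
  Finset.sum_congr rfl fun j _ => by rw [mul_comm]

theorem formMult_of_ne {p g a : G} (h : g ≠ a) (h' : g ≠ p + a) : formMult t p g a = 2 := by
  have hs : ∀ a b : G, a ≠ b → a + b ≠ 0 := by decide
  rw [formMult, moved_of_ne t (hs _ _ h), moved_of_ne t (hs _ _ h')]
  norm_num

theorem formMult_self {p : G} (hp : p ≠ 0) (g : G) :
    formMult t p g g = if moved t 0 then 2 else 1 := by
  rw [formMult, add_self_G, add_left_comm, add_self_G, add_zero, moved_of_ne t hp]
  cases moved t 0 <;> norm_num

theorem formMult_eq {p : G} (hp : p ≠ 0) (g a : G) :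
    formMult t p g a = 2 ∨ (moved t 0 = false ∧ formMult t p g a = 1) := by
  have hs : ∀ a b : G, a ≠ b → a + b ≠ 0 := by decide
  by_cases h : g = a
  · subst h
    rw [formMult_self hp]
    cases moved t 0 <;> simp
  by_cases h' : g = p + a
  · subst h'
    rw [formMult, add_self_G, moved_of_ne t (hs _ _ h)]
    cases moved t 0 <;> norm_num
  · exact Or.inl (formMult_of_ne h h')

/-- The weights on two lines through `p` change under an equivalence by the same factor: on both
lines, the weight times the trace form is preserved. For `𝔡₄` the forms attached to the two lines
coincide. For `𝔟₃` the form of the line through `g` is half of that of the other line on the matrix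
unit at `g`, and conversely for `h`, while the ratio of the forms on any matrix unit is `1 / 2`, `1`
or `2`. Hence the quotient of the two factors lies in `{1 / 4, 1 / 2, 1}` as well as in
`{1, 2, 4}`. -/
theorem IsEquivalence.weight_ratio {ε ε' : G → G → ℂ} {f : alg t ≃ₗ[ℂ] alg t} {σ : G → G}
    (E : IsEquivalence t ε ε' f σ) {p g h : G} (hp : p ≠ 0) (hg : g ≠ 0) (hgp : g ≠ p) (hh : h ≠ 0)
    (hhp : h ≠ p) (hgh : g ≠ h) (hgh' : h ≠ p + g) :
    weight ε p h * weight ε' (σ p) (σ g) = weight ε p g * weight ε' (σ p) (σ h) := by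
  have hs : ∀ a b : G, b ≠ a → a + b ≠ 0 := by decide
  have key : ∀ g h, g ≠ 0 → g ≠ p → h ≠ 0 → h ≠ p → ∃ a,
      formMult t p h g * (weight ε p h * weight ε' (σ p) (σ g)) * formMult t (σ p) (σ g) a =
      formMult t p g g * (weight ε p g * weight ε' (σ p) (σ h)) * formMult t (σ p) (σ h) a := by
    intro g h hg hgp hh hhp
    have mg := moved_of_ne t hg
    have mg' := moved_of_ne t (hs p g hgp)
    have hu : unit t (p + g) g ∈ (Γ t).comp p := unit_mem_of_add (by rw [add_add_self])
    have hy := E.map_mem hu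
    have hu0 : unit t (p + g) g ≠ 0 := unit_ne_zero mg' mg (by simpa using hp)
    obtain ⟨a, ha⟩ : ∃ a, cf (σ p + a) a (f (unit t (p + g) g)) ≠ 0 := by
      by_contra hc
      push Not at hc
      refine hu0 ((LinearEquiv.map_eq_zero_iff f).1 (cf_ext fun k j => ?_))
      rw [map_zero]
      by_cases hkj : k = σ p + j
      · rw [hkj, hc]
      · exact mem_comp_iff.1 hy k j hkj
    have ma : moved t a = true := by
      by_contra hc
      exact ha (cf_eq_zero_right _ (by simpa using hc))
    have ma' : moved t (σ p + a) = true := by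
      by_contra hc
      exact ha (cf_eq_zero_left _ (by simpa using hc))
    have hx' : unit t (σ p + a) a ∈ (Γ t).comp (σ p) := unit_mem_of_add (by rw [add_add_self])
    have E1 := E.weight_mul_form hp hg hgp hu (E.symm_mem hx')
    have E2 := E.weight_mul_form hp hh hhp hu (E.symm_mem hx')
    rw [LinearEquiv.apply_symm_apply, form_unit (E.map_ne_zero hp) ma ma', form_comm,
      form_unit hp mg mg'] at E1 E2
    refine ⟨a, mul_right_cancel₀ ha ?_⟩
    linear_combination weight ε p g * formMult t p g g * E2 -
      weight ε p h * formMult t p h g * E1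
  obtain ⟨a, ha⟩ := key g h hg hgp hh hhp
  obtain ⟨b, hb⟩ := key h g hh hhp hg hgp
  have hgh2 : g ≠ p + h := fun e => hgh' (by rw [e, add_add_cancel_G])
  rw [formMult_of_ne hgh.symm hgh', formMult_self hp] at ha
  rw [formMult_of_ne hgh hgh2, formMult_self hp] at hb
  have hp' := E.map_ne_zero hp
  rcases formMult_eq (t := t) hp' (σ g) a with h1 | ⟨h0, h1⟩ <;>
  rcases formMult_eq (t := t) hp' (σ h) a with h2 | ⟨h0, h2⟩ <;>
  rcases formMult_eq (t := t) hp' (σ h) b with h3 | ⟨h0, h3⟩ <;>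
  rcases formMult_eq (t := t) hp' (σ g) b with h4 | ⟨h0, h4⟩ <;>
  rw [h1, h2] at ha <;> rw [h3, h4] at hb <;> cases h5 : moved t 0 <;>
  simp only [h5, if_true, Bool.false_eq_true, if_false] at ha hb <;> grind

/-! ### Classification of the supports -/

/-- A point of the Fano plane as a binary number. -/
def code (g : G) : ℕ := g.1.val + 2 * g.2.1.val + 4 * g.2.2.val

/-- The position `8 a + b` of the edge `{g, h}` in a bit mask, for the codes `a < b` of its ends. -/
def edgeBit (g h : G) : ℕ :=
  bif (code g).blt (code h) then 8 * code g + code h else 8 * code h + code g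

/-- The points of the Fano plane, ordered by `code`. -/
def points : List G := [1, 2, 5, 3, 6, 7, 4].map deg

/-- The edges of the complete graph on the Fano plane, ordered by position. -/
def edgeList : List (G × G) :=
  (points.product points).filter fun p => (code p.1).blt (code p.2)

/-- The set of edges of a graph on the Fano plane as a bit mask. -/
def maskOf (S : G → G → Bool) : ℕ :=
  edgeList.foldr
    (fun p m => bif S p.1 p.2 then Nat.lor m (Nat.shiftLeft 1 (edgeBit p.1 p.2)) else m) 0

/-- A graph on the Fano plane is nice if, for every generic triple, it contains either all or none
of the three pairs of edges that occur in the Jacobi identity. -/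
def Nice (S : G → G → Bool) : Prop :=
  (∀ g h, S g h = S h g) ∧
    ∀ g h k, Generic g h k → S g (h + k) = true → S h k = true → S h (k + g) = true ∧ S k g = true

/-- The positions of the four edges in the defining condition of nice graphs, both for a
triple and for its opposite. -/
def implications : List (ℕ × ℕ × ℕ × ℕ) :=
  ((points.product (points.product points)).filter fun p => Generic p.1 p.2.1 p.2.2).map fun p =>
    (edgeBit p.1 (p.2.1 + p.2.2), edgeBit p.2.1 p.2.2,
      edgeBit p.2.1 (p.2.2 + p.1), edgeBit p.2.2 p.1)

/-- The implications that can be tested as soon as the edges up to position `e` are decided, but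
not before. -/
def implicationsAt (e : ℕ) : List (ℕ × ℕ × ℕ × ℕ) :=
  implications.filter fun (a, b, c, d) => a.ble e && b.ble e && c.ble e && d.ble e &&
    (a.beq e || b.beq e || c.beq e || d.beq e)

/-- The order in which the search decides the edges, with the implications to be tested. -/
def levels : List (ℕ × List (ℕ × ℕ × ℕ × ℕ)) :=
  edgeList.map fun p => (edgeBit p.1 p.2, implicationsAt (edgeBit p.1 p.2))

/-- A version of `Nat.testBit` which the kernel evaluates by arithmetic on literals. -/
def hasBit (m e : ℕ) : Bool := Nat.beq (Nat.land (Nat.shiftRight m e) 1) 1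

theorem hasBit_eq (m e : ℕ) : hasBit m e = m.testBit e := by
  rw [Bool.eq_iff_iff, hasBit, Nat.beq_eq, Nat.testBit_eq_decide_div_mod_eq, decide_eq_true_eq,
    ← Nat.shiftRight_eq_div_pow, ← Nat.and_one_is_mod]
  rfl

/-- The implication `c` fails for all graphs that contain `inn` and avoid `out`. -/
def violated (inn out : ℕ) (c : ℕ × ℕ × ℕ × ℕ) : Bool :=
  hasBit inn c.1 && (hasBit inn c.2.1 && (hasBit out c.2.2.1 || hasBit out c.2.2.2))

/-- The test `leaf` succeeds for all masks that contain `inn`, avoid `out` and satisfy the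
implications in the list of undecided edges. -/
def search (leaf : ℕ → Bool) : List (ℕ × List (ℕ × ℕ × ℕ × ℕ)) → ℕ → ℕ → Bool
  | [], inn, _ => leaf inn
  | l :: L, inn, out =>
    (l.2.any (violated (inn ||| (1 <<< l.1)) out) || search leaf L (inn ||| (1 <<< l.1)) out) &&
    (l.2.any (violated inn (out ||| (1 <<< l.1))) || search leaf L inn (out ||| (1 <<< l.1)))

theorem testBit_or_shift (m e i : ℕ) :
    (m ||| (1 <<< e)).testBit i = true ↔ m.testBit i = true ∨ i = e := by
  rw [Nat.testBit_or, Nat.one_shiftLeft, Nat.testBit_two_pow, Bool.or_eq_true, decide_eq_true_eq,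
    eq_comm (a := e)]

theorem search_sound {leaf : ℕ → Bool} {S : ℕ → Prop} :
    ∀ (L : List (ℕ × List (ℕ × ℕ × ℕ × ℕ))) (inn out : ℕ),
      (∀ l ∈ L, ∀ c ∈ l.2, S c.1 → S c.2.1 → S c.2.2.1 ∧ S c.2.2.2) →
      (∀ e, inn.testBit e = true → S e) → (∀ e, out.testBit e = true → ¬ S e) →
      search leaf L inn out = true →
      ∃ m, leaf m = true ∧ (∀ e, m.testBit e = true → S e) ∧
        (∀ e, inn.testBit e = true → m.testBit e = true) ∧
        ∀ l ∈ L, S l.1 → m.testBit l.1 = true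
  | [], inn, out, _, hin, _, h => ⟨inn, h, hin, fun _ h => h, by simp⟩
  | l :: L, inn, out, hS, hin, hout, h => by
    have hv : ∀ inn out : ℕ, (∀ e, inn.testBit e = true → S e) →
        (∀ e, out.testBit e = true → ¬ S e) → l.2.any (violated inn out) = false := by
      intro inn out hin hout
      rw [List.any_eq_false]
      intro c hc hviol
      simp only [violated, hasBit_eq, Bool.and_eq_true, Bool.or_eq_true] at hviol
      obtain ⟨h1, h2, h3⟩ := hviol
      have := hS l List.mem_cons_self c hc (hin _ h1) (hin _ h2)
      rcases h3 with h3 | h3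
      · exact hout _ h3 this.1
      · exact hout _ h3 this.2
    have hS' : ∀ l ∈ L, ∀ c ∈ l.2, S c.1 → S c.2.1 → S c.2.2.1 ∧ S c.2.2.2 := fun l hl =>
      hS l (List.mem_cons_of_mem _ hl)
    rw [search, Bool.and_eq_true, Bool.or_eq_true, Bool.or_eq_true] at h
    by_cases hl : S l.1
    · have hin' : ∀ e, (inn ||| (1 <<< l.1)).testBit e = true → S e := by
        intro e he
        rcases (testBit_or_shift _ _ _).1 he with he | rfl
        · exact hin e he
        · exact hl
      have h1 := h.1
      rw [hv _ _ hin' hout] at h1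
      obtain ⟨m, hm, hm1, hm2, hm3⟩ :=
        search_sound L _ _ hS' hin' hout (h1.resolve_left Bool.false_ne_true)
      refine ⟨m, hm, hm1, fun e he => hm2 e ((testBit_or_shift _ _ _).2 (Or.inl he)), ?_⟩
      intro l' hl' hSl
      rcases List.mem_cons.1 hl' with rfl | hl'
      · exact hm2 _ ((testBit_or_shift _ _ _).2 (Or.inr rfl))
      · exact hm3 l' hl' hSl
    · have hout' : ∀ e, (out ||| (1 <<< l.1)).testBit e = true → ¬ S e := by
        intro e he
        rcases (testBit_or_shift _ _ _).1 he with he | rfl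
        · exact hout e he
        · exact hl
      have h1 := h.2
      rw [hv _ _ hin hout'] at h1
      obtain ⟨m, hm, hm1, hm2, hm3⟩ :=
        search_sound L _ _ hS' hin hout' (h1.resolve_left Bool.false_ne_true)
      refine ⟨m, hm, hm1, hm2, fun l' hl' hSl => ?_⟩
      rcases List.mem_cons.1 hl' with rfl | hl'
      · exact absurd hSl hl
      · exact hm3 l' hl' hSl

/-- The transvection `x ↦ x + ⟨w, x⟩ v`. -/
def transvection (w v x : G) : G :=
  x + ((w.1 * x.1 + w.2.1 * x.2.1 + w.2.2 * x.2.2) * v.1,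
    (w.1 * x.1 + w.2.1 * x.2.1 + w.2.2 * x.2.2) * v.2.1,
    (w.1 * x.1 + w.2.1 * x.2.1 + w.2.2 * x.2.2) * v.2.2)

/-- The pairs `(w, v)` of nonzero vectors with `⟨w, v⟩ = 0`, which define transvections. -/
def transvectionList : List (G × G) := (points.product points).filter fun p =>
  p.1.1 * p.2.1 + p.1.2.1 * p.2.2.1 + p.1.2.2 * p.2.2.2 = 0

/-- The nice sets `T_1, …, T_24` as bit masks. -/
def representatives : List ℕ :=
  (List.range' 1 24).map fun i => maskOf fun g h => decide (s(idx g, idx h) ∈ T i)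

/-- The mask of the preimage of a graph under a map of the Fano plane. -/
def pullback (τ : G → G) (m : ℕ) : ℕ := maskOf fun g h => hasBit m (edgeBit (τ g) (τ h))

/-- The mask is a representative or smaller than `m`. -/
def better (m m' : ℕ) : Bool := m'.blt m || representatives.elem m'

/-- The mask `m` is a representative, or becomes better under a transvection or a product of two
transvections. -/
def reducible (m : ℕ) : Bool :=
  representatives.elem m ||
    (transvectionList.any (fun p => better m (pullback (transvection p.1 p.2) m)) ||
      transvectionList.any fun p => transvectionList.any fun q => better m
        (pullback (transvection p.1 p.2) (pullback (transvection q.1 q.2) m)))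

set_option maxRecDepth 100000 in
/-- The enumeration of the nice sets. -/
theorem search_levels : search reducible levels 0 0 = true := by
  decide +kernel

theorem testBit_foldr (S : G → G → Bool) (l : List (G × G)) (e : ℕ) :
    (l.foldr (fun p m => bif S p.1 p.2 then Nat.lor m (Nat.shiftLeft 1 (edgeBit p.1 p.2)) else m)
      0).testBit e = true ↔ ∃ p ∈ l, S p.1 p.2 = true ∧ edgeBit p.1 p.2 = e := by
  induction l with
  | nil => simp
  | cons p l ih =>
    rw [List.foldr_cons]
    cases hp : S p.1 p.2
    · rw [cond_false, ih]
      simp [hp]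
    · rw [cond_true]
      refine (testBit_or_shift _ _ _).trans ?_
      rw [ih, List.exists_mem_cons_iff, hp, eq_comm (a := e), or_comm]
      simp only [true_and]

theorem testBit_maskOf (S : G → G → Bool) (e : ℕ) :
    (maskOf S).testBit e = true ↔ ∃ p ∈ edgeList, S p.1 p.2 = true ∧ edgeBit p.1 p.2 = e :=
  testBit_foldr S edgeList e

theorem edgeBit_comm : ∀ g h : G, edgeBit g h = edgeBit h g := by decide

set_option synthInstance.maxSize 1000 in
theorem exists_edge : ∀ g h : G, g ≠ 0 ∧ h ≠ 0 ∧ g ≠ h →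
    (g, h) ∈ edgeList ∨ (h, g) ∈ edgeList := by
  decide +kernel

theorem edgeBit_inj : ∀ p ∈ edgeList, ∀ g h : G, g ≠ 0 ∧ h ≠ 0 ∧ g ≠ h →
    edgeBit p.1 p.2 = edgeBit g h → p = (g, h) ∨ p = (h, g) := by
  decide +kernel

theorem ne_of_mem_edgeList : ∀ p ∈ edgeList, p.1 ≠ 0 ∧ p.2 ≠ 0 ∧ p.1 ≠ p.2 := by
  decide +kernel

theorem testBit_maskOf_edgeBit {S : G → G → Bool} (hS : ∀ g h, S g h = S h g) {g h : G}
    (hg : g ≠ 0) (hh : h ≠ 0) (hgh : g ≠ h) : (maskOf S).testBit (edgeBit g h) = S g h := by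
  rw [Bool.eq_iff_iff, testBit_maskOf]
  constructor
  · rintro ⟨p, hp, h1, h2⟩
    rcases edgeBit_inj p hp g h ⟨hg, hh, hgh⟩ h2 with rfl | rfl
    · exact h1
    · rwa [hS]
  · intro h1
    rcases exists_edge g h ⟨hg, hh, hgh⟩ with h2 | h2
    · exact ⟨_, h2, h1, rfl⟩
    · exact ⟨_, h2, by rwa [hS], edgeBit_comm _ _⟩

theorem exists_of_mem_implications {c : ℕ × ℕ × ℕ × ℕ} (hc : c ∈ implications) :
    ∃ g h k, Generic g h k ∧
      c = (edgeBit g (h + k), edgeBit h k, edgeBit h (k + g), edgeBit k g) := by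
  obtain ⟨p, hp, rfl⟩ := List.mem_map.1 hc
  exact ⟨p.1, p.2.1, p.2.2, by simpa using (List.mem_filter.1 hp).2, rfl⟩

set_option synthInstance.maxSize 1000 in
theorem generic_ne : ∀ {g h k : G}, Generic g h k →
    g ≠ 0 ∧ h ≠ 0 ∧ k ≠ 0 ∧ h ≠ k ∧ k ≠ g ∧ h + k ≠ 0 ∧ k + g ≠ 0 ∧ g ≠ h + k ∧ h ≠ k + g := by
  decide

/-- The mask of a nice graph is one of the leaves of the search. -/
theorem reducible_maskOf {S : G → G → Bool} (hS : Nice S) : reducible (maskOf S) = true := by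
  have hL : ∀ l ∈ levels, ∀ c ∈ l.2, (maskOf S).testBit c.1 = true →
      (maskOf S).testBit c.2.1 = true →
        (maskOf S).testBit c.2.2.1 = true ∧ (maskOf S).testBit c.2.2.2 = true := by
    intro l hl c hc
    obtain ⟨p, hp, rfl⟩ := List.mem_map.1 hl
    obtain ⟨g, h, k, hgen, rfl⟩ := exists_of_mem_implications (List.mem_filter.1 hc).1
    obtain ⟨hg, hh, hk, hhk, hkg, hs, hs', h3, h4⟩ := generic_ne hgen
    simp only
    rw [testBit_maskOf_edgeBit hS.1 hg hs h3, testBit_maskOf_edgeBit hS.1 hh hk hhk,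
      testBit_maskOf_edgeBit hS.1 hh hs' h4, testBit_maskOf_edgeBit hS.1 hk hg hkg]
    exact hS.2 g h k hgen
  obtain ⟨m, hm, h1, -, h2⟩ := search_sound (S := fun e => (maskOf S).testBit e = true)
    levels 0 0 hL (by simp) (by simp) search_levels
  have : maskOf S = m := by
    refine Nat.eq_of_testBit_eq fun e => ?_
    rw [Bool.eq_iff_iff]
    refine ⟨fun h => ?_, h1 e⟩
    obtain ⟨p, hp, -, rfl⟩ := (testBit_maskOf S e).1 h
    exact h2 _ (List.mem_map_of_mem hp) h
  rwa [this]

/-- The transvection attached to orthogonal vectors as an automorphism of `G`. -/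
def transvectionEquiv (w v : G) (h : w.1 * v.1 + w.2.1 * v.2.1 + w.2.2 * v.2.2 = 0) : G ≃+ G where
  toFun := transvection w v
  invFun := transvection w v
  left_inv x := by revert w v x; decide
  right_inv x := by revert w v x; decide
  map_add' x y := by
    simp only [transvection, Prod.ext_iff, Prod.fst_add, Prod.snd_add]
    refine ⟨?_, ?_, ?_⟩ <;> ring

theorem exists_transvectionEquiv {p : G × G} (hp : p ∈ transvectionList) :
    ∃ σ : G ≃+ G, ∀ x, σ x = transvection p.1 p.2 x :=
  ⟨transvectionEquiv p.1 p.2 (by simpa using (List.mem_filter.1 hp).2), fun _ => rfl⟩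

theorem Nice.comp {S : G → G → Bool} (hS : Nice S) (σ : G ≃+ G) :
    Nice fun g h => S (σ g) (σ h) := by
  refine ⟨fun g h => hS.1 _ _, fun g h k hgen => ?_⟩
  have := hS.2 (σ g) (σ h) (σ k)
  simp only [← map_add] at this
  apply this
  unfold Generic at hgen ⊢
  rw [← map_add]
  simpa only [ne_eq, map_eq_zero_iff σ σ.injective, σ.injective.eq_iff] using hgen

theorem pullback_maskOf {S : G → G → Bool} (hS : Nice S) (σ : G ≃+ G) {τ : G → G}
    (hσ : ∀ x, σ x = τ x) : pullback τ (maskOf S) = maskOf fun g h => S (σ g) (σ h) := by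
  unfold pullback
  apply Nat.eq_of_testBit_eq
  intro e
  rw [Bool.eq_iff_iff, testBit_maskOf, testBit_maskOf]
  refine exists_congr fun p => and_congr_right fun hp => ?_
  obtain ⟨h1, h2, h3⟩ := ne_of_mem_edgeList p hp
  rw [hasBit_eq, ← hσ, ← hσ, testBit_maskOf_edgeBit hS.1 (by simpa using h1) (by simpa using h2)
    (σ.injective.ne h3)]

/-- Every nice graph becomes one of the sets `T_i` under a collineation. -/
theorem Nice.exists_collineation {S : G → G → Bool} (hS : Nice S) :
    ∃ σ : G ≃+ G, ∃ i ∈ Finset.Icc 1 24, ∀ g h, g ≠ 0 → h ≠ 0 → g ≠ h →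
      (S (σ g) (σ h) = true ↔ s(idx g, idx h) ∈ T i) := by
  have base : ∀ {S : G → G → Bool}, Nice S → representatives.elem (maskOf S) = true →
      ∃ σ : G ≃+ G, ∃ i ∈ Finset.Icc 1 24, ∀ g h, g ≠ 0 → h ≠ 0 → g ≠ h →
        (S (σ g) (σ h) = true ↔ s(idx g, idx h) ∈ T i) := by
    intro S hS h
    obtain ⟨i, hi, hm⟩ := List.mem_map.1 (List.elem_iff.1 h)
    refine ⟨AddEquiv.refl G, i, ?_, fun g h hg hh hgh => ?_⟩
    · rw [List.mem_range'_1] at hi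
      rw [Finset.mem_Icc]; omega
    · have h1 := testBit_maskOf_edgeBit hS.1 hg hh hgh
      rw [← hm, testBit_maskOf_edgeBit (fun g h => by rw [Sym2.eq_swap]) hg hh hgh] at h1
      rw [AddEquiv.refl_apply, AddEquiv.refl_apply, ← h1, decide_eq_true_eq]
  generalize hn : maskOf S = n
  induction n using Nat.strong_induction_on generalizing S with
  | _ n ih =>
    have step : ∀ σ : G ≃+ G, better n (maskOf fun g h => S (σ g) (σ h)) = true →
        ∃ σ : G ≃+ G, ∃ i ∈ Finset.Icc 1 24, ∀ g h, g ≠ 0 → h ≠ 0 → g ≠ h →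
          (S (σ g) (σ h) = true ↔ s(idx g, idx h) ∈ T i) := by
      intro σ hσ
      rw [better, Bool.or_eq_true] at hσ
      obtain ⟨τ, i, hi, hτ⟩ : ∃ τ : G ≃+ G, ∃ i ∈ Finset.Icc 1 24, ∀ g h, g ≠ 0 → h ≠ 0 → g ≠ h →
          (S (σ (τ g)) (σ (τ h)) = true ↔ s(idx g, idx h) ∈ T i) := by
        rcases hσ with hσ | hσ
        · exact ih _ (by simpa [Nat.blt_eq] using hσ) (hS.comp σ) rfl
        · exact base (hS.comp σ) hσ
      exact ⟨τ.trans σ, i, hi, hτ⟩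
    have h := reducible_maskOf hS
    rw [reducible, Bool.or_eq_true, Bool.or_eq_true, List.any_eq_true, List.any_eq_true] at h
    rcases h with h | ⟨p, hp, h⟩ | ⟨p, hp, h⟩
    · exact base hS h
    · obtain ⟨σ, hσ⟩ := exists_transvectionEquiv hp
      rw [pullback_maskOf hS σ hσ, hn] at h
      exact step σ h
    · obtain ⟨q, hq, h⟩ := List.any_eq_true.1 h
      obtain ⟨σ, hσ⟩ := exists_transvectionEquiv hp
      obtain ⟨τ, hτ⟩ := exists_transvectionEquiv hq
      rw [pullback_maskOf hS τ hτ, pullback_maskOf (hS.comp τ) σ hσ, hn] at h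
      exact step (σ.trans τ) h

/-! ### Normalization of the values -/

theorem exists_sq_eq {z : ℂ} (hz : z ≠ 0) : ∃ r : ℂ, r ≠ 0 ∧ r ^ 2 = z := by
  obtain ⟨r, hr⟩ := IsAlgClosed.exists_pow_nat_eq z two_pos
  exact ⟨r, by rintro rfl; exact hz (by simpa using hr.symm), hr⟩

theorem exists_sq_mul_eq {z w : ℂ} (hz : z ≠ 0) (hw : w ≠ 0) : ∃ r : ℂ, r ≠ 0 ∧ r ^ 2 * w = z := by
  obtain ⟨r, hr, hr'⟩ := exists_sq_eq (div_ne_zero hz hw)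
  exact ⟨r, hr, by rw [hr', div_mul_cancel₀ _ hw]⟩

/-- The value `ε_ij = ε(g_i, g_j)`. -/
def val (ε : G → G → ℂ) (i j : Fin 8) : ℂ := ε (deg i) (deg j)

/-- The support of `ε` is the set `T k`. -/
def HasSupport (ε : G → G → ℂ) (k : ℕ) : Prop :=
  ∀ g h, g ≠ 0 → h ≠ 0 → g ≠ h → (ε g h ≠ 0 ↔ s(idx g, idx h) ∈ T k)

theorem deg_ne_zero : ∀ {i : Fin 8}, 0 < i → deg i ≠ 0 := by decide

theorem deg_ne : ∀ {i j : Fin 8}, i < j → deg i ≠ deg j := by decide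

theorem HasSupport.ne_zero {ε : G → G → ℂ} {k : ℕ} (h : HasSupport ε k) (i j : Fin 8)
    (hij : (0 < i ∧ i < j) ∧ s(i, j) ∈ T k) : val ε i j ≠ 0 := by
  rw [val, h _ _ (deg_ne_zero hij.1.1) (deg_ne_zero (hij.1.1.trans hij.1.2)) (deg_ne hij.1.2),
    idx_deg, idx_deg]
  exact hij.2

/-- A scaling takes an admissible map with support `T k` to the map with values `c` on `T k` as
soon as it does so on the edges `{i, j}` of `T k`, listed with their product. -/
theorem equivalent_ofEdges {ε : G → G → ℂ} (hε : Admissible ε) {k : ℕ} (hT : HasSupport ε k)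
    (l : List (Fin 8 × Fin 8 × Fin 8))
    (hl : ∀ i j : Fin 8, 0 < i → i < j → s(i, j) ∈ T k → (i, j, idx (deg i + deg j)) ∈ l)
    (c : Sym2 (Fin 8) → ℂ) (hc : ∀ e, e ∉ T k → c e = 0) (a : Fin 8 → ℂ) (ha : ∀ i, a i ≠ 0)
    (h : ∀ p ∈ l, c s(p.1, p.2.1) * (a p.1 * a p.2.1) = a p.2.2 * val ε p.1 p.2.1) :
    (Γ t).Equivalent ε (ofEdges c) := by
  refine equivalent_of_scale (fun g => a (idx g)) (fun g => ha _) fun g g' hg hg' hgg => ?_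
  rw [ofEdges, if_neg (by tauto)]
  by_cases hm : s(idx g, idx g') ∈ T k
  · have key : ∀ i j : Fin 8, 0 < i → i < j → s(i, j) ∈ T k →
        c s(i, j) * (a i * a j) = a (idx (deg i + deg j)) * val ε i j :=
      fun i j hi hij hm => h _ (hl i j hi hij hm)
    have pos : ∀ g : G, g ≠ 0 → 0 < idx g := by decide
    rcases lt_trichotomy (idx g) (idx g') with hlt | heq | hlt
    · have := key _ _ (pos g hg) hlt hm
      rwa [val, deg_idx, deg_idx] at this
    · exact absurd (idxEquiv.injective heq) hgg
    · have := key _ _ (pos g' hg') hlt (by rwa [Sym2.eq_swap])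
      rwa [val, deg_idx, deg_idx, Sym2.eq_swap, mul_comm (a _), add_comm g',
        ← hε.symm g g' hg hg' hgg]
        at this
  · rw [hc _ hm, not_not.1 (mt (hT g g' hg hg' hgg).1 hm), zero_mul, mul_zero]

/-- A solution `a` of the equations `a_i a_j = a_k ε_ij`, for the edges `{i, j}` of the support with
product `k`, gives an equivalence with `ε^T`. -/
theorem equivalent_epsT {ε : G → G → ℂ} (hε : Admissible ε) {k : ℕ} (hT : HasSupport ε k)
    (l : List (Fin 8 × Fin 8 × Fin 8))
    (hl : ∀ i j : Fin 8, 0 < i → i < j → s(i, j) ∈ T k → (i, j, idx (deg i + deg j)) ∈ l)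
    (hl' : ∀ p ∈ l, s(p.1, p.2.1) ∈ T k)
    (a : Fin 8 → ℂ) (ha : ∀ i, a i ≠ 0)
    (h : ∀ p ∈ l, a p.1 * a p.2.1 = a p.2.2 * val ε p.1 p.2.1) :
    (Γ t).Equivalent ε (epsT k) := by
  refine equivalent_ofEdges hε hT l hl _ (fun e he => if_neg he) a ha fun p hp => ?_
  rw [if_pos (hl' p hp), one_mul, h p hp]

section

variable {ε : G → G → ℂ}

theorem equivalent_epsT_1 (hε : Admissible ε) (hT : HasSupport ε 1) :
    (Γ t).Equivalent ε (epsT 1) := by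
  refine equivalent_epsT hε hT []
    (by decide +kernel) (by decide +kernel)
    ![1, 1, 1, 1, 1, 1, 1, 1] ?_ ?_
  · intro i; fin_cases i <;> simp [*]
  · simp

theorem equivalent_epsT_2 (hε : Admissible ε) (hT : HasSupport ε 2) :
    (Γ t).Equivalent ε (epsT 2) := by
  have h12 := hT.ne_zero 1 2 (by decide)
  refine equivalent_epsT hε hT [(1, 2, 5)]
    (by decide +kernel) (by decide +kernel)
    ![1, 1, 1, 1, 1, 1 / val ε 1 2, 1, 1] ?_ ?_
  · intro i; fin_cases i <;> simp [*]
  · simp [*]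

theorem equivalent_epsT_3 (hε : Admissible ε) (hT : HasSupport ε 3) :
    (Γ t).Equivalent ε (epsT 3) := by
  have h12 := hT.ne_zero 1 2 (by decide)
  have h13 := hT.ne_zero 1 3 (by decide)
  refine equivalent_epsT hε hT [(1, 2, 5), (1, 3, 6)]
    (by decide +kernel) (by decide +kernel)
    ![1, 1, 1, 1, 1, 1 / val ε 1 2, 1 / val ε 1 3, 1] ?_ ?_
  · intro i; fin_cases i <;> simp [*]
  · simp only [List.forall_mem_cons]
    simp
    and_intros <;> field_simp

theorem equivalent_epsT_4 (hε : Admissible ε) (hT : HasSupport ε 4) :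
    (Γ t).Equivalent ε (epsT 4) := by
  have h12 := hT.ne_zero 1 2 (by decide)
  have h15 := hT.ne_zero 1 5 (by decide)
  obtain ⟨r, hr, hr'⟩ := exists_sq_eq (mul_ne_zero h12 h15)
  refine equivalent_epsT hε hT [(1, 2, 5), (1, 5, 2)]
    (by decide +kernel) (by decide +kernel)
    ![1, r, 1, 1, 1, r / val ε 1 2, 1, 1] ?_ ?_
  · intro i; fin_cases i <;> simp [*]
  · simp only [List.forall_mem_cons]
    simp
    and_intros <;> field_simp
    grind

theorem equivalent_epsT_5 (hε : Admissible ε) (hT : HasSupport ε 5) :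
    (Γ t).Equivalent ε (epsT 5) := by
  have h12 := hT.ne_zero 1 2 (by decide)
  have h67 := hT.ne_zero 6 7 (by decide)
  refine equivalent_epsT hε hT [(1, 2, 5), (6, 7, 5)]
    (by decide +kernel) (by decide +kernel)
    ![1, val ε 1 2, 1, 1, 1, 1, val ε 6 7, 1] ?_ ?_
  · intro i; fin_cases i <;> simp [*]
  · simp

theorem equivalent_epsT_6 (hε : Admissible ε) (hT : HasSupport ε 6) :
    (Γ t).Equivalent ε (epsT 6) := by
  have h12 := hT.ne_zero 1 2 (by decide)
  have h15 := hT.ne_zero 1 5 (by decide)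
  have h25 := hT.ne_zero 2 5 (by decide)
  obtain ⟨r, hr, hr'⟩ := exists_sq_eq (mul_ne_zero h12 h15)
  obtain ⟨s, hs, hs'⟩ := exists_sq_eq (mul_ne_zero h12 h25)
  refine equivalent_epsT hε hT [(1, 2, 5), (1, 5, 2), (2, 5, 1)]
    (by decide +kernel) (by decide +kernel)
    ![1, r, s, 1, 1, r * s / val ε 1 2, 1, 1] ?_ ?_
  · intro i; fin_cases i <;> simp [*]
  · simp only [List.forall_mem_cons]
    simp
    and_intros <;> field_simp <;> grind

theorem equivalent_epsT_7 (hε : Admissible ε) (hT : HasSupport ε 7) :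
    (Γ t).Equivalent ε (epsT 7) := by
  have h25 := hT.ne_zero 2 5 (by decide)
  have h36 := hT.ne_zero 3 6 (by decide)
  have h47 := hT.ne_zero 4 7 (by decide)
  refine equivalent_epsT hε hT [(2, 5, 1), (3, 6, 1), (4, 7, 1)]
    (by decide +kernel) (by decide +kernel)
    ![1, 1, val ε 2 5, val ε 3 6, val ε 4 7, 1, 1, 1] ?_ ?_
  · intro i; fin_cases i <;> simp [*]
  · simp

theorem equivalent_epsT_8 (hε : Admissible ε) (hT : HasSupport ε 8) :
    (Γ t).Equivalent ε (epsT 8) := by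
  have h12 := hT.ne_zero 1 2 (by decide)
  have h13 := hT.ne_zero 1 3 (by decide)
  have h14 := hT.ne_zero 1 4 (by decide)
  refine equivalent_epsT hε hT [(1, 2, 5), (1, 3, 6), (1, 4, 7)]
    (by decide +kernel) (by decide +kernel)
    ![1, 1, 1, 1, 1, 1 / val ε 1 2, 1 / val ε 1 3, 1 / val ε 1 4] ?_ ?_
  · intro i; fin_cases i <;> simp [*]
  · simp only [List.forall_mem_cons]
    simp
    and_intros <;> field_simp

theorem equivalent_epsT_9 (hε : Admissible ε) (hT : HasSupport ε 9) :
    (Γ t).Equivalent ε (epsT 9) := by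
  have h12 := hT.ne_zero 1 2 (by decide)
  have h13 := hT.ne_zero 1 3 (by decide)
  have h15 := hT.ne_zero 1 5 (by decide)
  obtain ⟨r, hr, hr'⟩ := exists_sq_eq (mul_ne_zero h12 h15)
  refine equivalent_epsT hε hT [(1, 2, 5), (1, 3, 6), (1, 5, 2)]
    (by decide +kernel) (by decide +kernel)
    ![1, r, 1, 1, 1, r / val ε 1 2, r / val ε 1 3, 1] ?_ ?_
  · intro i; fin_cases i <;> simp [*]
  · simp only [List.forall_mem_cons]
    simp
    and_intros <;> field_simp
    grind

theorem equivalent_epsT_10 (hε : Admissible ε) (hT : HasSupport ε 10) :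
    (Γ t).Equivalent ε (epsT 10) := by
  have h12 := hT.ne_zero 1 2 (by decide)
  have h13 := hT.ne_zero 1 3 (by decide)
  have h17 := hT.ne_zero 1 7 (by decide)
  refine equivalent_epsT hε hT [(1, 2, 5), (1, 3, 6), (1, 7, 4)]
    (by decide +kernel) (by decide +kernel)
    ![1, 1, 1, 1, 1 / val ε 1 7, 1 / val ε 1 2, 1 / val ε 1 3, 1] ?_ ?_
  · intro i; fin_cases i <;> simp [*]
  · simp only [List.forall_mem_cons]
    simp
    and_intros <;> field_simp

theorem equivalent_epsT_11 (hε : Admissible ε) (hT : HasSupport ε 11) :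
    (Γ t).Equivalent ε (epsT 11) := by
  have h12 := hT.ne_zero 1 2 (by decide)
  have h16 := hT.ne_zero 1 6 (by decide)
  have h26 := hT.ne_zero 2 6 (by decide)
  refine equivalent_epsT hε hT [(1, 2, 5), (1, 6, 3), (2, 6, 4)]
    (by decide +kernel) (by decide +kernel)
    ![1, 1, 1, 1 / val ε 1 6, 1 / val ε 2 6, 1 / val ε 1 2, 1, 1] ?_ ?_
  · intro i; fin_cases i <;> simp [*]
  · simp only [List.forall_mem_cons]
    simp
    and_intros <;> field_simp

theorem equivalent_epsT_12 (hε : Admissible ε) (hT : HasSupport ε 12) :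
    (Γ t).Equivalent ε (epsT 12) := by
  have h12 := hT.ne_zero 1 2 (by decide)
  have h16 := hT.ne_zero 1 6 (by decide)
  have h67 := hT.ne_zero 6 7 (by decide)
  refine equivalent_epsT hε hT [(1, 2, 5), (1, 6, 3), (6, 7, 5)]
    (by decide +kernel) (by decide +kernel)
    ![1, 1, val ε 1 2, 1 / val ε 1 6, 1, 1, 1, val ε 6 7] ?_ ?_
  · intro i; fin_cases i <;> simp [*]
  · simp only [List.forall_mem_cons]
    simp
    field_simp

theorem equivalent_epsT_13 (hε : Admissible ε) (hT : HasSupport ε 13) :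
    (Γ t).Equivalent ε (epsT 13) := by
  have h12 := hT.ne_zero 1 2 (by decide)
  have h13 := hT.ne_zero 1 3 (by decide)
  have h14 := hT.ne_zero 1 4 (by decide)
  have h15 := hT.ne_zero 1 5 (by decide)
  obtain ⟨r, hr, hr'⟩ := exists_sq_eq (mul_ne_zero h12 h15)
  refine equivalent_epsT hε hT [(1, 2, 5), (1, 3, 6), (1, 4, 7), (1, 5, 2)]
    (by decide +kernel) (by decide +kernel)
    ![1, r, 1, 1, 1, r / val ε 1 2, r / val ε 1 3, r / val ε 1 4] ?_ ?_
  · intro i; fin_cases i <;> simp [*]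
  · simp only [List.forall_mem_cons]
    simp
    and_intros <;> field_simp
    grind

theorem equivalent_epsT_15 (hε : Admissible ε) (hT : HasSupport ε 15) :
    (Γ t).Equivalent ε (epsT 15) := by
  have h12 := hT.ne_zero 1 2 (by decide)
  have h16 := hT.ne_zero 1 6 (by decide)
  have h17 := hT.ne_zero 1 7 (by decide)
  have h26 := hT.ne_zero 2 6 (by decide)
  refine equivalent_epsT hε hT [(1, 2, 5), (1, 6, 3), (1, 7, 4), (2, 6, 4)]
    (by decide +kernel) (by decide +kernel)
    ![1, 1, val ε 2 6, 1 / val ε 1 6, 1, val ε 2 6 / val ε 1 2, 1, val ε 1 7] ?_ ?_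
  · intro i; fin_cases i <;> simp [*]
  · simp only [List.forall_mem_cons]
    simp
    and_intros <;> field_simp

theorem equivalent_epsT_16 (hε : Admissible ε) (hT : HasSupport ε 16) :
    (Γ t).Equivalent ε (epsT 16) := by
  have h12 := hT.ne_zero 1 2 (by decide)
  have h16 := hT.ne_zero 1 6 (by decide)
  have h27 := hT.ne_zero 2 7 (by decide)
  have h67 := hT.ne_zero 6 7 (by decide)
  obtain ⟨q, hq, hq'⟩ := exists_sq_mul_eq (mul_ne_zero h12 h67)
    (mul_ne_zero h16 h27)
  refine equivalent_epsT hε hT [(1, 2, 5), (1, 6, 3), (2, 7, 3), (6, 7, 5)]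
    (by decide +kernel) (by decide +kernel)
    ![1, 1, val ε 1 2, q, 1, 1, q * val ε 1 6, q * val ε 2 7 / val ε 1 2] ?_ ?_
  · intro i; fin_cases i <;> simp [*]
  · simp only [List.forall_mem_cons]
    simp
    and_intros <;> field_simp
    grind

theorem equivalent_epsT_18 (hε : Admissible ε) (hT : HasSupport ε 18) :
    (Γ t).Equivalent ε (epsT 18) := by
  have h12 := hT.ne_zero 1 2 (by decide)
  have h16 := hT.ne_zero 1 6 (by decide)
  have h17 := hT.ne_zero 1 7 (by decide)
  have h26 := hT.ne_zero 2 6 (by decide)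
  have h27 := hT.ne_zero 2 7 (by decide)
  obtain ⟨q, hq, hq'⟩ := exists_sq_mul_eq (mul_ne_zero h17 h27)
    (mul_ne_zero h26 h16)
  refine equivalent_epsT hε hT [(1, 2, 5), (1, 6, 3), (1, 7, 4), (2, 6, 4), (2, 7, 3)]
    (by decide +kernel) (by decide +kernel)
    ![1, q * val ε 1 6 / val ε 2 7, 1, q / val ε 2 7, 1 / val ε 2 6,
      q * val ε 1 6 / (val ε 2 7 * val ε 1 2), 1, q] ?_ ?_
  · intro i; fin_cases i <;> simp [*]
  · simp only [List.forall_mem_cons]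
    simp
    and_intros <;> field_simp
    grind

theorem equivalent_epsT_19 (hε : Admissible ε) (hT : HasSupport ε 19) :
    (Γ t).Equivalent ε (epsT 19) := by
  have h34 := hT.ne_zero 3 4 (by decide)
  have h36 := hT.ne_zero 3 6 (by decide)
  have h37 := hT.ne_zero 3 7 (by decide)
  have h46 := hT.ne_zero 4 6 (by decide)
  have h47 := hT.ne_zero 4 7 (by decide)
  have h67 := hT.ne_zero 6 7 (by decide)
  obtain ⟨p, hp, hp'⟩ := exists_sq_mul_eq (mul_ne_zero h67 h47)
    (mul_ne_zero h34 h36)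
  obtain ⟨q, hq, hq'⟩ := exists_sq_mul_eq (mul_ne_zero h67 h46)
    (mul_ne_zero h34 h37)
  refine equivalent_epsT hε hT [(3, 4, 5), (3, 6, 1), (3, 7, 2), (4, 6, 2), (4, 7, 1), (6, 7, 5)]
    (by decide +kernel) (by decide +kernel)
    ![1, q / val ε 3 6, p / val ε 3 7, 1, val ε 3 4 / val ε 6 7 * p * q,
      val ε 3 4 / val ε 6 7 * p * q / val ε 3 4, q, p] ?_ ?_
  · intro i; fin_cases i <;> simp [*]
  · simp only [List.forall_mem_cons]
    simp
    and_intros <;> field_simp <;> grind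

/-- The parameter is the quotient of the products of the values on the two edges of the lines
`{1, 3, 6}` and `{1, 2, 5}`, which is not changed by scalings; for `eps17` and `eps20` the
parameters are square roots of such quotients. -/
theorem equivalent_eps14 (hε : Admissible ε) (hT : HasSupport ε 14) {l : ℂ}
    (hl : l * (val ε 1 2 * val ε 1 5) = val ε 1 3 * val ε 1 6) :
    (Γ t).Equivalent ε (eps14 l) := by
  have h12 := hT.ne_zero 1 2 (by decide)
  have h13 := hT.ne_zero 1 3 (by decide)
  have h15 := hT.ne_zero 1 5 (by decide)
  have h16 := hT.ne_zero 1 6 (by decide)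
  obtain ⟨r, hr, hr'⟩ := exists_sq_eq (mul_ne_zero h12 h15)
  refine equivalent_ofEdges hε hT [(1, 2, 5), (1, 3, 6), (1, 5, 2), (1, 6, 3)]
    (by decide +kernel) _ (fun e he => ?_)
    ![1, r, 1, 1, 1, r / val ε 1 2, r / val ε 1 3, 1] ?_ ?_
  · rw [if_neg (by rintro rfl; exact he (by decide)), if_neg he]
  · intro i; fin_cases i <;> simp [*]
  · simp only [List.forall_mem_cons]
    simp [T]
    and_intros <;> field_simp <;> grind

theorem equivalent_eps17 (hε : Admissible ε) (hT : HasSupport ε 17) {l : ℂ} (h0 : l ≠ 0)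
    (hl : l ^ 2 * (val ε 1 2 * val ε 1 5) = val ε 1 3 * val ε 1 6) :
    (Γ t).Equivalent ε (eps17 l) := by
  have h12 := hT.ne_zero 1 2 (by decide)
  have h13 := hT.ne_zero 1 3 (by decide)
  have h14 := hT.ne_zero 1 4 (by decide)
  have h15 := hT.ne_zero 1 5 (by decide)
  have h16 := hT.ne_zero 1 6 (by decide)
  obtain ⟨r, hr, hr'⟩ := exists_sq_eq (mul_ne_zero h12 h15)
  refine equivalent_ofEdges hε hT [(1, 2, 5), (1, 3, 6), (1, 4, 7), (1, 5, 2), (1, 6, 3)]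
    (by decide +kernel) _ (fun e he => ?_)
    ![1, r, 1, 1, 1, r / val ε 1 2, l * r / val ε 1 3, r / val ε 1 4] ?_ ?_
  · rw [if_neg (by rintro (rfl | rfl) <;> exact he (by decide)), if_neg he]
  · intro i; fin_cases i <;> simp [*]
  · simp only [List.forall_mem_cons]
    simp [T]
    and_intros <;> field_simp <;> grind

theorem equivalent_eps20 (hε : Admissible ε) (hT : HasSupport ε 20) {l m : ℂ} (h0 : l ≠ 0)
    (h0' : m ≠ 0) (hl : l ^ 2 * (val ε 1 2 * val ε 1 5) = val ε 1 3 * val ε 1 6)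
    (hm : m ^ 2 * (val ε 1 2 * val ε 1 5) = val ε 1 4 * val ε 1 7) :
    (Γ t).Equivalent ε (eps20 l m) := by
  have h12 := hT.ne_zero 1 2 (by decide)
  have h13 := hT.ne_zero 1 3 (by decide)
  have h14 := hT.ne_zero 1 4 (by decide)
  have h15 := hT.ne_zero 1 5 (by decide)
  have h16 := hT.ne_zero 1 6 (by decide)
  have h17 := hT.ne_zero 1 7 (by decide)
  obtain ⟨r, hr, hr'⟩ := exists_sq_eq (mul_ne_zero h12 h15)
  refine equivalent_ofEdges hε hT [(1, 2, 5), (1, 3, 6), (1, 4, 7), (1, 5, 2), (1, 6, 3), (1, 7, 4)]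
    (by decide +kernel) _ (fun e he => ?_)
    ![1, r, 1, 1, 1, r / val ε 1 2, l * r / val ε 1 3, m * r / val ε 1 4] ?_ ?_
  · rw [if_neg (by rintro (rfl | rfl) <;> exact he (by decide)),
      if_neg (by rintro (rfl | rfl) <;> exact he (by decide)), if_neg he]
  · intro i; fin_cases i <;> simp [*]
  · simp only [List.forall_mem_cons]
    simp [T]
    and_intros <;> field_simp <;> grind

theorem Admissible.val_comm (hε : Admissible ε) (i j : Fin 8)
    (h : deg i ≠ 0 ∧ deg j ≠ 0 ∧ deg i ≠ deg j := by decide) : val ε i j = val ε j i :=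
  hε.symm _ _ h.1 h.2.1 h.2.2

theorem Admissible.val_jacobi (hε : Admissible ε) (i j k p q : Fin 8)
    (h : Generic (deg i) (deg j) (deg k) ∧ deg j + deg k = deg p ∧ deg k + deg i = deg q :=
      by decide) :
    val ε i p * val ε j k = val ε j q * val ε k i := by
  have := hε.jacobi _ _ _ h.1
  rwa [h.2.1, h.2.2] at this

theorem equivalent_epsT_of_val_eq_one (hε : Admissible ε) {k : ℕ} (hT : HasSupport ε k)
    (h : ∀ i j : Fin 8, 0 < i → i < j → s(i, j) ∈ T k → val ε i j = 1) :
    (Γ t).Equivalent ε (epsT k) := by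
  refine equivalent_of_scale (fun _ => 1) (fun _ => one_ne_zero) fun g k hg hk hgk => ?_
  rw [epsT, ofEdges, if_neg (by tauto), one_mul, mul_one, one_mul]
  have pos : ∀ g : G, g ≠ 0 → 0 < idx g := by decide
  split_ifs with hm
  · rcases lt_trichotomy (idx g) (idx k) with hlt | heq | hlt
    · rw [← h _ _ (pos g hg) hlt hm, val, deg_idx, deg_idx]
    · exact absurd (idxEquiv.injective heq) hgk
    · rw [hε.symm g k hg hk hgk, ← h _ _ (pos k hk) hlt (by rwa [Sym2.eq_swap]), val, deg_idx,
        deg_idx]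
  · exact (not_not.1 (mt (hT g k hg hk hgk).1 hm)).symm

/-- The scaling of `ε` by `a`. -/
noncomputable def rescale (a : Fin 8 → ℂ) (ε : G → G → ℂ) (g h : G) : ℂ :=
  a (idx (g + h)) * ε g h / (a (idx g) * a (idx h))

theorem Admissible.rescale (hε : Admissible ε) {a : Fin 8 → ℂ} (ha : ∀ i, a i ≠ 0) :
    Admissible (rescale a ε) where
  symm g h hg hh hgh := by
    rw [Octonion.rescale, Octonion.rescale, hε.symm g h hg hh hgh, add_comm h, mul_comm (a (idx h))]
  jacobi g h k hgen := by
    have := hε.jacobi g h k hgen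
    simp only [Octonion.rescale]
    rw [add_comm k g, ← add_assoc, add_left_comm h, ← add_assoc]
    rw [add_comm k g] at this
    have e1 := ha (idx (h + k))
    have e2 := ha (idx (g + k))
    have e3 := ha (idx g)
    have e4 := ha (idx h)
    have e5 := ha (idx k)
    field_simp
    linear_combination a (idx (g + h + k)) * this

theorem HasSupport.rescale {k : ℕ} (hT : HasSupport ε k) {a : Fin 8 → ℂ} (ha : ∀ i, a i ≠ 0) :
    HasSupport (rescale a ε) k := by
  intro g h hg hh hgh
  rw [← hT g h hg hh hgh, Octonion.rescale]
  simp [ha]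

theorem equivalent_rescale {a : Fin 8 → ℂ} (ha : ∀ i, a i ≠ 0) :
    (Γ t).Equivalent ε (rescale a ε) :=
  equivalent_of_scale (fun g => a (idx g)) (fun _ => ha _) fun g h _ _ _ => by
    rw [rescale, div_mul_cancel₀ _ (mul_ne_zero (ha _) (ha _))]

theorem val_rescale (a : Fin 8 → ℂ) (ε : G → G → ℂ) (i j k : Fin 8)
    (h : deg i + deg j = deg k := by decide) :
    val (rescale a ε) i j = a k * val ε i j / (a i * a j) := by
  rw [val, rescale, h, idx_deg, idx_deg, idx_deg, val]

/-- If the values on `12`, `13`, `17` and `23` are nonzero, then they can be scaled to `1`, with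
three parameters `a`, `b`, `c` left for scaling the values on `15`, `25` and `36`. -/
theorem exists_normalized (hε : Admissible ε) {k : ℕ} (hT : HasSupport ε k)
    (h12 : val ε 1 2 ≠ 0) (h13 : val ε 1 3 ≠ 0) (h17 : val ε 1 7 ≠ 0) (h23 : val ε 2 3 ≠ 0)
    {a b c : ℂ} (ha : a ≠ 0) (hb : b ≠ 0) (hc : c ≠ 0) :
    ∃ ε', Admissible ε' ∧ HasSupport ε' k ∧ (Γ t).Equivalent ε ε' ∧
      (val ε' 1 2 = 1 ∧ val ε' 1 3 = 1 ∧ val ε' 1 7 = 1 ∧ val ε' 2 3 = 1) ∧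
      (a ^ 2 = val ε 1 2 * val ε 1 5 → val ε' 1 5 = 1) ∧
      (b ^ 2 = val ε 1 2 * val ε 2 5 → val ε' 2 5 = 1) ∧
      (c ^ 2 = val ε 1 3 * val ε 3 6 → val ε' 3 6 = 1) := by
  let s : Fin 8 → ℂ := ![1, a, b, c, a * (b * c / val ε 2 3) / val ε 1 7, a * b / val ε 1 2,
    a * c / val ε 1 3, b * c / val ε 2 3]
  have hs : ∀ i, s i ≠ 0 := by intro i; fin_cases i <;> simp [s, *]
  refine ⟨rescale s ε, hε.rescale hs, hT.rescale hs, equivalent_rescale hs, ⟨?_, ?_, ?_, ?_⟩,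
    fun h => ?_, fun h => ?_, fun h => ?_⟩
  · rw [val_rescale s ε 1 2 5]
    simp only [s, Matrix.cons_val]
    field_simp
  · rw [val_rescale s ε 1 3 6]
    simp only [s, Matrix.cons_val]
    field_simp
  · rw [val_rescale s ε 1 7 4]
    simp only [s, Matrix.cons_val]
    field_simp
  · rw [val_rescale s ε 2 3 7]
    simp only [s, Matrix.cons_val]
    field_simp
  · rw [val_rescale s ε 1 5 2]
    simp only [s, Matrix.cons_val]
    field_simp
    rw [h]
    ring
  · rw [val_rescale s ε 2 5 1]
    simp only [s, Matrix.cons_val]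
    field_simp
    rw [h]
    ring
  · rw [val_rescale s ε 3 6 1]
    simp only [s, Matrix.cons_val]
    field_simp
    rw [h]
    ring

/-- The value `1` propagates from four edges to all of `T 21`, by two Jacobi identities. In the same
way it propagates to `T 22`, `T 23` and `T 24` if in each step one more value is `1`. -/
theorem Admissible.val_eq_one_21 (hε : Admissible ε)
    (h : val ε 1 2 = 1 ∧ val ε 1 3 = 1 ∧ val ε 1 7 = 1 ∧ val ε 2 3 = 1) :
    val ε 2 6 = 1 ∧ val ε 3 5 = 1 := by
  obtain ⟨h12, h13, h17, h23⟩ := h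
  have e1 := hε.val_jacobi 1 2 3 7 6
  have e2 := hε.val_jacobi 2 3 1 6 5
  have c1 := hε.val_comm 3 1
  grind

theorem Admissible.val_eq_one_22 (hε : Admissible ε)
    (h : val ε 1 2 = 1 ∧ val ε 1 3 = 1 ∧ val ε 1 7 = 1 ∧ val ε 2 3 = 1) (h15 : val ε 1 5 = 1) :
    val ε 1 4 = 1 ∧ val ε 5 6 = 1 ∧ val ε 1 6 = 1 := by
  obtain ⟨h26, h35⟩ := hε.val_eq_one_21 h
  obtain ⟨h12, h13, h17, h23⟩ := h
  have e1 := hε.val_jacobi 1 3 5 4 2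
  have e2 := hε.val_jacobi 3 5 1 2 6
  have e3 := hε.val_jacobi 1 5 6 7 3
  have c1 := hε.val_comm 3 2
  have c2 := hε.val_comm 5 1
  have c3 := hε.val_comm 5 3
  have c4 := hε.val_comm 6 1
  grind

theorem Admissible.val_eq_one_23 (hε : Admissible ε)
    (h : val ε 1 2 = 1 ∧ val ε 1 3 = 1 ∧ val ε 1 7 = 1 ∧ val ε 2 3 = 1) (h15 : val ε 1 5 = 1)
    (h25 : val ε 2 5 = 1) :
    val ε 2 4 = 1 ∧ val ε 5 7 = 1 ∧ val ε 4 5 = 1 ∧ val ε 2 7 = 1 := by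
  obtain ⟨h26, h35⟩ := hε.val_eq_one_21 h
  obtain ⟨h14, h56, h16⟩ := hε.val_eq_one_22 h h15
  obtain ⟨h12, h13, h17, h23⟩ := h
  have e1 := hε.val_jacobi 2 3 5 4 1
  have e2 := hε.val_jacobi 3 5 2 1 7
  have e3 := hε.val_jacobi 2 4 5 3 1
  have e4 := hε.val_jacobi 2 5 6 7 4
  have c1 := hε.val_comm 3 1
  have c2 := hε.val_comm 5 2
  have c3 := hε.val_comm 4 1
  have c4 := hε.val_comm 5 4
  have c5 := hε.val_comm 6 2
  grind

theorem Admissible.val_eq_one_24 (hε : Admissible ε)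
    (h : val ε 1 2 = 1 ∧ val ε 1 3 = 1 ∧ val ε 1 7 = 1 ∧ val ε 2 3 = 1) (h15 : val ε 1 5 = 1)
    (h25 : val ε 2 5 = 1) (h36 : val ε 3 6 = 1) :
    val ε 3 4 = 1 ∧ val ε 6 7 = 1 ∧ val ε 4 7 = 1 ∧ val ε 4 6 = 1 ∧ val ε 3 7 = 1 := by
  obtain ⟨h26, h35⟩ := hε.val_eq_one_21 h
  obtain ⟨h14, h56, h16⟩ := hε.val_eq_one_22 h h15
  obtain ⟨h24, h57, h45, h27⟩ := hε.val_eq_one_23 h h15 h25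
  obtain ⟨h12, h13, h17, h23⟩ := h
  have e1 := hε.val_jacobi 2 3 6 1 4
  have e2 := hε.val_jacobi 3 6 2 4 7
  have e3 := hε.val_jacobi 7 2 4 6 1
  have e4 := hε.val_jacobi 3 4 6 2 1
  have e5 := hε.val_jacobi 3 4 7 1 2
  have c1 := hε.val_comm 2 1
  have c2 := hε.val_comm 6 2
  have c3 := hε.val_comm 7 6
  have c4 := hε.val_comm 4 1
  have c5 := hε.val_comm 4 2
  have c6 := hε.val_comm 6 3
  have c7 := hε.val_comm 3 1
  have c8 := hε.val_comm 3 2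
  have c9 := hε.val_comm 7 3
  have c10 := hε.val_comm 4 3
  have c11 := hε.val_comm 7 4
  grind

theorem forall_edge_21 (P : Fin 8 → Fin 8 → Prop) (h : P 1 2 ∧ P 1 3 ∧ P 1 7 ∧ P 2 3)
    (h' : P 2 6 ∧ P 3 5) : ∀ i j : Fin 8, 0 < i → i < j → s(i, j) ∈ T 21 → P i j := by
  have key : ∀ i j : Fin 8, 0 < i → i < j → s(i, j) ∈ T 21 →
      (i, j) ∈ [((1 : Fin 8), (2 : Fin 8)), (1, 3), (1, 7), (2, 3), (2, 6), (3, 5)] := by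
    decide +kernel
  intro i j hi hij hm
  have := key i j hi hij hm
  simp only [List.mem_cons, Prod.mk.injEq, List.not_mem_nil, or_false] at this
  rcases this with ⟨rfl, rfl⟩ | ⟨rfl, rfl⟩ | ⟨rfl, rfl⟩ | ⟨rfl, rfl⟩ | ⟨rfl, rfl⟩ | ⟨rfl, rfl⟩ <;>
    tauto

theorem forall_edge_22 (P : Fin 8 → Fin 8 → Prop)
    (h : ∀ i j : Fin 8, 0 < i → i < j → s(i, j) ∈ T 21 → P i j)
    (h' : P 1 5 ∧ P 1 4 ∧ P 5 6 ∧ P 1 6) :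
    ∀ i j : Fin 8, 0 < i → i < j → s(i, j) ∈ T 22 → P i j := by
  have key : ∀ i j : Fin 8, 0 < i → i < j → s(i, j) ∈ T 22 → s(i, j) ∈ T 21 ∨
      (i, j) ∈ [((1 : Fin 8), (5 : Fin 8)), (1, 4), (5, 6), (1, 6)] := by
    decide +kernel
  intro i j hi hij hm
  rcases key i j hi hij hm with hm | this
  · exact h i j hi hij hm
  simp only [List.mem_cons, Prod.mk.injEq, List.not_mem_nil, or_false] at this
  rcases this with ⟨rfl, rfl⟩ | ⟨rfl, rfl⟩ | ⟨rfl, rfl⟩ | ⟨rfl, rfl⟩ <;> tauto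

theorem forall_edge_23 (P : Fin 8 → Fin 8 → Prop)
    (h : ∀ i j : Fin 8, 0 < i → i < j → s(i, j) ∈ T 22 → P i j)
    (h' : P 2 5 ∧ P 2 4 ∧ P 5 7 ∧ P 4 5 ∧ P 2 7) :
    ∀ i j : Fin 8, 0 < i → i < j → s(i, j) ∈ T 23 → P i j := by
  have key : ∀ i j : Fin 8, 0 < i → i < j → s(i, j) ∈ T 23 → s(i, j) ∈ T 22 ∨
      (i, j) ∈ [((2 : Fin 8), (5 : Fin 8)), (2, 4), (5, 7), (4, 5), (2, 7)] := by
    decide +kernel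
  intro i j hi hij hm
  rcases key i j hi hij hm with hm | this
  · exact h i j hi hij hm
  simp only [List.mem_cons, Prod.mk.injEq, List.not_mem_nil, or_false] at this
  rcases this with ⟨rfl, rfl⟩ | ⟨rfl, rfl⟩ | ⟨rfl, rfl⟩ | ⟨rfl, rfl⟩ | ⟨rfl, rfl⟩ <;> tauto

theorem forall_edge_24 (P : Fin 8 → Fin 8 → Prop)
    (h : ∀ i j : Fin 8, 0 < i → i < j → s(i, j) ∈ T 23 → P i j)
    (h' : P 3 6 ∧ P 3 4 ∧ P 6 7 ∧ P 4 7 ∧ P 4 6 ∧ P 3 7) :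
    ∀ i j : Fin 8, 0 < i → i < j → s(i, j) ∈ T 24 → P i j := by
  have key : ∀ i j : Fin 8, 0 < i → i < j → s(i, j) ∈ T 24 → s(i, j) ∈ T 23 ∨
      (i, j) ∈ [((3 : Fin 8), (6 : Fin 8)), (3, 4), (6, 7), (4, 7), (4, 6), (3, 7)] := by
    decide +kernel
  intro i j hi hij hm
  rcases key i j hi hij hm with hm | this
  · exact h i j hi hij hm
  simp only [List.mem_cons, Prod.mk.injEq, List.not_mem_nil, or_false] at this
  rcases this with ⟨rfl, rfl⟩ | ⟨rfl, rfl⟩ | ⟨rfl, rfl⟩ | ⟨rfl, rfl⟩ | ⟨rfl, rfl⟩ | ⟨rfl, rfl⟩ <;>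
    tauto

theorem equivalent_epsT_21 (hε : Admissible ε) (hT : HasSupport ε 21) :
    (Γ t).Equivalent ε (epsT 21) := by
  obtain ⟨ε', hε', hT', heq, h, -⟩ := exists_normalized (t := t) hε hT
    (hT.ne_zero 1 2 (by decide)) (hT.ne_zero 1 3 (by decide)) (hT.ne_zero 1 7 (by decide))
    (hT.ne_zero 2 3 (by decide)) one_ne_zero one_ne_zero one_ne_zero
  exact heq.trans (equivalent_epsT_of_val_eq_one hε' hT'
    (forall_edge_21 _ h (hε'.val_eq_one_21 h)))

theorem equivalent_epsT_22 (hε : Admissible ε) (hT : HasSupport ε 22) :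
    (Γ t).Equivalent ε (epsT 22) := by
  have h12 := hT.ne_zero 1 2 (by decide)
  obtain ⟨a, ha, ha'⟩ := exists_sq_eq (mul_ne_zero h12 (hT.ne_zero 1 5 (by decide)))
  obtain ⟨ε', hε', hT', heq, h, h15, -⟩ := exists_normalized (t := t) hε hT
    h12 (hT.ne_zero 1 3 (by decide)) (hT.ne_zero 1 7 (by decide))
    (hT.ne_zero 2 3 (by decide)) ha one_ne_zero one_ne_zero
  exact heq.trans (equivalent_epsT_of_val_eq_one hε' hT'
    (forall_edge_22 _ (forall_edge_21 _ h (hε'.val_eq_one_21 h))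
      ⟨h15 ha', hε'.val_eq_one_22 h (h15 ha')⟩))

theorem equivalent_epsT_23 (hε : Admissible ε) (hT : HasSupport ε 23) :
    (Γ t).Equivalent ε (epsT 23) := by
  have h12 := hT.ne_zero 1 2 (by decide)
  obtain ⟨a, ha, ha'⟩ := exists_sq_eq (mul_ne_zero h12 (hT.ne_zero 1 5 (by decide)))
  obtain ⟨b, hb, hb'⟩ := exists_sq_eq (mul_ne_zero h12 (hT.ne_zero 2 5 (by decide)))
  obtain ⟨ε', hε', hT', heq, h, h15, h25, -⟩ := exists_normalized (t := t) hε hT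
    h12 (hT.ne_zero 1 3 (by decide)) (hT.ne_zero 1 7 (by decide))
    (hT.ne_zero 2 3 (by decide)) ha hb one_ne_zero
  have h15 := h15 ha'
  have h25 := h25 hb'
  exact heq.trans (equivalent_epsT_of_val_eq_one hε' hT'
    (forall_edge_23 _ (forall_edge_22 _ (forall_edge_21 _ h (hε'.val_eq_one_21 h))
      ⟨h15, hε'.val_eq_one_22 h h15⟩) ⟨h25, hε'.val_eq_one_23 h h15 h25⟩))

theorem equivalent_epsT_24 (hε : Admissible ε) (hT : HasSupport ε 24) :
    (Γ t).Equivalent ε (epsT 24) := by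
  have h12 := hT.ne_zero 1 2 (by decide)
  have h13 := hT.ne_zero 1 3 (by decide)
  obtain ⟨a, ha, ha'⟩ := exists_sq_eq (mul_ne_zero h12 (hT.ne_zero 1 5 (by decide)))
  obtain ⟨b, hb, hb'⟩ := exists_sq_eq (mul_ne_zero h12 (hT.ne_zero 2 5 (by decide)))
  obtain ⟨c, hc, hc'⟩ := exists_sq_eq (mul_ne_zero h13 (hT.ne_zero 3 6 (by decide)))
  obtain ⟨ε', hε', hT', heq, h, h15, h25, h36⟩ := exists_normalized (t := t) hε hT
    h12 h13 (hT.ne_zero 1 7 (by decide)) (hT.ne_zero 2 3 (by decide)) ha hb hc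
  have h15 := h15 ha'
  have h25 := h25 hb'
  have h36 := h36 hc'
  exact heq.trans (equivalent_epsT_of_val_eq_one hε' hT'
    (forall_edge_24 _ (forall_edge_23 _ (forall_edge_22 _ (forall_edge_21 _ h
      (hε'.val_eq_one_21 h)) ⟨h15, hε'.val_eq_one_22 h h15⟩) ⟨h25, hε'.val_eq_one_23 h h15 h25⟩)
      ⟨h36, hε'.val_eq_one_24 h h15 h25 h36⟩))

/-- The sets `T 8` and `T 10` differ only in the edge on the line `{1, 4, 7}`; they are not related
by a collineation. -/
theorem equivalent_epsT_8_10 : (Γ t).Equivalent (epsT 8) (epsT 10) := by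
  have hs : ∀ c : Sym2 (Fin 8) → ℂ, ∀ g h, ofEdges c g h = ofEdges c h g := by
    intro c g h
    rw [ofEdges, ofEdges, Sym2.eq_swap]
    exact if_congr (by tauto) rfl rfl
  have h0 : ∀ k, (∀ g h : G, g ≠ deg 1 → h ≠ deg 1 → s(idx g, idx h) ∉ T k) →
      ∀ g h, g ≠ deg 1 → h ≠ deg 1 → epsT k g h = 0 := by
    intro k hk g h hg hh
    rw [epsT, ofEdges, if_neg (hk g h hg hh), ite_self]
  refine equivalent_of_swap (fun g _ _ => hs _ _ _) (fun g _ _ => hs _ _ _)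
    (h0 8 (by decide +kernel)) (h0 10 (by decide +kernel)) fun g hg hg1 => ?_
  have h1 : ∀ g : G, g ≠ 0 → g ≠ deg 1 → Equiv.swap (deg 4) (deg 7) g ≠ 0 ∧
      Equiv.swap (deg 4) (deg 7) g ≠ deg 1 ∧
      (s(idx (deg 1), idx (Equiv.swap (deg 4) (deg 7) g)) ∈ T 10 ↔
        s(idx (deg 1), idx g) ∈ T 8) := by
    decide +kernel
  obtain ⟨e1, e2, e3⟩ := h1 g hg hg1
  rw [epsT, epsT, ofEdges, ofEdges, if_neg (not_or.2 ⟨by decide, not_or.2 ⟨e1, e2.symm⟩⟩),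
    if_neg (not_or.2 ⟨by decide, not_or.2 ⟨hg, hg1.symm⟩⟩)]
  simp only [e3]

end

/-! ### The listed maps are graded contractions -/

theorem ofEdges_comm (c : Sym2 (Fin 8) → ℂ) (g h : G) : ofEdges c g h = ofEdges c h g := by
  rw [ofEdges, ofEdges, Sym2.eq_swap]
  exact if_congr (by tauto) rfl rfl

theorem ofEdges_of_ne (c : Sym2 (Fin 8) → ℂ) {g h : G} (hg : g ≠ 0) (hh : h ≠ 0) (hgh : g ≠ h) :
    ofEdges c g h = c s(idx g, idx h) :=
  if_neg (by tauto)

theorem val_ofEdges (c : Sym2 (Fin 8) → ℂ) (i j : Fin 8) (hij : 0 < i ∧ i < j := by decide) :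
    val (ofEdges c) i j = c s(i, j) := by
  rw [val, ofEdges_of_ne c (deg_ne_zero hij.1) (deg_ne_zero (hij.1.trans hij.2)) (deg_ne hij.2),
    idx_deg, idx_deg]

theorem hasSupport_ofEdges {c : Sym2 (Fin 8) → ℂ} {k : ℕ} (hc : ∀ a, c a ≠ 0 ↔ a ∈ T k) :
    HasSupport (ofEdges c) k := fun g h hg hh hgh => by rw [ofEdges_of_ne c hg hh hgh, hc]

theorem hasSupport_epsT (k : ℕ) : HasSupport (epsT k) k :=
  hasSupport_ofEdges fun a => by simp

theorem hasSupport_eps14 {l : ℂ} (hl : l ≠ 0) : HasSupport (eps14 l) 14 :=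
  hasSupport_ofEdges fun a => by
    have : s(1, 6) ∈ T 14 := by decide
    split_ifs <;> simp_all

theorem hasSupport_eps17 {l : ℂ} (hl : l ≠ 0) : HasSupport (eps17 l) 17 :=
  hasSupport_ofEdges fun a => by
    have h1 : s(1, 3) ∈ T 17 := by decide
    have h2 : s(1, 6) ∈ T 17 := by decide
    split_ifs with h <;> [rcases h with rfl | rfl; skip; skip] <;> simp_all

theorem hasSupport_eps20 {l m : ℂ} (hl : l ≠ 0) (hm : m ≠ 0) : HasSupport (eps20 l m) 20 :=
  hasSupport_ofEdges fun a => by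
    have h1 : s(1, 3) ∈ T 20 := by decide
    have h2 : s(1, 6) ∈ T 20 := by decide
    have h3 : s(1, 4) ∈ T 20 := by decide
    have h4 : s(1, 7) ∈ T 20 := by decide
    split_ifs with h h' <;> [rcases h with rfl | rfl; rcases h' with rfl | rfl; skip; skip] <;>
      simp_all

theorem admissible_epsT : ∀ i ∈ isolated, Admissible (epsT i) := by
  have key : ∀ i ∈ isolated, ∀ g h k, Generic g h k →
      ((s(idx g, idx (h + k)) ∈ T i ∧ s(idx h, idx k) ∈ T i) ↔
        (s(idx h, idx (k + g)) ∈ T i ∧ s(idx k, idx g) ∈ T i)) := by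
    decide +kernel
  refine fun i hi => ⟨fun g h _ _ _ => ofEdges_comm _ g h, fun g h k hgen => ?_⟩
  obtain ⟨hg, hh, hk, hhk, hkg, hs, hs', h3, h4⟩ := generic_ne hgen
  have := key i hi g h k hgen
  rw [epsT, ofEdges_of_ne _ hg hs h3, ofEdges_of_ne _ hh hk hhk, ofEdges_of_ne _ hh hs' h4,
    ofEdges_of_ne _ hk hg hkg]
  simp only [← ite_and, mul_ite, mul_one, mul_zero]
  exact if_congr (by tauto) rfl rfl

/-- A symmetric map all of whose edges pass through `g₁` is admissible: in each of the products in
the Jacobi identity one of the two edges avoids `g₁`. -/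
theorem admissible_of_hasSupport_star {c : Sym2 (Fin 8) → ℂ} {k : ℕ}
    (hk : k = 14 ∨ k = 17 ∨ k = 20) (hc : HasSupport (ofEdges c) k) : Admissible (ofEdges c) := by
  have key : ∀ g h k, Generic g h k → ¬(s(idx g, idx (h + k)) ∈ T 20 ∧ s(idx h, idx k) ∈ T 20) := by
    decide +kernel
  have hsub : T k ⊆ T 20 := by rcases hk with rfl | rfl | rfl <;> decide
  have hzero : ∀ g h k, Generic g h k → ofEdges c g (h + k) * ofEdges c h k = 0 := by
    intro g h k hgen
    obtain ⟨hg, hh, hk, hhk, hkg, hs, hs', h3, h4⟩ := generic_ne hgen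
    by_contra h0
    obtain ⟨h1, h2⟩ := mul_ne_zero_iff.1 h0
    exact key g h k hgen ⟨hsub ((hc _ _ hg hs h3).1 h1), hsub ((hc _ _ hh hk hhk).1 h2)⟩
  exact ⟨fun g h _ _ _ => ofEdges_comm _ g h, fun g h k hgen => by
    rw [hzero g h k hgen, hzero h k g hgen.rotate]⟩

theorem admissible_eps14 {l : ℂ} (hl : l ≠ 0) : Admissible (eps14 l) :=
  admissible_of_hasSupport_star (by tauto) (hasSupport_eps14 hl)

theorem admissible_eps17 {l : ℂ} (hl : l ≠ 0) : Admissible (eps17 l) :=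
  admissible_of_hasSupport_star (by tauto) (hasSupport_eps17 hl)

theorem admissible_eps20 {l m : ℂ} (hl : l ≠ 0) (hm : m ≠ 0) : Admissible (eps20 l m) :=
  admissible_of_hasSupport_star (by tauto) (hasSupport_eps20 hl hm)

/-! ### An invariant of the support -/

/-- `g` and `h` are joined by an edge of `T k`. -/
def Adj (k : ℕ) (g h : G) : Prop := (g ≠ 0 ∧ h ≠ 0 ∧ g ≠ h) ∧ s(idx g, idx h) ∈ T k

instance (k : ℕ) (g h : G) : Decidable (Adj k g h) := inferInstanceAs (Decidable (_ ∧ _))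

/-- The number of edges of `T k` at `g`. -/
def valency (k : ℕ) (g : G) : ℕ := (Finset.univ.filter fun h => Adj k g h).card

/-- The number of `x` such that `{x, g + x}` is an edge of `T k`, which is twice the number of
edges whose sum is `g`. -/
def sumCount (k : ℕ) (g : G) : ℕ := (Finset.univ.filter fun x => Adj k x (g + x)).card

/-- A number attached to `T k` that depends only on the equivalence classes of maps with this
support. -/
def supportInvariant (k : ℕ) : ℕ := ∑ g, valency k g * (2 * valency k g + sumCount k g) ^ 2

theorem supportInvariant_injOn : ∀ i ∈ Finset.Icc 1 24 \ {8}, ∀ j ∈ Finset.Icc 1 24 \ {8},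
    supportInvariant i = supportInvariant j → i = j := by
  decide +kernel

section

variable {ε ε' : G → G → ℂ} {f : alg t ≃ₗ[ℂ] alg t} {σ : G → G} {i j : ℕ}

theorem IsEquivalence.adj_iff (E : IsEquivalence t ε ε' f σ) (hi : HasSupport ε i)
    (hj : HasSupport ε' j) (g h : G) : Adj i g h ↔ Adj j (σ g) (σ h) := by
  have h0 : ∀ g, σ g ≠ 0 ↔ g ≠ 0 := fun g =>
    ⟨fun h h' => h (by rw [h', E.map_zero']), E.map_ne_zero⟩
  unfold Adj
  rw [h0, h0, E.injective.ne_iff]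
  refine and_congr_right fun ⟨hg, hh, hgh⟩ => ?_
  rw [← hi g h hg hh hgh, E.support_iff hg hh hgh,
    hj _ _ (E.map_ne_zero hg) (E.map_ne_zero hh) (E.injective.ne hgh)]

theorem IsEquivalence.map_add_of_adj (E : IsEquivalence t ε ε' f σ) (hi : HasSupport ε i)
    {g h : G} (hgh : Adj i g h) : σ (g + h) = σ g + σ h := by
  obtain ⟨⟨hg, hh, hne⟩, hm⟩ := hgh
  exact E.map_add_of_ne_zero hg hh hne ((hi g h hg hh hne).2 hm)

theorem IsEquivalence.valency_eq (E : IsEquivalence t ε ε' f σ) (hi : HasSupport ε i)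
    (hj : HasSupport ε' j) (g : G) : valency j (σ g) = valency i g := by
  have hb : Function.Bijective σ := Finite.injective_iff_bijective.1 E.injective
  refine (Finset.card_bij (fun x _ => σ x) ?_ (fun x _ y _ h => E.injective h) ?_).symm
  · intro x hx
    simpa [← E.adj_iff hi hj] using hx
  · intro y hy
    obtain ⟨x, rfl⟩ := hb.2 y
    exact ⟨x, by simpa [← E.adj_iff hi hj] using hy, rfl⟩

theorem IsEquivalence.sumCount_eq (E : IsEquivalence t ε ε' f σ) (hi : HasSupport ε i)
    (hj : HasSupport ε' j) (g : G) : sumCount j (σ g) = sumCount i g := by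
  have hb : Function.Bijective σ := Finite.injective_iff_bijective.1 E.injective
  refine (Finset.card_bij (fun x _ => σ x) ?_ (fun x _ y _ h => E.injective h) ?_).symm
  · intro x hx
    have hx : Adj i x (g + x) := by simpa using hx
    have h1 := E.map_add_of_adj hi hx
    rw [add_comm g x, ← add_assoc, add_self_G, zero_add] at h1
    rw [E.adj_iff hi hj] at hx
    have h2 : σ (x + g) = σ g + σ x := by
      rw [h1, add_comm (σ x), add_add_self]
    rw [add_comm g, h2] at hx
    simpa using hx
  · intro y hy
    obtain ⟨x, rfl⟩ := hb.2 y
    have hx : Adj j (σ x) (σ g + σ x) := by simpa using hy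
    obtain ⟨z, hz⟩ := hb.2 (σ g + σ x)
    rw [← hz, ← E.adj_iff hi hj] at hx
    have h1 := E.map_add_of_adj hi hx
    rw [hz, add_comm (σ g), ← add_assoc, add_self_G, zero_add] at h1
    refine ⟨x, ?_, rfl⟩
    have h2 : z = g + x := by rw [← E.injective h1, add_comm x z, add_add_self]
    simpa [← h2] using hx

end

theorem supportInvariant_eq {ε ε' : G → G → ℂ} {i j : ℕ} (h : (Γ t).Equivalent ε ε')
    (hi : HasSupport ε i) (hj : HasSupport ε' j) : supportInvariant i = supportInvariant j := by
  obtain ⟨f, σ, E⟩ := exists_isEquivalence h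
  have hb : Function.Bijective σ := Finite.injective_iff_bijective.1 E.injective
  unfold supportInvariant
  rw [← (Equiv.ofBijective σ hb).sum_comp fun g => valency j g * _]
  refine Finset.sum_congr rfl fun g _ => ?_
  rw [Equiv.ofBijective_apply, E.valency_eq hi hj, E.sumCount_eq hi hj]

/-- Equivalent maps supported on listed sets other than `T 8` have the same support. -/
theorem index_eq_of_equivalent {ε ε' : G → G → ℂ} {i j : ℕ} (h : (Γ t).Equivalent ε ε')
    (hi : HasSupport ε i) (hj : HasSupport ε' j) (hi' : i ∈ Finset.Icc 1 24 \ {8})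
    (hj' : j ∈ Finset.Icc 1 24 \ {8}) : i = j :=
  supportInvariant_injOn i hi' j hj' (supportInvariant_eq h hi hj)

/-! ### The weights of the members of the families -/

/-- The line through `g₁` and `g`: `0`, `1`, `2` for the lines `{1, 2, 5}`, `{1, 3, 6}` and
`{1, 4, 7}`. -/
def line (g : G) : Fin 3 := ![0, 0, 0, 1, 2, 0, 1, 2] (idx g)

theorem weight_eq_of_val {ε : G → G → ℂ} {W : Fin 3 → ℂ}
    (h : ∀ p ∈ [((2 : Fin 8), (5 : Fin 8), (0 : Fin 3)), (3, 6, 1), (4, 7, 2)],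
      val ε 1 p.1 * val ε 1 p.2.1 = W p.2.2) {g : G} (hg : g ≠ 0) (hg1 : g ≠ deg 1) :
    weight ε (deg 1) g = W (line g) := by
  have key : ∀ g : G, g ≠ 0 → g ≠ deg 1 →
      ∃ p ∈ [((2 : Fin 8), (5 : Fin 8), (0 : Fin 3)), (3, 6, 1), (4, 7, 2)],
        p.2.2 = line g ∧ ((g = deg p.1 ∧ deg 1 + g = deg p.2.1) ∨
          (g = deg p.2.1 ∧ deg 1 + g = deg p.1)) := by
    decide +kernel
  obtain ⟨p, hp, h1, h2⟩ := key g hg hg1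
  rw [← h1, ← h p hp, weight, val, val]
  rcases h2 with ⟨h2, h3⟩ | ⟨h2, h3⟩
  · rw [h3, h2, mul_comm]
  · rw [h3, h2]

theorem weight_eps14 (l : ℂ) {g : G} (hg : g ≠ 0) (hg1 : g ≠ deg 1) :
    weight (eps14 l) (deg 1) g = ![1, l, 0] (line g) := by
  refine weight_eq_of_val ?_ hg hg1
  simp [eps14, val_ofEdges, T]

theorem weight_eps17 (l : ℂ) {g : G} (hg : g ≠ 0) (hg1 : g ≠ deg 1) :
    weight (eps17 l) (deg 1) g = ![1, l ^ 2, 0] (line g) := by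
  refine weight_eq_of_val ?_ hg hg1
  simp [eps17, val_ofEdges, T, sq]

theorem weight_eps20 (l m : ℂ) {g : G} (hg : g ≠ 0) (hg1 : g ≠ deg 1) :
    weight (eps20 l m) (deg 1) g = ![1, l ^ 2, m ^ 2] (line g) := by
  refine weight_eq_of_val ?_ hg hg1
  simp [eps20, val_ofEdges, T, sq]

/-- An equivalence between two maps supported on the same star permutes the three lines through
`g₁`, and the weights on the lines agree up to this permutation and a common factor. -/
theorem exists_perm_weights {ε ε' : G → G → ℂ} (h : (Γ t).Equivalent ε ε') {k : ℕ}
    (hk : k = 14 ∨ k = 17 ∨ k = 20) (hε : HasSupport ε k) (hε' : HasSupport ε' k)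
    {W W' : Fin 3 → ℂ} (hW : ∀ g, g ≠ 0 → g ≠ deg 1 → weight ε (deg 1) g = W (line g))
    (hW' : ∀ g, g ≠ 0 → g ≠ deg 1 → weight ε' (deg 1) g = W' (line g)) :
    ∃ a b c : Fin 3, a ≠ b ∧ a ≠ c ∧ b ≠ c ∧
      W 1 * W' a = W 0 * W' b ∧ W 2 * W' a = W 0 * W' c := by
  obtain ⟨f, σ, E⟩ := exists_isEquivalence h
  have a12 : Adj k (deg 1) (deg 2) := by rcases hk with rfl | rfl | rfl <;> decide
  have a13 : Adj k (deg 1) (deg 3) := by rcases hk with rfl | rfl | rfl <;> decide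
  -- `g₁` is the only vertex with two neighbours
  have center : ∀ g x y, Adj k g x → Adj k g y → x ≠ y → g = deg 1 := by
    rcases hk with rfl | rfl | rfl <;> decide +kernel
  have h1 : σ (deg 1) = deg 1 := center _ _ _ ((E.adj_iff hε hε' _ _).1 a12)
    ((E.adj_iff hε hε' _ _).1 a13) (E.injective.ne (by decide))
  have h5 := E.map_add_of_adj hε a12
  have h6 := E.map_add_of_adj hε a13
  rw [h1] at h5 h6
  have lines : ∀ x y : G, x ≠ 0 ∧ x ≠ deg 1 ∧ y ≠ 0 ∧ y ≠ deg 1 ∧ x ≠ y ∧ x ≠ deg 1 + y →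
      line x ≠ line y := by decide +kernel
  have hne : ∀ {g}, g ≠ deg 1 → σ g ≠ deg 1 := fun hg h => hg (E.injective (h.trans h1.symm))
  have hz : ∀ i : Fin 8, 0 < i → σ (deg i) ≠ 0 := fun i hi => E.map_ne_zero (deg_ne_zero hi)
  have ho : ∀ i : Fin 8, 1 < i → σ (deg i) ≠ deg 1 := fun i hi => hne (deg_ne hi).symm
  have l1 : line (σ (deg 2)) ≠ line (σ (deg 3)) := lines _ _ ⟨hz 2 (by decide), ho 2 (by decide),
    hz 3 (by decide), ho 3 (by decide), E.injective.ne (by decide),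
    h6 ▸ E.injective.ne (by decide)⟩
  have l2 : line (σ (deg 4)) ≠ line (σ (deg 2)) := lines _ _ ⟨hz 4 (by decide), ho 4 (by decide),
    hz 2 (by decide), ho 2 (by decide), E.injective.ne (by decide),
    h5 ▸ E.injective.ne (by decide)⟩
  have l3 : line (σ (deg 4)) ≠ line (σ (deg 3)) := lines _ _ ⟨hz 4 (by decide), ho 4 (by decide),
    hz 3 (by decide), ho 3 (by decide), E.injective.ne (by decide),
    h6 ▸ E.injective.ne (by decide)⟩
  refine ⟨_, _, _, l1, l2.symm, l3.symm, ?_, ?_⟩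
  · have := E.weight_ratio (p := deg 1) (g := deg 2) (h := deg 3) (by decide) (by decide)
      (by decide) (by decide) (by decide) (by decide) (by decide)
    rwa [h1, hW _ (by decide) (by decide), hW _ (by decide) (by decide),
      hW' _ (hz 2 (by decide)) (ho 2 (by decide)), hW' _ (hz 3 (by decide)) (ho 3 (by decide))]
      at this
  · have := E.weight_ratio (p := deg 1) (g := deg 2) (h := deg 4) (by decide) (by decide)
      (by decide) (by decide) (by decide) (by decide) (by decide)
    rwa [h1, hW _ (by decide) (by decide), hW _ (by decide) (by decide),
      hW' _ (hz 2 (by decide)) (ho 2 (by decide)), hW' _ (hz 4 (by decide)) (ho 4 (by decide))]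
      at this

/-! ### Equivalences within the families -/

theorem Admissible.comp {ε : G → G → ℂ} (hε : Admissible ε) (σ : G ≃+ G) :
    Admissible fun g h => ε (σ g) (σ h) where
  symm g h hg hh hgh := hε.symm _ _ (by simpa using hg) (by simpa using hh) (σ.injective.ne hgh)
  jacobi g h k hgen := by
    simp only [map_add]
    apply hε.jacobi
    unfold Generic at hgen ⊢
    rw [← map_add]
    simpa only [ne_eq, map_eq_zero_iff σ σ.injective, σ.injective.eq_iff] using hgen

theorem HasSupport.comp {ε : G → G → ℂ} {k : ℕ} (hε : HasSupport ε k) (σ : G ≃+ G)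
    (h : ∀ g h, s(idx (σ g), idx (σ h)) ∈ T k ↔ s(idx g, idx h) ∈ T k) :
    HasSupport (fun g h => ε (σ g) (σ h)) k := fun g h' hg hh hgh => by
  rw [hε _ _ (by simpa using hg) (by simpa using hh) (σ.injective.ne hgh), h]

/-- The collineation that fixes `g₁` and `g₄` and exchanges `g₂` and `g₃`. -/
def swap23 : G ≃+ G where
  toFun g := (g.1, g.2.2, g.2.1)
  invFun g := (g.1, g.2.2, g.2.1)
  left_inv _ := rfl
  right_inv _ := rfl
  map_add' _ _ := rfl

/-- The collineation that fixes `g₁` and `g₂` and exchanges `g₃` and `g₄`. -/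
def swap34 : G ≃+ G where
  toFun g := (g.1 + g.2.2, g.2.1 + g.2.2, g.2.2)
  invFun g := (g.1 + g.2.2, g.2.1 + g.2.2, g.2.2)
  left_inv := by decide
  right_inv := by decide
  map_add' := by decide

theorem val_comp (ε : G → G → ℂ) (σ : G ≃+ G) (i j i' j' : Fin 8)
    (h : σ (deg i) = deg i' ∧ σ (deg j) = deg j') :
    val (fun g h => ε (σ g) (σ h)) i j = val ε i' j' := by
  rw [val, h.1, h.2, val]

theorem equivalent_eps14_inv {l : ℂ} (hl : l ≠ 0) : (Γ t).Equivalent (eps14 l) (eps14 (1 / l)) := by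
  refine (equivalent_comp _ swap23).trans (equivalent_eps14 ((admissible_eps14 hl).comp swap23)
    ((hasSupport_eps14 hl).comp swap23 (by decide +kernel)) ?_)
  rw [val_comp _ swap23 1 2 1 3 (by decide), val_comp _ swap23 1 3 1 2 (by decide),
    val_comp _ swap23 1 5 1 6 (by decide), val_comp _ swap23 1 6 1 5 (by decide)]
  simp [eps14, val_ofEdges, T, hl]

theorem equivalent_eps14_iff {l l' : ℂ} (hl : l ≠ 0) (hl' : l' ≠ 0) :
    (Γ t).Equivalent (eps14 l) (eps14 l') ↔ l' = l ∨ l' = 1 / l := by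
  constructor
  · intro h
    obtain ⟨a, b, c, hab, hac, hbc, h1, h2⟩ := exists_perm_weights h (by tauto)
      (hasSupport_eps14 hl) (hasSupport_eps14 hl') (fun _ => weight_eps14 l)
      (fun _ => weight_eps14 l')
    fin_cases a <;> fin_cases b <;> fin_cases c <;> simp_all
    grind
  · rintro (rfl | rfl)
    · exact equivalent_of_scale (fun _ => 1) (fun _ => one_ne_zero) (by simp)
    · exact equivalent_eps14_inv hl

theorem equivalent_eps17_of_sq_eq {l l' : ℂ} (hl : l ≠ 0) (hl' : l' ≠ 0) (h : l' ^ 2 = l ^ 2) :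
    (Γ t).Equivalent (eps17 l) (eps17 l') := by
  refine equivalent_eps17 (admissible_eps17 hl) (hasSupport_eps17 hl) hl' ?_
  simp [eps17, val_ofEdges, T, h, sq]

theorem equivalent_eps17_of_sq_mul_sq {l l' : ℂ} (hl : l ≠ 0) (hl' : l' ≠ 0)
    (h : l' ^ 2 * l ^ 2 = 1) : (Γ t).Equivalent (eps17 l) (eps17 l') := by
  refine (equivalent_comp _ swap23).trans (equivalent_eps17 ((admissible_eps17 hl).comp swap23)
    ((hasSupport_eps17 hl).comp swap23 (by decide +kernel)) hl' ?_)
  rw [val_comp _ swap23 1 2 1 3 (by decide), val_comp _ swap23 1 3 1 2 (by decide),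
    val_comp _ swap23 1 5 1 6 (by decide), val_comp _ swap23 1 6 1 5 (by decide)]
  simp [eps17, val_ofEdges, T]
  linear_combination h

theorem equivalent_eps17_iff_sq {l l' : ℂ} (hl : l ≠ 0) (hl' : l' ≠ 0) :
    (Γ t).Equivalent (eps17 l) (eps17 l') ↔ l' ^ 2 = l ^ 2 ∨ l' ^ 2 * l ^ 2 = 1 := by
  constructor
  · intro h
    obtain ⟨a, b, c, hab, hac, hbc, h1, h2⟩ := exists_perm_weights h (by tauto)
      (hasSupport_eps17 hl) (hasSupport_eps17 hl') (fun _ => weight_eps17 l)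
      (fun _ => weight_eps17 l')
    fin_cases a <;> fin_cases b <;> fin_cases c <;> simp_all <;> grind
  · rintro (h | h)
    · exact equivalent_eps17_of_sq_eq hl hl' h
    · exact equivalent_eps17_of_sq_mul_sq hl hl' h

theorem equivalent_eps17_iff {l l' : ℂ} (hl : l ≠ 0) (hl' : l' ≠ 0) :
    (Γ t).Equivalent (eps17 l) (eps17 l') ↔ l' = l ∨ l' = -l ∨ l' = 1 / l ∨ l' = -(1 / l) := by
  rw [equivalent_eps17_iff_sq hl hl', ← mul_pow, sq_eq_one_iff, sq_eq_sq_iff_eq_or_eq_neg,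
    eq_div_iff hl, neg_div', eq_div_iff hl, or_assoc]

theorem equivalent_eps20_of_sq_eq {l m l' m' : ℂ} (hl : l ≠ 0) (hm : m ≠ 0) (hl' : l' ≠ 0)
    (hm' : m' ≠ 0) (h1 : l' ^ 2 = l ^ 2) (h2 : m' ^ 2 = m ^ 2) :
    (Γ t).Equivalent (eps20 l m) (eps20 l' m') := by
  refine equivalent_eps20 (admissible_eps20 hl hm) (hasSupport_eps20 hl hm) hl' hm' ?_ ?_
  · simp [eps20, val_ofEdges, T, h1, sq]
  · simp [eps20, val_ofEdges, T, h2, sq]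

theorem equivalent_eps20_comm {l m : ℂ} (hl : l ≠ 0) (hm : m ≠ 0) :
    (Γ t).Equivalent (eps20 l m) (eps20 m l) := by
  refine (equivalent_comp _ swap34).trans (equivalent_eps20 ((admissible_eps20 hl hm).comp swap34)
    ((hasSupport_eps20 hl hm).comp swap34 (by decide +kernel)) hm hl ?_ ?_)
  · rw [val_comp _ swap34 1 2 1 2 (by decide), val_comp _ swap34 1 5 1 5 (by decide),
      val_comp _ swap34 1 3 1 4 (by decide), val_comp _ swap34 1 6 1 7 (by decide)]
    simp [eps20, val_ofEdges, T, sq]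
  · rw [val_comp _ swap34 1 2 1 2 (by decide), val_comp _ swap34 1 5 1 5 (by decide),
      val_comp _ swap34 1 4 1 3 (by decide), val_comp _ swap34 1 7 1 6 (by decide)]
    simp [eps20, val_ofEdges, T, sq]

theorem equivalent_eps20_inv {l m : ℂ} (hl : l ≠ 0) (hm : m ≠ 0) :
    (Γ t).Equivalent (eps20 l m) (eps20 (1 / l) (m / l)) := by
  refine (equivalent_comp _ swap23).trans (equivalent_eps20 ((admissible_eps20 hl hm).comp swap23)
    ((hasSupport_eps20 hl hm).comp swap23 (by decide +kernel)) (one_div_ne_zero hl)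
    (div_ne_zero hm hl) ?_ ?_)
  · rw [val_comp _ swap23 1 2 1 3 (by decide), val_comp _ swap23 1 5 1 6 (by decide),
      val_comp _ swap23 1 3 1 2 (by decide), val_comp _ swap23 1 6 1 5 (by decide)]
    simp [eps20, val_ofEdges, T]
    field_simp
  · rw [val_comp _ swap23 1 2 1 3 (by decide), val_comp _ swap23 1 5 1 6 (by decide),
      val_comp _ swap23 1 4 1 4 (by decide), val_comp _ swap23 1 7 1 7 (by decide)]
    simp [eps20, val_ofEdges, T]
    field_simp

theorem set_eq_iff_sq {x y a b : ℂ} : ({x, -x, y, -y} : Set ℂ) = {a, -a, b, -b} ↔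
    (x ^ 2 = a ^ 2 ∧ y ^ 2 = b ^ 2) ∨ (x ^ 2 = b ^ 2 ∧ y ^ 2 = a ^ 2) := by
  have hm : ∀ x a b : ℂ, x ∈ ({a, -a, b, -b} : Set ℂ) ↔ x ^ 2 = a ^ 2 ∨ x ^ 2 = b ^ 2 := by
    intro x a b
    simp only [Set.mem_insert_iff, Set.mem_singleton_iff, sq_eq_sq_iff_eq_or_eq_neg, or_assoc]
  constructor
  · intro h
    have h1 := (hm x a b).1 (h ▸ by simp)
    have h2 := (hm y a b).1 (h ▸ by simp)
    have h3 := (hm a x y).1 (h ▸ by simp)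
    have h4 := (hm b x y).1 (h ▸ by simp)
    grind
  · intro h
    ext z
    rw [hm, hm]
    rcases h with ⟨h1, h2⟩ | ⟨h1, h2⟩ <;> rw [h1, h2]
    tauto

theorem equivalent_eps20_of_set_eq {l m l' m' : ℂ} (hl : l ≠ 0) (hm : m ≠ 0) (hl' : l' ≠ 0)
    (hm' : m' ≠ 0) (h : ({l', -l', m', -m'} : Set ℂ) = {l, -l, m, -m}) :
    (Γ t).Equivalent (eps20 l m) (eps20 l' m') := by
  rcases set_eq_iff_sq.1 h with ⟨h1, h2⟩ | ⟨h1, h2⟩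
  · exact equivalent_eps20_of_sq_eq hl hm hl' hm' h1 h2
  · exact (equivalent_eps20_comm hl hm).trans (equivalent_eps20_of_sq_eq hm hl hl' hm' h1 h2)

theorem equivalent_eps20_iff {l m l' m' : ℂ} (hl : l ≠ 0) (hm : m ≠ 0) (hl' : l' ≠ 0)
    (hm' : m' ≠ 0) :
    (Γ t).Equivalent (eps20 l m) (eps20 l' m') ↔
      ({l', -l', m', -m'} : Set ℂ) = {l, -l, m, -m} ∨
      ({l', -l', m', -m'} : Set ℂ) = {1 / l, -(1 / l), m / l, -(m / l)} ∨
      ({l', -l', m', -m'} : Set ℂ) = {l / m, -(l / m), 1 / m, -(1 / m)} := by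
  constructor
  · intro h
    obtain ⟨a, b, c, hab, hac, hbc, h1, h2⟩ := exists_perm_weights h (by tauto)
      (hasSupport_eps20 hl hm) (hasSupport_eps20 hl' hm') (fun _ => weight_eps20 l m)
      (fun _ => weight_eps20 l' m')
    rw [set_eq_iff_sq, set_eq_iff_sq, set_eq_iff_sq]
    simp only [div_pow, one_pow]
    rw [eq_div_iff (pow_ne_zero 2 hl), eq_div_iff (pow_ne_zero 2 hl), eq_div_iff (pow_ne_zero 2 hl),
      eq_div_iff (pow_ne_zero 2 hl), eq_div_iff (pow_ne_zero 2 hm), eq_div_iff (pow_ne_zero 2 hm),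
      eq_div_iff (pow_ne_zero 2 hm), eq_div_iff (pow_ne_zero 2 hm)]
    have h3 := pow_ne_zero 2 hl
    have h4 := pow_ne_zero 2 hm
    generalize l ^ 2 = L at *
    generalize m ^ 2 = M at *
    generalize l' ^ 2 = L' at *
    generalize m' ^ 2 = M' at *
    fin_cases a <;> fin_cases b <;> fin_cases c <;> simp at * <;> grind
  · rintro (h | h | h)
    · exact equivalent_eps20_of_set_eq hl hm hl' hm' h
    · exact (equivalent_eps20_inv hl hm).trans (equivalent_eps20_of_set_eq (one_div_ne_zero hl)
        (div_ne_zero hm hl) hl' hm' h)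
    · refine ((equivalent_eps20_comm hl hm).trans (equivalent_eps20_inv hm hl)).trans
        (equivalent_eps20_of_set_eq (one_div_ne_zero hm) (div_ne_zero hl hm) hl' hm' (h.trans ?_))
      rw [set_eq_iff_sq]
      tauto

/-! ### The classification -/

open Classical in
/-- Up to a collineation, the support of an admissible map is one of the listed sets. -/
theorem Admissible.exists_hasSupport {ε : G → G → ℂ} (hε : Admissible ε) :
    ∃ σ : G ≃+ G, ∃ i ∈ Finset.Icc 1 24, HasSupport (fun g h => ε (σ g) (σ h)) i := by
  have hS : Nice fun g h => decide (g ≠ 0 ∧ h ≠ 0 ∧ g ≠ h ∧ ε g h ≠ 0) := by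
    refine ⟨fun g h => ?_, fun g h k hgen => ?_⟩
    · rw [decide_eq_decide]
      constructor <;> rintro ⟨h1, h2, h3, h4⟩
      · exact ⟨h2, h1, h3.symm, by rwa [← hε.symm g h h1 h2 h3]⟩
      · exact ⟨h2, h1, h3.symm, by rwa [hε.symm g h h2 h1 h3.symm]⟩
    · obtain ⟨hg, hh, hk, hhk, hkg, hs, hs', h3, h4⟩ := generic_ne hgen
      simp only [decide_eq_true_eq]
      rintro ⟨-, -, -, h5⟩ ⟨-, -, -, h6⟩
      have h7 := hε.jacobi g h k hgen ▸ mul_ne_zero h5 h6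
      exact ⟨⟨hh, hs', h4, left_ne_zero_of_mul h7⟩, hk, hg, hkg, right_ne_zero_of_mul h7⟩
  obtain ⟨σ, i, hi, h⟩ := hS.exists_collineation
  refine ⟨σ, i, hi, fun g k hg hk hgk => ?_⟩
  rw [← h g k hg hk hgk, decide_eq_true_eq]
  simp [hg, hk, hgk]

/-- Every admissible map is equivalent to one of the representatives. -/
theorem Admissible.exists_equivalent {ε : G → G → ℂ} (hε : Admissible ε) :
    (∃ i ∈ isolated, (Γ t).Equivalent ε (epsT i)) ∨
      (∃ l : ℂ, l ≠ 0 ∧ (Γ t).Equivalent ε (eps14 l)) ∨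
      (∃ l : ℂ, l ≠ 0 ∧ (Γ t).Equivalent ε (eps17 l)) ∨
      (∃ l m : ℂ, l ≠ 0 ∧ m ≠ 0 ∧ (Γ t).Equivalent ε (eps20 l m)) := by
  obtain ⟨σ, i, hi, hT⟩ := hε.exists_hasSupport
  have hA := hε.comp σ
  have hE : (Γ t).Equivalent ε (fun g h => ε (σ g) (σ h)) := equivalent_comp ε σ
  generalize (fun g h => ε (σ g) (σ h)) = ε' at hT hA hE
  have isol : ∀ i, i ∈ isolated → (Γ t).Equivalent ε' (epsT i) →
      ∃ i ∈ isolated, (Γ t).Equivalent ε (epsT i) := fun i hi h => ⟨i, hi, hE.trans h⟩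
  rw [Finset.mem_Icc] at hi
  obtain ⟨hi1, hi2⟩ := hi
  interval_cases i
  · exact Or.inl (isol 1 (by decide) (equivalent_epsT_1 hA hT))
  · exact Or.inl (isol 2 (by decide) (equivalent_epsT_2 hA hT))
  · exact Or.inl (isol 3 (by decide) (equivalent_epsT_3 hA hT))
  · exact Or.inl (isol 4 (by decide) (equivalent_epsT_4 hA hT))
  · exact Or.inl (isol 5 (by decide) (equivalent_epsT_5 hA hT))
  · exact Or.inl (isol 6 (by decide) (equivalent_epsT_6 hA hT))
  · exact Or.inl (isol 7 (by decide) (equivalent_epsT_7 hA hT))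
  · exact Or.inl (isol 10 (by decide) ((equivalent_epsT_8 hA hT).trans equivalent_epsT_8_10))
  · exact Or.inl (isol 9 (by decide) (equivalent_epsT_9 hA hT))
  · exact Or.inl (isol 10 (by decide) (equivalent_epsT_10 hA hT))
  · exact Or.inl (isol 11 (by decide) (equivalent_epsT_11 hA hT))
  · exact Or.inl (isol 12 (by decide) (equivalent_epsT_12 hA hT))
  · exact Or.inl (isol 13 (by decide) (equivalent_epsT_13 hA hT))
  · have h := mul_ne_zero (hT.ne_zero 1 2 (by decide)) (hT.ne_zero 1 5 (by decide))
    have h' := mul_ne_zero (hT.ne_zero 1 3 (by decide)) (hT.ne_zero 1 6 (by decide))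
    exact Or.inr (Or.inl ⟨_, div_ne_zero h' h,
      hE.trans (equivalent_eps14 hA hT (div_mul_cancel₀ _ h))⟩)
  · exact Or.inl (isol 15 (by decide) (equivalent_epsT_15 hA hT))
  · exact Or.inl (isol 16 (by decide) (equivalent_epsT_16 hA hT))
  · have h := mul_ne_zero (hT.ne_zero 1 2 (by decide)) (hT.ne_zero 1 5 (by decide))
    have h' := mul_ne_zero (hT.ne_zero 1 3 (by decide)) (hT.ne_zero 1 6 (by decide))
    obtain ⟨l, hl, hl'⟩ := exists_sq_mul_eq h' h
    exact Or.inr (Or.inr (Or.inl ⟨l, hl, hE.trans (equivalent_eps17 hA hT hl hl')⟩))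
  · exact Or.inl (isol 18 (by decide) (equivalent_epsT_18 hA hT))
  · exact Or.inl (isol 19 (by decide) (equivalent_epsT_19 hA hT))
  · have h := mul_ne_zero (hT.ne_zero 1 2 (by decide)) (hT.ne_zero 1 5 (by decide))
    have h' := mul_ne_zero (hT.ne_zero 1 3 (by decide)) (hT.ne_zero 1 6 (by decide))
    have h'' := mul_ne_zero (hT.ne_zero 1 4 (by decide)) (hT.ne_zero 1 7 (by decide))
    obtain ⟨l, hl, hl'⟩ := exists_sq_mul_eq h' h
    obtain ⟨m, hm, hm'⟩ := exists_sq_mul_eq h'' h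
    exact Or.inr (Or.inr (Or.inr ⟨l, m, hl, hm, hE.trans (equivalent_eps20 hA hT hl hm hl' hm')⟩))
  · exact Or.inl (isol 21 (by decide) (equivalent_epsT_21 hA hT))
  · exact Or.inl (isol 22 (by decide) (equivalent_epsT_22 hA hT))
  · exact Or.inl (isol 23 (by decide) (equivalent_epsT_23 hA hT))
  · exact Or.inl (isol 24 (by decide) (equivalent_epsT_24 hA hT))

end Octonion

open Octonion LieGrading in
/-- Classification up to equivalence of the graded contractions of `Γ_{𝔟₃}` and `Γ_{𝔡₄}`. -/
theorem mainTheorem1 (t : OrthType) :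
    -- all the listed maps are graded contractions
    ((∀ i ∈ isolated, (Γ t).IsGradedContraction (epsT i)) ∧
      (∀ l : ℂ, l ≠ 0 → (Γ t).IsGradedContraction (eps14 l)) ∧
      (∀ l : ℂ, l ≠ 0 → (Γ t).IsGradedContraction (eps17 l)) ∧
      (∀ l m : ℂ, l ≠ 0 → m ≠ 0 → (Γ t).IsGradedContraction (eps20 l m))) ∧
    -- every graded contraction is equivalent to one of them
    (∀ ε : G → G → ℂ, (Γ t).IsGradedContraction ε →
      (∃ i ∈ isolated, (Γ t).Equivalent ε (epsT i)) ∨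
      (∃ l : ℂ, l ≠ 0 ∧ (Γ t).Equivalent ε (eps14 l)) ∨
      (∃ l : ℂ, l ≠ 0 ∧ (Γ t).Equivalent ε (eps17 l)) ∨
      (∃ l m : ℂ, l ≠ 0 ∧ m ≠ 0 ∧ (Γ t).Equivalent ε (eps20 l m))) ∧
    -- the isolated ones are pairwise inequivalent
    (∀ i ∈ isolated, ∀ j ∈ isolated, (Γ t).Equivalent (epsT i) (epsT j) → i = j) ∧
    -- no isolated one is equivalent to a member of a family
    (∀ i ∈ isolated,
      (∀ l : ℂ, l ≠ 0 → ¬ (Γ t).Equivalent (epsT i) (eps14 l)) ∧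
      (∀ l : ℂ, l ≠ 0 → ¬ (Γ t).Equivalent (epsT i) (eps17 l)) ∧
      (∀ l m : ℂ, l ≠ 0 → m ≠ 0 → ¬ (Γ t).Equivalent (epsT i) (eps20 l m))) ∧
    -- members of different families are inequivalent
    ((∀ l l' : ℂ, l ≠ 0 → l' ≠ 0 → ¬ (Γ t).Equivalent (eps14 l) (eps17 l')) ∧
      (∀ l l' m' : ℂ, l ≠ 0 → l' ≠ 0 → m' ≠ 0 → ¬ (Γ t).Equivalent (eps14 l) (eps20 l' m')) ∧
      (∀ l l' m' : ℂ, l ≠ 0 → l' ≠ 0 → m' ≠ 0 → ¬ (Γ t).Equivalent (eps17 l) (eps20 l' m'))) ∧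
    -- equivalence inside each family
    (∀ l l' : ℂ, l ≠ 0 → l' ≠ 0 →
      ((Γ t).Equivalent (eps14 l) (eps14 l') ↔ l' ∈ ({l, 1 / l} : Set ℂ))) ∧
    (∀ l l' : ℂ, l ≠ 0 → l' ≠ 0 →
      ((Γ t).Equivalent (eps17 l) (eps17 l') ↔ l' ∈ ({l, -l, 1 / l, -(1 / l)} : Set ℂ))) ∧
    (∀ l m l' m' : ℂ, l ≠ 0 → m ≠ 0 → l' ≠ 0 → m' ≠ 0 →
      ((Γ t).Equivalent (eps20 l m) (eps20 l' m') ↔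
        ({l', -l', m', -m'} : Set ℂ) = {l, -l, m, -m} ∨
        ({l', -l', m', -m'} : Set ℂ) = {1 / l, -(1 / l), m / l, -(m / l)} ∨
        ({l', -l', m', -m'} : Set ℂ) = {l / m, -(l / m), 1 / m, -(1 / m)})) := by
  have hsub : ∀ i ∈ isolated, i ∈ Finset.Icc 1 24 \ {8} := by decide
  have hfam : ∀ i ∈ isolated, i ≠ 14 ∧ i ≠ 17 ∧ i ≠ 20 := by decide
  refine ⟨⟨fun i hi => (admissible_epsT i hi).isGradedContraction,
    fun l hl => (admissible_eps14 hl).isGradedContraction,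
    fun l hl => (admissible_eps17 hl).isGradedContraction,
    fun l m hl hm => (admissible_eps20 hl hm).isGradedContraction⟩,
    fun ε hε => (Admissible.of_isGradedContraction hε).exists_equivalent,
    fun i hi j hj h => index_eq_of_equivalent h (hasSupport_epsT i) (hasSupport_epsT j)
      (hsub i hi) (hsub j hj),
    fun i hi => ⟨fun l hl h => (hfam i hi).1 (index_eq_of_equivalent h (hasSupport_epsT i)
        (hasSupport_eps14 hl) (hsub i hi) (by decide)),
      fun l hl h => (hfam i hi).2.1 (index_eq_of_equivalent h (hasSupport_epsT i)
        (hasSupport_eps17 hl) (hsub i hi) (by decide)),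
      fun l m hl hm h => (hfam i hi).2.2 (index_eq_of_equivalent h (hasSupport_epsT i)
        (hasSupport_eps20 hl hm) (hsub i hi) (by decide))⟩,
    ⟨fun l l' hl hl' h => absurd (index_eq_of_equivalent h (hasSupport_eps14 hl)
        (hasSupport_eps17 hl') (by decide) (by decide)) (by decide),
      fun l l' m' hl hl' hm' h => absurd (index_eq_of_equivalent h (hasSupport_eps14 hl)
        (hasSupport_eps20 hl' hm') (by decide) (by decide)) (by decide),
      fun l l' m' hl hl' hm' h => absurd (index_eq_of_equivalent h (hasSupport_eps17 hl)
        (hasSupport_eps20 hl' hm') (by decide) (by decide)) (by decide)⟩,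
    fun l l' hl hl' => equivalent_eps14_iff hl hl',
    fun l l' hl hl' => equivalent_eps17_iff hl hl',
    fun l m l' m' hl hm hl' hm' => equivalent_eps20_iff hl hm hl' hm'⟩
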